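/- **Notation.** Composition of functors and horizontal composition of natural transformations are written by juxtaposition, vertical composition as $\circ$; a functor also denotes its identity transformation. Let $\mathcal A$ and $\mathcal B$ be categories. An object of $\mathrm{Adj}(\mathcal A,\mathcal B)$ is a category $\mathcal T$ with adjunctions $N_A\dashv R_A$ and $N_B\dashv R_B$, where $N_A:\mathcal A\to\mathcal T$, $N_B:\mathcal B\to\mathcal T$, with units $\eta^A,\eta^B$ and counits $\epsilon^A,\epsilon^B$. A morphism $(\mathcal T,(N_A,R_A),(N_B,R_B))\to(\mathcal T',(N'_A,R'_A),(N'_B,R'_B))$ is a functor $F:\mathcal T'\to\mathcal T$ with $R_AF=R'_A$ and $R_BF=R'_B$; put $a=(\epsilon^AFN'_A)\circ(N_A\eta'^A):N_A\to FN'_A$ and $b=(\epsilon^BFN'_B)\circ(N_B\eta'^B):N_B\to FN'_B$. An object of $\mathrm{PreTor}(\mathcal A,\mathcal B)$ (a pre-torsor) is an object of $\mathrm{Adj}(\mathcal A,\mathcal B)$ with a natural transformation $\tau:R_AN_B\to R_AN_BR_BN_AR_AN_B$ such that $(R_AN_BR_B\epsilon^AN_B)\circ\tau=R_AN_B\eta^B$,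 $(R_A\epsilon^BN_AR_AN_B)\circ\tau=\eta^AR_AN_B$ and $(R_AN_BR_BN_A\tau)\circ\tau=(\tau R_BN_AR_AN_B)\circ\tau$. A morphism is a morphism $F$ in $\mathrm{Adj}(\mathcal A,\mathcal B)$ with $(R_Ab\,R_Ba\,R_Ab)\circ\tau=\tau'\circ(R_Ab)$. An object of $\mathrm{Arr}(\mathcal A,\mathcal B)$ is an object of $\mathrm{Adj}(\mathcal A,\mathcal B)$ with a comonad $\mathbb C=(C,\Delta,\varepsilon)$ on $\mathcal A$ and a natural transformation $\xi:CR_A\to R_AN_BR_B$ such that $(R_A,\xi)$ is a comonad arrow from $\mathbb C$ to the comonad $(N_BR_B,N_B\eta^BR_B,\epsilon^B)$, i.e. $(R_A\epsilon^B)\circ\xi=\varepsilon R_A$ and $(R_AN_B\eta^BR_B)\circ\xi=(\xi N_BR_B)\circ(C\xi)\circ(\Delta R_A)$. A morphism is a pair $(F,t)$ of a morphism $F$ in $\mathrm{Adj}(\mathcal A,\mathcal B)$ and a comonad morphism $t:\mathbb C\to\mathbb C'$ with $(R_AbR'_B)\circ(\xi F)=\xi'\circ(tR'_A)$. An adjunction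 $N\dashv R$ with unit $\eta$ is *regular* if $\eta$ is a regular monomorphism in the category of endofunctors and $N$ preserves equalizers. $\mathrm{PreTor}_{reg}(\mathcal A,\mathcal B)$ is the full subcategory of $\mathrm{PreTor}(\mathcal A,\mathcal B)$ of objects for which both adjunctions are regular. $\mathrm{RArr}_{reg}(\mathcal A,\mathcal B)$ (resp. $\overline{\mathrm{RArr}}_{reg}(\mathcal A,\mathcal B)$) is the full subcategory of $\mathrm{Arr}(\mathcal A,\mathcal B)$ of objects for which both adjunctions are regular, $C$ preserves equalizers, and $\xi$ (resp. $\overline\xi:=(\epsilon^AN_BR_BN_A)\circ(N_A\xi N_A)\circ(N_AC\eta^A):N_AC\to N_BR_BN_A$) is an isomorphism. **Theorem.** Let $\mathcal A$ and $\mathcal B$ be categories with equalizers. Then the categories (i) $\mathrm{PreTor}_{reg}(\mathcal A,\mathcal B)$, (ii) $\mathrm{RArr}_{reg}(\mathcal A,\mathcal B)$, (iii) $\overline{\mathrm{RArr}}_{reg}(\mathcal B,\mathcal A)$ are equivalent. More precisely: (1) There are well-defined functors $\Gamma:\mathrm{PreTor}_{reg}(\mathcal A,\mathcal B)\to\mathrm{RArr}_{reg}(\mathcal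 A,\mathcal B)$ and $\Omega$ in the opposite direction, as follows, that are mutually inverse equivalences, with $\Omega\Gamma=\mathrm{Id}$ and $\Gamma\Omega\cong\mathrm{Id}$. Both keep the pair of adjunctions and the functor $F$ underlying a morphism. $\Omega$ replaces $(\mathbb C,\xi)$ by $$\tau=(\xi N_AR_AN_B)\circ(C\eta^AR_AN_B)\circ(\xi^{-1}N_B)\circ(R_AN_B\eta^B).$$ $\Gamma$ replaces $\tau$ by $(\mathbb C,\xi)$, where $i:C\to R_AN_BR_BN_A$ is an equalizer, in the category of endofunctors of $\mathcal A$, of $(R_AN_BR_BN_AR_A\epsilon^BN_A)\circ(\tau R_BN_A)$ and $R_AN_BR_BN_A\eta^A$, and $(ii)\circ\Delta=(\tau R_BN_A)\circ i$, $\eta^A\circ\varepsilon=(R_A\epsilon^BN_A)\circ i$, $\xi=(R_AN_BR_B\epsilon^A)\circ(iR_A)$. (2) There are well-defined functors $\overline\Gamma:\mathrm{PreTor}_{reg}(\mathcal A,\mathcal B)\to\overline{\mathrm{RArr}}_{reg}(\mathcal B,\mathcal A)$ and $\overline\Omega$ in the opposite direction, as follows, that are mutually inverse equivalences, with $\overline\Omega\,\overline\Gamma=\mathrm{Id}$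 and $\overline\Gamma\,\overline\Omega\cong\mathrm{Id}$. Both exchange the two adjunctions and keep the functor $F$ underlying a morphism. $\overline\Omega$ replaces $(\mathbb D,\zeta)$, $\zeta:DR_B\to R_BN_AR_A$, by $$\tau=(R_AN_BR_B\overline\zeta)\circ(R_AN_B\eta^BD)\circ(R_A\overline\zeta^{-1})\circ(\eta^AR_AN_B),\qquad \overline\zeta=(\epsilon^BN_AR_AN_B)\circ(N_B\zeta N_B)\circ(N_BD\eta^B).$$ $\overline\Gamma$ replaces $\tau$ by $(\mathbb D,\zeta)$, where $j:D\to R_BN_AR_AN_B$ is an equalizer, in the category of endofunctors of $\mathcal B$, of $(R_B\epsilon^AN_BR_BN_AR_AN_B)\circ(R_BN_A\tau)$ and $\eta^BR_BN_AR_AN_B$, and $(jj)\circ\Delta=(R_BN_A\tau)\circ j$, $\eta^B\circ\varepsilon=(R_B\epsilon^AN_B)\circ j$, $\zeta=(R_BN_AR_A\epsilon^B)\circ(jR_B)$. -/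

import Mathlib

open CategoryTheory CategoryTheory.Limits

set_option linter.checkUnivs false

universe v₁ v₂ v₃ v₄ u₁ u₂ u₃ u₄

namespace RegTorsor

/-! ## Comonad arrows -/

section ComonadArrow

variable {K : Type u₁} [Category.{v₁} K] {K' : Type u₂} [Category.{v₂} K']

/-- `(F, ξ)` is a comonad arrow from the comonad `C` on `K` to the comonad `C'` on `K'`, where
`F : K' ⥤ K` and `ξ : C F ⟶ F C'`:
`(F ε') ∘ ξ = ε F` and `(F Δ') ∘ ξ = (ξ C') ∘ (C ξ) ∘ (Δ F)`. -/
structure IsComonadArrow (C : Comonad K) (C' : Comonad K') (F : K' ⥤ K)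
    (ξ : F ⋙ C.toFunctor ⟶ C'.toFunctor ⋙ F) : Prop where
  counit : ∀ z : K', ξ.app z ≫ F.map (C'.ε.app z) = C.ε.app (F.obj z)
  comul : ∀ z : K', ξ.app z ≫ F.map (C'.δ.app z) =
    C.δ.app (F.obj z) ≫ C.map (ξ.app z) ≫ ξ.app (C'.obj z)

/-- For an adjunction `G ⊣ F` with unit `η` and counit `ϵ`, and `ξ : C F ⟶ F C'`, the natural
transformation `(ϵ C' G) ∘ (G ξ G) ∘ (G C η) : G C ⟶ C' G`. -/
def coMate {C : K ⥤ K} {C' : K' ⥤ K'} {F : K' ⥤ K} {G : K ⥤ K'} (adj : G ⊣ F)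
    (ξ : F ⋙ C ⟶ C' ⋙ F) : C ⋙ G ⟶ G ⋙ C' where
  app x := G.map (C.map (adj.unit.app x)) ≫ G.map (ξ.app (G.obj x)) ≫
    adj.counit.app (C'.obj (G.obj x))
  naturality x y f := by
    have h1 : C.map f ≫ C.map (adj.unit.app y) =
        C.map (adj.unit.app x) ≫ C.map (F.map (G.map f)) := by
      rw [← C.map_comp, ← C.map_comp]
      exact congrArg C.map (adj.unit.naturality f)
    have h2 : C.map (F.map (G.map f)) ≫ ξ.app (G.obj y) =
        ξ.app (G.obj x) ≫ F.map (C'.map (G.map f)) := ξ.naturality (G.map f)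
    have h3 : G.map (F.map (C'.map (G.map f))) ≫ adj.counit.app (C'.obj (G.obj y)) =
        adj.counit.app (C'.obj (G.obj x)) ≫ C'.map (G.map f) :=
      adj.counit.naturality (C'.map (G.map f))
    simp only [Functor.comp_map, Functor.comp_obj, Category.assoc]
    rw [← Category.assoc, ← G.map_comp, h1, G.map_comp, Category.assoc, ← h3,
      ← Category.assoc (G.map (C.map (F.map (G.map f)))), ← G.map_comp, h2, G.map_comp,
      Category.assoc]

end ComonadArrow

/-- An adjunction `N ⊣ R` is regular if its unit is a regular monomorphism in the category of
endofunctors and `N` preserves equalizers. -/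
structure IsRegularAdj {K : Type u₁} [Category.{v₁} K] {T : Type u₂} [Category.{v₂} T]
    {N : K ⥤ T} {R : T ⥤ K} (adj : N ⊣ R) : Prop where
  unit_regular : IsRegularMono adj.unit
  preserves : PreservesLimitsOfShape WalkingParallelPair N

/-- `(E, i)` is the equalizer of `f` and `g`. -/
def IsEqualizer {K : Type u₁} [Category.{v₁} K] {E X Y : K} (i : E ⟶ X) (f g : X ⟶ Y) : Prop :=
  ∃ w : i ≫ f = i ≫ g, Nonempty (IsLimit (Fork.ofι i w))

/-! ## The comparison of left adjoints -/

section Comparison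

variable {K : Type u₁} [Category.{v₁} K] {T : Type u₂} [Category.{v₂} T]
  {T' : Type u₃} [Category.{v₃} T'] {T'' : Type u₄} [Category.{v₄} T'']
  {N : K ⥤ T} {R : T ⥤ K} {N' : K ⥤ T'} {R' : T' ⥤ K} {N'' : K ⥤ T''} {R'' : T'' ⥤ K}

/-- For adjunctions `N ⊣ R` and `N' ⊣ R'` and a functor `F` with `R F = R'`, the natural
transformation `(ϵ F N') ∘ (N η') : N ⟶ F N'`; it is well typed since `N R' N' = N R F N'`. -/
def cmp (adj : N ⊣ R) (adj' : N' ⊣ R') (F : T' ⥤ T) (h : F ⋙ R = R') : N ⟶ N' ⋙ F :=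
  Functor.whiskerRight adj'.unit N ≫
    Functor.whiskerRight (Functor.whiskerLeft N' (eqToHom h.symm)) N ≫
    Functor.whiskerLeft (N' ⋙ F) adj.counit

theorem cmp_app (adj : N ⊣ R) (adj' : N' ⊣ R') (F : T' ⥤ T) (h : F ⋙ R = R') (x : K) :
    (cmp adj adj' F h).app x =
      N.map (adj'.unit.app x) ≫ N.map ((eqToHom h.symm : R' ⟶ F ⋙ R).app (N'.obj x)) ≫
        adj.counit.app (F.obj (N'.obj x)) := rfl

theorem cmp_id (adj : N ⊣ R) (x : K) : (cmp adj adj (𝟭 T) rfl).app x = 𝟙 (N.obj x) := by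
  simp [cmp_app]

theorem cmp_comp (adj : N ⊣ R) (adj' : N' ⊣ R') (adj'' : N'' ⊣ R'') (F : T' ⥤ T) (G : T'' ⥤ T')
    (h : F ⋙ R = R') (k : G ⋙ R' = R'') (l : (G ⋙ F) ⋙ R = R'') (x : K) :
    (cmp adj adj'' (G ⋙ F) l).app x =
      (cmp adj adj' F h).app x ≫ F.map ((cmp adj' adj'' G k).app x) := by
  subst h
  subst k
  have h1 : ∀ {y z : T'} (f : y ⟶ z), N.map (R.map (F.map f)) ≫ adj.counit.app (F.obj z) =
      adj.counit.app (F.obj y) ≫ F.map f := fun f => adj.counit.naturality (F.map f)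
  have h2 : adj'.unit.app (R.obj (F.obj (G.obj (N''.obj x)))) ≫
      R.map (F.map (adj'.counit.app (G.obj (N''.obj x)))) = 𝟙 _ :=
    adj'.right_triangle_components (G.obj (N''.obj x))
  have h3 : adj''.unit.app x ≫ adj'.unit.app (R.obj (F.obj (G.obj (N''.obj x)))) =
      adj'.unit.app x ≫ R.map (F.map (N'.map (adj''.unit.app x))) :=
    adj'.unit.naturality (adj''.unit.app x)
  have h4 : adj''.unit.app x = adj'.unit.app x ≫
      R.map (F.map (N'.map (adj''.unit.app x) ≫ adj'.counit.app (G.obj (N''.obj x)))) := by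
    rw [F.map_comp, R.map_comp, ← Category.assoc, ← h3, Category.assoc, h2]
    exact (Category.comp_id _).symm
  have e1 : (cmp adj adj'' (G ⋙ F) l).app x =
      N.map (adj''.unit.app x) ≫ adj.counit.app (F.obj (G.obj (N''.obj x))) := by
    simp [cmp_app]
  have e2 : (cmp adj adj' F rfl).app x =
      N.map (adj'.unit.app x) ≫ adj.counit.app (F.obj (N'.obj x)) := by
    simp [cmp_app]
  have e3 : (cmp adj' adj'' G rfl).app x =
      N'.map (adj''.unit.app x) ≫ adj'.counit.app (G.obj (N''.obj x)) := by
    simp [cmp_app]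
  rw [e1, e2, e3, Category.assoc, ← h1, ← Category.assoc, ← N.map_comp]
  exact congrArg (fun f => N.map f ≫ adj.counit.app (F.obj (G.obj (N''.obj x)))) h4

end Comparison

/-! ## Pairs of adjunctions -/

section Adj

variable (A : Type u₁) [Category.{v₁} A] (B : Type u₂) [Category.{v₂} B]

/-- An object of `Adj(A, B)`: a category `T` with adjunctions `NA ⊣ RA` and `NB ⊣ RB`, where
`NA : A ⥤ T` and `NB : B ⥤ T`. -/
structure AdjObj where
  T : Type u₃
  [cat : Category.{v₃} T]
  NA : A ⥤ T
  RA : T ⥤ A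
  adjA : NA ⊣ RA
  NB : B ⥤ T
  RB : T ⥤ B
  adjB : NB ⊣ RB

attribute [instance] AdjObj.cat

end Adj

variable {A : Type u₁} [Category.{v₁} A] {B : Type u₂} [Category.{v₂} B]

namespace AdjObj

variable (X : AdjObj.{v₁, v₂, v₃, u₁, u₂, u₃} A B)

/-- The functor `R_A N_B : B ⥤ A`. -/
abbrev Q : B ⥤ A := X.NB ⋙ X.RA

/-- The functor `R_B N_A : A ⥤ B`. -/
abbrev P : A ⥤ B := X.NA ⋙ X.RB

/-- The same pair of adjunctions in the opposite order. -/
def swap : AdjObj.{v₂, v₁, v₃, u₂, u₁, u₃} B A where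
  T := X.T
  NA := X.NB
  RA := X.RB
  adjA := X.adjB
  NB := X.NA
  RB := X.RA
  adjB := X.adjA

end AdjObj

/-- A morphism `X ⟶ Y` in `Adj(A, B)`: a functor `F : T_Y ⥤ T_X` with `R_A F = R'_A` and
`R_B F = R'_B` (equalities of functors). -/
@[ext]
structure AdjHom (X Y : AdjObj.{v₁, v₂, v₃, u₁, u₂, u₃} A B) where
  F : Y.T ⥤ X.T
  hA : F ⋙ X.RA = Y.RA
  hB : F ⋙ X.RB = Y.RB

instance : Category (AdjObj.{v₁, v₂, v₃, u₁, u₂, u₃} A B) where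
  Hom := AdjHom
  id X := ⟨𝟭 X.T, rfl, rfl⟩
  comp {X Y Z} f g := ⟨g.F ⋙ f.F,
    show g.F ⋙ (f.F ⋙ X.RA) = Z.RA by rw [f.hA, g.hA],
    show g.F ⋙ (f.F ⋙ X.RB) = Z.RB by rw [f.hB, g.hB]⟩

namespace AdjHom

variable {X Y Z : AdjObj.{v₁, v₂, v₃, u₁, u₂, u₃} A B}

/-- The identity `R_A F = R'_A`, as a natural transformation. -/
def eqA (f : X ⟶ Y) : f.F ⋙ X.RA ⟶ Y.RA := eqToHom f.hA

/-- The identity `R_B F = R'_B`, as a natural transformation. -/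
def eqB (f : X ⟶ Y) : f.F ⋙ X.RB ⟶ Y.RB := eqToHom f.hB

/-- The natural transformation `a := (ϵ^A F N'_A) ∘ (N_A η'^A) : N_A ⟶ F N'_A`. -/
def a (f : X ⟶ Y) : X.NA ⟶ Y.NA ⋙ f.F := cmp X.adjA Y.adjA f.F f.hA

/-- The natural transformation `b := (ϵ^B F N'_B) ∘ (N_B η'^B) : N_B ⟶ F N'_B`. -/
def b (f : X ⟶ Y) : X.NB ⟶ Y.NB ⋙ f.F := cmp X.adjB Y.adjB f.F f.hB

/-- `R_A b : R_A N_B ⟶ R_A F N'_B = R'_A N'_B`. -/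
def Rb (f : X ⟶ Y) : X.Q ⟶ Y.Q :=
  Functor.whiskerRight (b f) X.RA ≫ Functor.whiskerLeft Y.NB (eqA f)

/-- `R_B a : R_B N_A ⟶ R_B F N'_A = R'_B N'_A`. -/
def Ra (f : X ⟶ Y) : X.P ⟶ Y.P :=
  Functor.whiskerRight (a f) X.RB ≫ Functor.whiskerLeft Y.NA (eqB f)

theorem Rb_app (f : X ⟶ Y) (x : B) : (Rb f).app x =
    X.RA.map ((b f).app x) ≫ (eqA f).app (Y.NB.obj x) := rfl

theorem Ra_app (f : X ⟶ Y) (x : A) : (Ra f).app x =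
    X.RB.map ((a f).app x) ≫ (eqB f).app (Y.NA.obj x) := rfl

theorem eqA_id_app (z : X.T) : (eqA (𝟙 X)).app z = 𝟙 (X.RA.obj z) := rfl

theorem eqB_id_app (z : X.T) : (eqB (𝟙 X)).app z = 𝟙 (X.RB.obj z) := rfl

theorem eqA_comp_app (f : X ⟶ Y) (g : Y ⟶ Z) (z : Z.T) :
    (eqA (f ≫ g)).app z = (eqA f).app (g.F.obj z) ≫ (eqA g).app z := by
  simp only [eqA, eqToHom_app]
  exact (eqToHom_trans _ _).symm

theorem eqB_comp_app (f : X ⟶ Y) (g : Y ⟶ Z) (z : Z.T) :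
    (eqB (f ≫ g)).app z = (eqB f).app (g.F.obj z) ≫ (eqB g).app z := by
  simp only [eqB, eqToHom_app]
  exact (eqToHom_trans _ _).symm

theorem b_id_app (x : B) : (b (𝟙 X)).app x = 𝟙 (X.NB.obj x) := cmp_id X.adjB x

theorem a_id_app (x : A) : (a (𝟙 X)).app x = 𝟙 (X.NA.obj x) := cmp_id X.adjA x

theorem b_comp_app (f : X ⟶ Y) (g : Y ⟶ Z) (x : B) :
    (b (f ≫ g)).app x = (b f).app x ≫ f.F.map ((b g).app x) :=
  cmp_comp X.adjB Y.adjB Z.adjB f.F g.F f.hB g.hB _ x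

theorem a_comp_app (f : X ⟶ Y) (g : Y ⟶ Z) (x : A) :
    (a (f ≫ g)).app x = (a f).app x ≫ f.F.map ((a g).app x) :=
  cmp_comp X.adjA Y.adjA Z.adjA f.F g.F f.hA g.hA _ x

theorem eqA_naturality (f : X ⟶ Y) {y z : Y.T} (m : y ⟶ z) :
    X.RA.map (f.F.map m) ≫ (eqA f).app z = (eqA f).app y ≫ Y.RA.map m :=
  (eqA f).naturality m

theorem eqB_naturality (f : X ⟶ Y) {y z : Y.T} (m : y ⟶ z) :
    X.RB.map (f.F.map m) ≫ (eqB f).app z = (eqB f).app y ≫ Y.RB.map m :=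
  (eqB f).naturality m

theorem Rb_id : Rb (𝟙 X) = 𝟙 X.Q := by
  ext x
  rw [Rb_app, b_id_app, X.RA.map_id]
  exact Category.id_comp _

theorem Ra_id : Ra (𝟙 X) = 𝟙 X.P := by
  ext x
  rw [Ra_app, a_id_app, X.RB.map_id]
  exact Category.id_comp _

theorem Rb_comp (f : X ⟶ Y) (g : Y ⟶ Z) : Rb (f ≫ g) = Rb f ≫ Rb g := by
  ext x
  rw [NatTrans.comp_app, Rb_app, Rb_app, Rb_app, b_comp_app, X.RA.map_comp, eqA_comp_app,
    Category.assoc, Category.assoc, ← Category.assoc ((eqA f).app (Y.NB.obj x))]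
  congr 1
  rw [← eqA_naturality, Category.assoc]
  rfl

theorem Ra_comp (f : X ⟶ Y) (g : Y ⟶ Z) : Ra (f ≫ g) = Ra f ≫ Ra g := by
  ext x
  rw [NatTrans.comp_app, Ra_app, Ra_app, Ra_app, a_comp_app, X.RB.map_comp, eqB_comp_app,
    Category.assoc, Category.assoc, ← Category.assoc ((eqB f).app (Y.NA.obj x))]
  congr 1
  rw [← eqB_naturality, Category.assoc]
  rfl

end AdjHom

/-- Exchanging the two adjunctions, as a functor `Adj(A, B) ⥤ Adj(B, A)`. -/
def swapFunctor (A : Type u₁) [Category.{v₁} A] (B : Type u₂) [Category.{v₂} B] :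
    AdjObj.{v₁, v₂, v₃, u₁, u₂, u₃} A B ⥤ AdjObj.{v₂, v₁, v₃, u₂, u₁, u₃} B A where
  obj X := X.swap
  map f := ⟨f.F, f.hB, f.hA⟩

/-! ## Pre-torsors -/

/-- The axioms of a pre-torsor for `τ : R_A N_B ⟶ R_A N_B R_B N_A R_A N_B`:
`(R_A N_B R_B ϵ^A N_B) ∘ τ = R_A N_B η^B`, `(R_A ϵ^B N_A R_A N_B) ∘ τ = η^A R_A N_B` and
`(R_A N_B R_B N_A τ) ∘ τ = (τ R_B N_A R_A N_B) ∘ τ`. -/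
structure IsPreTorsor (X : AdjObj.{v₁, v₂, v₃, u₁, u₂, u₃} A B) (τ : X.Q ⟶ X.Q ⋙ X.P ⋙ X.Q) :
    Prop where
  counitA : ∀ y : B, τ.app y ≫ X.Q.map (X.RB.map (X.adjA.counit.app (X.NB.obj y))) =
    X.Q.map (X.adjB.unit.app y)
  counitB : ∀ y : B, τ.app y ≫ X.RA.map (X.adjB.counit.app (X.NA.obj (X.Q.obj y))) =
    X.adjA.unit.app (X.Q.obj y)
  coassoc : ∀ y : B, τ.app y ≫ X.Q.map (X.P.map (τ.app y)) =
    τ.app y ≫ τ.app (X.P.obj (X.Q.obj y))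

section Categories

variable (A : Type u₁) [Category.{v₁} A] (B : Type u₂) [Category.{v₂} B]

/-- The objects of `PreTor(A, B)`: pre-torsors. -/
structure PreTor where
  adj : AdjObj.{v₁, v₂, v₃, u₁, u₂, u₃} A B
  τ : adj.Q ⟶ adj.Q ⋙ adj.P ⋙ adj.Q
  isPreTorsor : IsPreTorsor adj τ

/-- The objects of `Arr(A, B)`: a pair of adjunctions, a comonad `C` on `A` and a comonad arrow
`(R_A, ξ)` from `C` to the comonad `(N_B R_B, N_B η^B R_B, ϵ^B)`. -/
structure Arr where
  adj : AdjObj.{v₁, v₂, v₃, u₁, u₂, u₃} A B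
  C : Comonad A
  ξ : adj.RA ⋙ C.toFunctor ⟶ (adj.RB ⋙ adj.NB) ⋙ adj.RA
  isComonadArrow : IsComonadArrow C adj.adjB.toComonad adj.RA ξ

end Categories

/-- A morphism of pre-torsors: a morphism of `Adj(A, B)` with
`(R_A b R_B a R_A b) ∘ τ = τ' ∘ (R_A b)`. -/
@[ext]
structure PreTorHom (X Y : PreTor.{v₁, v₂, v₃, u₁, u₂, u₃} A B) where
  f : X.adj ⟶ Y.adj
  comm : X.τ ≫ (AdjHom.Rb f ◫ (AdjHom.Ra f ◫ AdjHom.Rb f)) = AdjHom.Rb f ≫ Y.τ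

theorem PreTorHom.comm_id (X : PreTor.{v₁, v₂, v₃, u₁, u₂, u₃} A B) :
    X.τ ≫ (AdjHom.Rb (𝟙 X.adj) ◫ (AdjHom.Ra (𝟙 X.adj) ◫ AdjHom.Rb (𝟙 X.adj))) =
      AdjHom.Rb (𝟙 X.adj) ≫ X.τ := by
  rw [AdjHom.Rb_id, AdjHom.Ra_id]
  ext y
  simp

theorem PreTorHom.comm_comp {X Y Z : PreTor.{v₁, v₂, v₃, u₁, u₂, u₃} A B} (f : PreTorHom X Y)
    (g : PreTorHom Y Z) :
    X.τ ≫ (AdjHom.Rb (f.f ≫ g.f) ◫ (AdjHom.Ra (f.f ≫ g.f) ◫ AdjHom.Rb (f.f ≫ g.f))) =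
      AdjHom.Rb (f.f ≫ g.f) ≫ Z.τ := by
  rw [AdjHom.Rb_comp, AdjHom.Ra_comp, NatTrans.exchange, NatTrans.exchange, ← Category.assoc,
    f.comm, Category.assoc, g.comm, Category.assoc]

/-- The category `PreTor(A, B)`. -/
instance : Category (PreTor.{v₁, v₂, v₃, u₁, u₂, u₃} A B) where
  Hom := PreTorHom
  id X := ⟨𝟙 X.adj, PreTorHom.comm_id X⟩
  comp f g := ⟨f.f ≫ g.f, PreTorHom.comm_comp f g⟩

/-! ## Comonad arrows over a pair of adjunctions -/

/-- A morphism of `Arr(A, B)`: a morphism `F` of `Adj(A, B)` and a comonad morphism `t : C ⟶ C'`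
with `(R_A b R'_B) ∘ (ξ F) = ξ' ∘ (t R'_A)`. -/
@[ext]
structure ArrHom (X Y : Arr.{v₁, v₂, v₃, u₁, u₂, u₃} A B) where
  f : X.adj ⟶ Y.adj
  t : X.C ⟶ Y.C
  comm : ∀ z : Y.adj.T,
    X.ξ.app (f.F.obj z) ≫ X.adj.Q.map ((AdjHom.eqB f).app z) ≫
        (AdjHom.Rb f).app (Y.adj.RB.obj z) =
      X.C.map ((AdjHom.eqA f).app z) ≫ t.app (Y.adj.RA.obj z) ≫ Y.ξ.app z

theorem ArrHom.comm_id (X : Arr.{v₁, v₂, v₃, u₁, u₂, u₃} A B) (z : X.adj.T) :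
    X.ξ.app z ≫ X.adj.Q.map ((AdjHom.eqB (𝟙 X.adj)).app z) ≫
        (AdjHom.Rb (𝟙 X.adj)).app (X.adj.RB.obj z) =
      X.C.map ((AdjHom.eqA (𝟙 X.adj)).app z) ≫
        (𝟙 X.C : X.C ⟶ X.C).app (X.adj.RA.obj z) ≫ X.ξ.app z := by
  have h1 : X.adj.Q.map ((AdjHom.eqB (𝟙 X.adj)).app z) = 𝟙 _ := X.adj.Q.map_id _
  have h2 : X.C.map ((AdjHom.eqA (𝟙 X.adj)).app z) = 𝟙 _ := X.C.map_id _
  rw [AdjHom.Rb_id, h1, h2]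
  refine ((congrArg (X.ξ.app z ≫ ·) (Category.id_comp _)).trans (Category.comp_id _)).trans ?_
  exact ((Category.id_comp _).trans (Category.id_comp _)).symm

theorem ArrHom.comm_comp {X Y Z : Arr.{v₁, v₂, v₃, u₁, u₂, u₃} A B} (f : ArrHom X Y)
    (g : ArrHom Y Z) (z : Z.adj.T) :
    X.ξ.app ((f.f ≫ g.f).F.obj z) ≫ X.adj.Q.map ((AdjHom.eqB (f.f ≫ g.f)).app z) ≫
        (AdjHom.Rb (f.f ≫ g.f)).app (Z.adj.RB.obj z) =
      X.C.map ((AdjHom.eqA (f.f ≫ g.f)).app z) ≫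
        (f.t ≫ g.t : X.C ⟶ Z.C).app (Z.adj.RA.obj z) ≫ Z.ξ.app z := by
  have hf := f.comm (g.f.F.obj z)
  have hg := g.comm z
  have n1 : X.adj.Q.map ((AdjHom.eqB g.f).app z) ≫ (AdjHom.Rb f.f).app (Z.adj.RB.obj z) =
      (AdjHom.Rb f.f).app (Y.adj.RB.obj (g.f.F.obj z)) ≫
        Y.adj.Q.map ((AdjHom.eqB g.f).app z) := (AdjHom.Rb f.f).naturality _
  have n2 : X.C.map ((AdjHom.eqA g.f).app z) ≫ f.t.app (Z.adj.RA.obj z) =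
      f.t.app (Y.adj.RA.obj (g.f.F.obj z)) ≫ Y.C.map ((AdjHom.eqA g.f).app z) :=
    f.t.naturality _
  have e1 : (f.t ≫ g.t : X.C ⟶ Z.C).app (Z.adj.RA.obj z) =
    f.t.app (Z.adj.RA.obj z) ≫ g.t.app (Z.adj.RA.obj z) := rfl
  have e2 : X.C.map ((AdjHom.eqA (f.f ≫ g.f)).app z) =
      X.C.map ((AdjHom.eqA f.f).app (g.f.F.obj z)) ≫ X.C.map ((AdjHom.eqA g.f).app z) := by
    rw [AdjHom.eqA_comp_app]
    exact X.C.map_comp _ _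
  have e3 : X.adj.Q.map ((AdjHom.eqB (f.f ≫ g.f)).app z) =
      X.adj.Q.map ((AdjHom.eqB f.f).app (g.f.F.obj z)) ≫
        X.adj.Q.map ((AdjHom.eqB g.f).app z) := by
    rw [AdjHom.eqB_comp_app]
    exact X.adj.Q.map_comp _ _
  rw [e1, e2, e3, AdjHom.Rb_comp, NatTrans.comp_app]
  calc _ = X.ξ.app (f.f.F.obj (g.f.F.obj z)) ≫
          X.adj.Q.map ((AdjHom.eqB f.f).app (g.f.F.obj z)) ≫
          (X.adj.Q.map ((AdjHom.eqB g.f).app z) ≫ (AdjHom.Rb f.f).app (Z.adj.RB.obj z)) ≫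
          (AdjHom.Rb g.f).app (Z.adj.RB.obj z) := by simp only [Category.assoc]; rfl
    _ = (X.ξ.app (f.f.F.obj (g.f.F.obj z)) ≫
          X.adj.Q.map ((AdjHom.eqB f.f).app (g.f.F.obj z)) ≫
          (AdjHom.Rb f.f).app (Y.adj.RB.obj (g.f.F.obj z))) ≫
          Y.adj.Q.map ((AdjHom.eqB g.f).app z) ≫
          (AdjHom.Rb g.f).app (Z.adj.RB.obj z) := by rw [n1]; simp only [Category.assoc]
    _ = X.C.map ((AdjHom.eqA f.f).app (g.f.F.obj z)) ≫
          f.t.app (Y.adj.RA.obj (g.f.F.obj z)) ≫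
          Y.ξ.app (g.f.F.obj z) ≫ Y.adj.Q.map ((AdjHom.eqB g.f).app z) ≫
          (AdjHom.Rb g.f).app (Z.adj.RB.obj z) := by rw [hf]; simp only [Category.assoc]
    _ = X.C.map ((AdjHom.eqA f.f).app (g.f.F.obj z)) ≫
          (f.t.app (Y.adj.RA.obj (g.f.F.obj z)) ≫ Y.C.map ((AdjHom.eqA g.f).app z)) ≫
          g.t.app (Z.adj.RA.obj z) ≫ Z.ξ.app z := by rw [hg]; simp only [Category.assoc]
    _ = _ := by rw [← n2]; simp only [Category.assoc]

/-- The category `Arr(A, B)`. -/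
instance : Category (Arr.{v₁, v₂, v₃, u₁, u₂, u₃} A B) where
  Hom := ArrHom
  id X := ⟨𝟙 X.adj, 𝟙 X.C, ArrHom.comm_id X⟩
  comp f g := ⟨f.f ≫ g.f, f.t ≫ g.t, ArrHom.comm_comp f g⟩
  id_comp f := ArrHom.ext (Category.id_comp f.f) (Category.id_comp f.t)
  comp_id f := ArrHom.ext (Category.comp_id f.f) (Category.comp_id f.t)
  assoc f g h := ArrHom.ext (Category.assoc f.f g.f h.f) (Category.assoc f.t g.t h.t)

/-! ## Regular objects -/

section Regular

variable (A : Type u₁) [Category.{v₁} A] (B : Type u₂) [Category.{v₂} B]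

/-- A pre-torsor is regular if both adjunctions are. -/
structure IsRegularPreTor (X : PreTor.{v₁, v₂, v₃, u₁, u₂, u₃} A B) : Prop where
  regA : IsRegularAdj X.adj.adjA
  regB : IsRegularAdj X.adj.adjB

/-- Regular objects of `Arr(A, B)`: the comonad arrow `(R_A, ξ)` is regular, that is `ξ` is
invertible; both adjunctions are regular; and the functor `C` preserves equalizers. -/
structure IsRegularArr (X : Arr.{v₁, v₂, v₃, u₁, u₂, u₃} A B) : Prop where
  isIso : IsIso X.ξ
  regA : IsRegularAdj X.adj.adjA
  regB : IsRegularAdj X.adj.adjB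
  preserves : PreservesLimitsOfShape WalkingParallelPair X.C.toFunctor

/-- Co-regular objects of `Arr(A, B)`: the comonad arrow `(R_A, ξ)` is co-regular, that is
`(ϵ^A N_B R_B N_A) ∘ (N_A ξ N_A) ∘ (N_A C η^A) : N_A C ⟶ N_B R_B N_A` is invertible; both
adjunctions are regular; and the functor `C` preserves equalizers. (Left adjoints of `R_A` being
unique up to isomorphism, it does not matter that the given one is used.) -/
structure IsCoregularArr (X : Arr.{v₁, v₂, v₃, u₁, u₂, u₃} A B) : Prop where
  isIso : IsIso (coMate X.adj.adjA X.ξ)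
  regA : IsRegularAdj X.adj.adjA
  regB : IsRegularAdj X.adj.adjB
  preserves : PreservesLimitsOfShape WalkingParallelPair X.C.toFunctor

/-- `PreTor_reg(A, B)`, a full subcategory of `PreTor(A, B)`. -/
abbrev PreTorReg :=
  ObjectProperty.FullSubcategory
    (IsRegularPreTor A B : ObjectProperty (PreTor.{v₁, v₂, v₃, u₁, u₂, u₃} A B))

/-- `RArr_reg(A, B)`, the full subcategory of regular objects of `Arr(A, B)`. -/
abbrev RArrReg :=
  ObjectProperty.FullSubcategory
    (IsRegularArr A B : ObjectProperty (Arr.{v₁, v₂, v₃, u₁, u₂, u₃} A B))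

/-- The full subcategory of co-regular objects of `Arr(A, B)`. -/
abbrev RArrBarReg :=
  ObjectProperty.FullSubcategory
    (IsCoregularArr A B : ObjectProperty (Arr.{v₁, v₂, v₃, u₁, u₂, u₃} A B))

/-- The forgetful functor from pre-torsors to pairs of adjunctions. -/
def PreTorReg.toAdj : PreTorReg.{v₁, v₂, v₃, u₁, u₂, u₃} A B ⥤
    AdjObj.{v₁, v₂, v₃, u₁, u₂, u₃} A B where
  obj X := X.obj.adj
  map f := f.hom.f

/-- The forgetful functor from regular comonad arrows to pairs of adjunctions. -/
def RArrReg.toAdj : RArrReg.{v₁, v₂, v₃, u₁, u₂, u₃} A B ⥤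
    AdjObj.{v₁, v₂, v₃, u₁, u₂, u₃} A B where
  obj X := X.obj.adj
  map f := f.hom.f

/-- The forgetful functor from co-regular comonad arrows to pairs of adjunctions. -/
def RArrBarReg.toAdj : RArrBarReg.{v₁, v₂, v₃, u₁, u₂, u₃} A B ⥤
    AdjObj.{v₁, v₂, v₃, u₁, u₂, u₃} A B where
  obj X := X.obj.adj
  map f := f.hom.f

end Regular

/-! ## From comonad arrows to pre-torsors -/

/-- For `ξ : C R_A ⟶ R_A N_B R_B` invertible, the natural transformation
`τ = (ξ N_A R_A N_B) ∘ (C η^A R_A N_B) ∘ (ξ⁻¹ N_B) ∘ (R_A N_B η^B)`. -/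
noncomputable def tauOfArr (X : AdjObj.{v₁, v₂, v₃, u₁, u₂, u₃} A B) {C : A ⥤ A}
    (ξ : X.RA ⋙ C ⟶ (X.RB ⋙ X.NB) ⋙ X.RA) (_ : IsIso ξ) : X.Q ⟶ X.Q ⋙ X.P ⋙ X.Q :=
  (Functor.whiskerRight X.adjB.unit X.Q : X.Q ⟶ X.NB ⋙ (X.RB ⋙ X.NB) ⋙ X.RA) ≫
    (Functor.whiskerLeft X.NB (inv ξ) : X.NB ⋙ (X.RB ⋙ X.NB) ⋙ X.RA ⟶ X.Q ⋙ C) ≫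
    (Functor.whiskerLeft X.Q (Functor.whiskerRight X.adjA.unit C) :
      X.Q ⋙ C ⟶ (X.Q ⋙ X.NA) ⋙ X.RA ⋙ C) ≫
    Functor.whiskerLeft (X.Q ⋙ X.NA) ξ

/-- For `ζ : D R_B ⟶ R_B N_A R_A` such that
`ζ' := (ϵ^B N_A R_A N_B) ∘ (N_B ζ N_B) ∘ (N_B D η^B) : N_B D ⟶ N_A R_A N_B` is invertible, the
natural transformation
`τ = (R_A N_B R_B ζ') ∘ (R_A N_B η^B D) ∘ (R_A ζ'⁻¹) ∘ (η^A R_A N_B)`. -/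
noncomputable def tauOfArrBar (X : AdjObj.{v₁, v₂, v₃, u₁, u₂, u₃} A B) {D : B ⥤ B}
    (ζ : X.RB ⋙ D ⟶ (X.RA ⋙ X.NA) ⋙ X.RB) (_ : IsIso (coMate X.adjB ζ)) :
    X.Q ⟶ X.Q ⋙ X.P ⋙ X.Q :=
  (Functor.whiskerLeft X.Q X.adjA.unit : X.Q ⟶ (X.NB ⋙ X.RA ⋙ X.NA) ⋙ X.RA) ≫
    (Functor.whiskerRight (inv (coMate X.adjB ζ)) X.RA :
      (X.NB ⋙ X.RA ⋙ X.NA) ⋙ X.RA ⟶ D ⋙ X.Q) ≫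
    (Functor.whiskerLeft D (Functor.whiskerRight X.adjB.unit X.Q) :
      D ⋙ X.Q ⟶ (D ⋙ X.NB) ⋙ X.RB ⋙ X.Q) ≫
    Functor.whiskerRight (coMate X.adjB ζ) (X.RB ⋙ X.Q)

/-- `Ω : RArr_reg(A, B) ⥤ PreTor_reg(A, B)` keeps the pair of adjunctions, replaces `(C, ξ)` by the
pre-torsor map `tauOfArr`, and sends a morphism `(F, t)` to `F`. -/
def IsOmega (Ω : RArrReg.{v₁, v₂, v₃, u₁, u₂, u₃} A B ⥤
    PreTorReg.{v₁, v₂, v₃, u₁, u₂, u₃} A B) : Prop :=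
  Ω ⋙ PreTorReg.toAdj A B = RArrReg.toAdj A B ∧
    ∀ X : RArrReg.{v₁, v₂, v₃, u₁, u₂, u₃} A B,
      ∃ h : IsPreTorsor X.obj.adj (tauOfArr X.obj.adj X.obj.ξ X.property.isIso),
        (Ω.obj X).obj = ⟨X.obj.adj, tauOfArr X.obj.adj X.obj.ξ X.property.isIso, h⟩

/-- The analogue of `Ω` for co-regular objects: it exchanges the two adjunctions, replaces the
comonad arrow by the pre-torsor map `tauOfArrBar`, and sends a morphism `(F, t)` to `F`. -/
def IsOmegaBar (Ω : RArrBarReg.{v₂, v₁, v₃, u₂, u₁, u₃} B A ⥤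
    PreTorReg.{v₁, v₂, v₃, u₁, u₂, u₃} A B) : Prop :=
  Ω ⋙ PreTorReg.toAdj A B = RArrBarReg.toAdj B A ⋙ swapFunctor B A ∧
    ∀ Y : RArrBarReg.{v₂, v₁, v₃, u₂, u₁, u₃} B A,
      ∃ h : IsPreTorsor Y.obj.adj.swap (tauOfArrBar Y.obj.adj.swap Y.obj.ξ Y.property.isIso),
        (Ω.obj Y).obj =
          ⟨Y.obj.adj.swap, tauOfArrBar Y.obj.adj.swap Y.obj.ξ Y.property.isIso, h⟩

/-! ## From pre-torsors to comonad arrows -/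

namespace PreTor

variable (X : PreTor.{v₁, v₂, v₃, u₁, u₂, u₃} A B)

/-- `ω^l := (R_A N_B R_B N_A R_A ϵ^B N_A) ∘ (τ R_B N_A)`. -/
def omegaL : X.adj.P ⋙ X.adj.Q ⟶ (X.adj.NA ⋙ X.adj.RA) ⋙ X.adj.P ⋙ X.adj.Q :=
  (Functor.whiskerLeft X.adj.P X.τ :
      X.adj.P ⋙ X.adj.Q ⟶ ((X.adj.NA ⋙ X.adj.RB ⋙ X.adj.NB) ⋙ X.adj.RA) ⋙ X.adj.P ⋙ X.adj.Q) ≫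
    Functor.whiskerRight
      (Functor.whiskerRight (Functor.whiskerLeft X.adj.NA X.adj.adjB.counit) X.adj.RA)
      (X.adj.P ⋙ X.adj.Q)

/-- `ω^r := R_A N_B R_B N_A η^A`. -/
def omegaR : X.adj.P ⋙ X.adj.Q ⟶ (X.adj.NA ⋙ X.adj.RA) ⋙ X.adj.P ⋙ X.adj.Q :=
  Functor.whiskerRight X.adj.adjA.unit (X.adj.P ⋙ X.adj.Q)

/-- `θ^l := (R_B ϵ^A N_B R_B N_A R_A N_B) ∘ (R_B N_A τ)`. -/
def thetaL : X.adj.Q ⋙ X.adj.P ⟶ (X.adj.Q ⋙ X.adj.P) ⋙ X.adj.NB ⋙ X.adj.RB :=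
  (Functor.whiskerRight X.τ X.adj.P :
      X.adj.Q ⋙ X.adj.P ⟶
        (X.adj.Q ⋙ X.adj.P) ⋙ X.adj.NB ⋙ (X.adj.RA ⋙ X.adj.NA) ⋙ X.adj.RB) ≫
    Functor.whiskerLeft (X.adj.Q ⋙ X.adj.P)
      (Functor.whiskerLeft X.adj.NB (Functor.whiskerRight X.adj.adjA.counit X.adj.RB))

/-- `θ^r := η^B R_B N_A R_A N_B`. -/
def thetaR : X.adj.Q ⋙ X.adj.P ⟶ (X.adj.Q ⋙ X.adj.P) ⋙ X.adj.NB ⋙ X.adj.RB :=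
  Functor.whiskerLeft (X.adj.Q ⋙ X.adj.P) X.adj.adjB.unit

/-- `(C, Δ, ε)` and `ξ` are built from the pre-torsor `X` by means of the equalizer
`i : C ⟶ R_A N_B R_B N_A` of `ω^l` and `ω^r` in the category of endofunctors of `A`:
`(i i) ∘ Δ = (τ R_B N_A) ∘ i`, `η^A ∘ ε = (R_A ϵ^B N_A) ∘ i` and
`ξ = (R_A N_B R_B ϵ^A) ∘ (i R_A)`. -/
structure IsComonadOf (C : Comonad A) (i : C.toFunctor ⟶ X.adj.P ⋙ X.adj.Q)
    (ξ : X.adj.RA ⋙ C.toFunctor ⟶ (X.adj.RB ⋙ X.adj.NB) ⋙ X.adj.RA) : Prop where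
  isEqualizer : IsEqualizer i X.omegaL X.omegaR
  comul : ∀ x : A, C.δ.app x ≫ (i ◫ i).app x = i.app x ≫ X.τ.app (X.adj.P.obj x)
  counit : ∀ x : A, C.ε.app x ≫ X.adj.adjA.unit.app x =
    i.app x ≫ X.adj.RA.map (X.adj.adjB.counit.app (X.adj.NA.obj x))
  arrow : ∀ z : X.adj.T, ξ.app z =
    i.app (X.adj.RA.obj z) ≫ X.adj.Q.map (X.adj.RB.map (X.adj.adjA.counit.app z))

/-- `(D, Δ, ε)` and `ζ` are built from the pre-torsor `X` by means of the equalizer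
`j : D ⟶ R_B N_A R_A N_B` of `θ^l` and `θ^r` in the category of endofunctors of `B`:
`(j j) ∘ Δ = (R_B N_A τ) ∘ j`, `η^B ∘ ε = (R_B ϵ^A N_B) ∘ j` and
`ζ = (R_B N_A R_A ϵ^B) ∘ (j R_B)`. -/
structure IsComonadBarOf (D : Comonad B) (j : D.toFunctor ⟶ X.adj.Q ⋙ X.adj.P)
    (ζ : X.adj.RB ⋙ D.toFunctor ⟶ (X.adj.RA ⋙ X.adj.NA) ⋙ X.adj.RB) : Prop where
  isEqualizer : IsEqualizer j X.thetaL X.thetaR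
  comul : ∀ y : B, D.δ.app y ≫ (j ◫ j).app y = j.app y ≫ X.adj.P.map (X.τ.app y)
  counit : ∀ y : B, D.ε.app y ≫ X.adj.adjB.unit.app y =
    j.app y ≫ X.adj.RB.map (X.adj.adjA.counit.app (X.adj.NB.obj y))
  arrow : ∀ z : X.adj.T, ζ.app z =
    j.app (X.adj.RB.obj z) ≫ X.adj.P.map (X.adj.RA.map (X.adj.adjB.counit.app z))

end PreTor

/-- `Γ : PreTor_reg(A, B) ⥤ RArr_reg(A, B)` keeps the pair of adjunctions, replaces the pre-torsor
map `τ` by the comonad and comonad arrow of `PreTor.IsComonadOf`, and sends a morphism `F` to a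
morphism of the form `(F, t)`. -/
def IsGamma (Γ : PreTorReg.{v₁, v₂, v₃, u₁, u₂, u₃} A B ⥤
    RArrReg.{v₁, v₂, v₃, u₁, u₂, u₃} A B) : Prop :=
  Γ ⋙ RArrReg.toAdj A B = PreTorReg.toAdj A B ∧
    ∀ X : PreTorReg.{v₁, v₂, v₃, u₁, u₂, u₃} A B,
      ∃ (C : Comonad A) (i : C.toFunctor ⟶ X.obj.adj.P ⋙ X.obj.adj.Q)
        (ξ : X.obj.adj.RA ⋙ C.toFunctor ⟶ (X.obj.adj.RB ⋙ X.obj.adj.NB) ⋙ X.obj.adj.RA)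
        (h : IsComonadArrow C X.obj.adj.adjB.toComonad X.obj.adj.RA ξ),
        X.obj.IsComonadOf C i ξ ∧ (Γ.obj X).obj = ⟨X.obj.adj, C, ξ, h⟩

/-- The analogue of `Γ` for co-regular objects: it exchanges the two adjunctions, replaces the
pre-torsor map `τ` by the comonad and comonad arrow of `PreTor.IsComonadBarOf`, and sends a
morphism `F` to a morphism of the form `(F, t)`. -/
def IsGammaBar (Γ : PreTorReg.{v₁, v₂, v₃, u₁, u₂, u₃} A B ⥤
    RArrBarReg.{v₂, v₁, v₃, u₂, u₁, u₃} B A) : Prop :=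
  Γ ⋙ RArrBarReg.toAdj B A = PreTorReg.toAdj A B ⋙ swapFunctor A B ∧
    ∀ X : PreTorReg.{v₁, v₂, v₃, u₁, u₂, u₃} A B,
      ∃ (D : Comonad B) (j : D.toFunctor ⟶ X.obj.adj.Q ⋙ X.obj.adj.P)
        (ζ : X.obj.adj.RB ⋙ D.toFunctor ⟶ (X.obj.adj.RA ⋙ X.obj.adj.NA) ⋙ X.obj.adj.RB)
        (h : IsComonadArrow D X.obj.adj.adjA.toComonad X.obj.adj.RB ζ),
        X.obj.IsComonadBarOf D j ζ ∧ (Γ.obj X).obj = ⟨X.obj.adj.swap, D, ζ, h⟩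

end RegTorsor

namespace RegTorsor

/-! ### Functors applied to commuting triangles and squares -/

section Squares

variable {K : Type u₁} [Category.{v₁} K] {T : Type u₂} [Category.{v₂} T] (F : K ⥤ T)

/-! Write S = R_A N_B R_B N_A. The right adjoints preserve equalizers always and the left adjoints
by regularity, so every composite of them, in particular S, does so as well. Since A and B have
equalizers, equalizers of endofunctors are pointwise. All constructions can therefore be made on
components, by lifting through an equalizer, and all identities can be tested after composing with
monomorphisms such as i, S i and S S i. Regularity of an adjunction enters in the form
`IsRegularAdj.equalizes`: each η_x is the equalizer of R N η_x and η_{RNx}.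

From τ to (C, ξ). Coassociativity of τ, naturality and one counit law make τ ∘ i factor through i i,
which gives Δ; the fork of η^A gives ε. The comonad axioms become the pre-torsor axioms and the fork
equation of i. The inverse of ξ is the lift through i of (S R_A ϵ^B) ∘ (τ R_B), see
`exists_arrow_inv`; substituting it into the formula for Ω returns τ, so ΩΓ = Id on objects.

From (C, ξ) to τ. The map (ξ⁻¹ N_B) ∘ (R_A N_B η^B) is a coassociative C-coaction on R_A N_B, and τ
is this coaction followed by (ξ N_A) ∘ (C η^A) : C ⟶ S. Because C preserves the fork of η^A and ξ is
invertible, that second map is again an equalizer of the pair that defines Γ. So (C, ξ) is a comonad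
of its own pre-torsor (`RArrReg.isComonadOf`), and the one chosen by Γ is another; two such are
isomorphic over the identity of the adjunctions, whence ΓΩ ≅ Id.

Morphisms. The square for (F, t) forces i' ∘ t = (R_A b R_B a) ∘ i with i' monic, so F determines t.
The forgetful functors to Adj(A, B) are thus faithful, and functoriality, naturality and the
equality ΩΓ = Id on morphisms follow from what happens to F.

The statement for B runs in parallel, with j, P Q (for P = R_B N_A, Q = R_A N_B) and the other
counit law in the place of i, S and the first. The one real change is that the transpose N_B D ⟶ N_A
R_A N_B of j is invertible instead of ζ; R_B of this isomorphism carries the fork of η^B at D y to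
the fork of j. -/

theorem map_tri {x y z : K} {a : x ⟶ y} {b : y ⟶ z} {c : x ⟶ z} (h : a ≫ b = c) :
    F.map a ≫ F.map b = F.map c := by rw [← F.map_comp, h]

theorem map_sq {x y y' z : K} {a : x ⟶ y} {b : y ⟶ z} {c : x ⟶ y'} {d : y' ⟶ z}
    (h : a ≫ b = c ≫ d) : F.map a ≫ F.map b = F.map c ≫ F.map d := by
  rw [← F.map_comp, h, F.map_comp]

end Squares

/-! ## Equalizers, elementwise -/

section Equalizers

variable {K : Type u₁} [Category.{v₁} K] {T : Type u₂} [Category.{v₂} T]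

/-- The universal property of the equalizer `i` of `f` and `g`, as a proposition. -/
structure Equalizes {E X Y : K} (i : E ⟶ X) (f g : X ⟶ Y) : Prop where
  w : i ≫ f = i ≫ g
  lift : ∀ {W : K} (k : W ⟶ X), k ≫ f = k ≫ g → ∃ l, l ≫ i = k
  cancel : ∀ {W : K} {k l : W ⟶ E}, k ≫ i = l ≫ i → k = l

theorem isEqualizer_iff {E X Y : K} {i : E ⟶ X} {f g : X ⟶ Y} :
    IsEqualizer i f g ↔ Equalizes i f g := by
  constructor
  · rintro ⟨w, ⟨h⟩⟩
    refine ⟨w, fun k hk => ⟨h.lift (Fork.ofι k hk), h.fac (Fork.ofι k hk) .zero⟩,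
      fun {W k l} e => Fork.IsLimit.hom_ext h e⟩
  · intro h
    refine ⟨h.w, ⟨Fork.IsLimit.mk _ (fun s => (h.lift s.ι s.condition).choose)
      (fun s => (h.lift s.ι s.condition).choose_spec) fun s m hm => h.cancel ?_⟩⟩
    exact hm.trans (h.lift s.ι s.condition).choose_spec.symm

/-- Serves to recognise a given fork as a copy of the fork of a unit. -/
theorem Equalizes.comp_iso {E X Y X' Y' : K} {i : E ⟶ X} {f g : X ⟶ Y} (h : Equalizes i f g)
    {i' : E ⟶ X'} {f' g' : X' ⟶ Y'} (e : X ⟶ X') [IsIso e] (e' : Y ⟶ Y') [IsIso e']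
    (hi : i ≫ e = i') (hf : e ≫ f' = f ≫ e') (hg : e ≫ g' = g ≫ e') : Equalizes i' f' g' := by
  subst hi
  refine ⟨by rw [Category.assoc, Category.assoc, hf, hg, reassoc_of% h.w], fun k hk => ?_,
    fun hk => h.cancel ?_⟩
  · obtain ⟨l, hl⟩ := h.lift (k ≫ inv e) (by
      rw [← cancel_mono e', Category.assoc, Category.assoc, Category.assoc, Category.assoc, ← hf,
        ← hg, IsIso.inv_hom_id_assoc, IsIso.inv_hom_id_assoc, hk])
    exact ⟨l, by rw [reassoc_of% hl, IsIso.inv_hom_id, Category.comp_id]⟩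
  · rw [← cancel_mono e, Category.assoc, hk, Category.assoc]

/-- A functor that preserves equalizers. -/
def PreservesEq (F : K ⥤ T) : Prop :=
  ∀ {E X Y : K} {i : E ⟶ X} {f g : X ⟶ Y}, Equalizes i f g →
    Equalizes (F.map i) (F.map f) (F.map g)

theorem PreservesEq.of_preserves (F : K ⥤ T) [PreservesLimitsOfShape WalkingParallelPair F] :
    PreservesEq F := by
  intro E X Y i f g h
  rw [← isEqualizer_iff] at h ⊢
  obtain ⟨w, ⟨h⟩⟩ := h
  exact ⟨by rw [← F.map_comp, w, F.map_comp], ⟨isLimitForkMapOfIsLimit F w h⟩⟩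

/-- Every diagram on the walking parallel pair is isomorphic to a `parallelPair`, and every cone
over the latter to a fork `Fork.ofι`. -/
theorem PreservesEq.preserves {F : K ⥤ T} (hF : PreservesEq F) :
    PreservesLimitsOfShape WalkingParallelPair F := by
  refine ⟨fun {D} => ?_⟩
  have key : PreservesLimit (parallelPair (D.map .left) (D.map .right)) F := by
    refine ⟨fun {c} hc => ?_⟩
    have hc' : IsLimit (Fork.ofι (Fork.ι c) (Fork.condition c)) :=
      IsLimit.ofIsoLimit hc (Fork.isoForkOfι c)
    obtain ⟨w, ⟨h⟩⟩ := isEqualizer_iff.2 (hF (isEqualizer_iff.1 ⟨_, ⟨hc'⟩⟩))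
    exact ⟨IsLimit.ofIsoLimit ((isLimitMapConeForkEquiv F (Fork.condition c)).symm h)
      ((Cone.functoriality _ F).mapIso (Fork.isoForkOfι c).symm)⟩
  exact preservesLimit_of_iso_diagram F (diagramIsoParallelPair D).symm

theorem PreservesEq.of_adj {N : K ⥤ T} {R : T ⥤ K} (adj : N ⊣ R) : PreservesEq R :=
  have := adj.rightAdjoint_preservesLimits.{0, 0}
  PreservesEq.of_preserves R

/-- When the target has equalizers, those of functors are computed pointwise, so evaluation
preserves them. -/
theorem equalizes_app [HasEqualizers K] {F G H : T ⥤ K} {i : F ⟶ G} {f g : G ⟶ H}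
    (h : IsEqualizer i f g) (x : T) : Equalizes (i.app x) (f.app x) (g.app x) := by
  have : PreservesLimitsOfShape WalkingParallelPair ((evaluation T K).obj x) :=
    evaluation_preservesLimitsOfShape x
  exact PreservesEq.of_preserves ((evaluation T K).obj x) (isEqualizer_iff.1 h)

/-- The pointwise lifts are automatically natural, because the components of i are monic. -/
theorem isEqualizer_of_app {F G H : T ⥤ K} {i : F ⟶ G} {f g : G ⟶ H}
    (h : ∀ x, Equalizes (i.app x) (f.app x) (g.app x)) : IsEqualizer i f g := by
  refine isEqualizer_iff.2 ⟨by ext x; exact (h x).w, fun k hk => ?_, fun {W k l} hk => ?_⟩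
  · have hk' : ∀ x, k.app x ≫ f.app x = k.app x ≫ g.app x := fun x => by
      rw [← NatTrans.comp_app, hk, NatTrans.comp_app]
    choose l hl using fun x => (h x).lift (k.app x) (hk' x)
    refine ⟨⟨l, fun x y m => (h y).cancel ?_⟩, by ext x; exact hl x⟩
    rw [Category.assoc, hl, k.naturality, Category.assoc, i.naturality, reassoc_of% hl]
  · ext x
    exact (h x).cancel (by rw [← NatTrans.comp_app, hk, NatTrans.comp_app])

/-- A pointwise equalizer of transformations between functors that preserve equalizers is itself
a functor that preserves equalizers. -/
theorem PreservesEq.of_equalizes {F G H : K ⥤ T} {i : F ⟶ G} {f g : G ⟶ H} (hG : PreservesEq G)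
    (hH : PreservesEq H) (h : ∀ x, Equalizes (i.app x) (f.app x) (g.app x)) : PreservesEq F := by
  intro E X Y m p q e
  refine ⟨by rw [← F.map_comp, e.w, F.map_comp], fun k hk => ?_, fun {W k l} hk => ?_⟩
  · obtain ⟨l, hl⟩ := (hG e).lift (k ≫ i.app X) (by
      rw [Category.assoc, Category.assoc, ← i.naturality, ← i.naturality, reassoc_of% hk])
    obtain ⟨n, hn⟩ := (h E).lift l ((hH e).cancel (by
      rw [Category.assoc, Category.assoc, ← f.naturality, ← g.naturality, reassoc_of% hl,
        reassoc_of% hl, (h X).w]))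
    exact ⟨n, (h X).cancel (by rw [Category.assoc, i.naturality, reassoc_of% hn, hl])⟩
  · refine (h E).cancel ((hG e).cancel ?_)
    rw [Category.assoc, Category.assoc, ← i.naturality, reassoc_of% hk]

end Equalizers

/-! ## Adjunctions, componentwise -/

section Adjunctions

variable {K : Type u₁} [Category.{v₁} K] {T : Type u₂} [Category.{v₂} T]
  {N : K ⥤ T} {R : T ⥤ K} (adj : N ⊣ R)

/-- The component of the unit at `x`. -/
def un (x : K) : x ⟶ R.obj (N.obj x) := adj.unit.app x

/-- The component of the counit at `z`. -/
def co (z : T) : N.obj (R.obj z) ⟶ z := adj.counit.app z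

theorem un_nat {x y : K} (f : x ⟶ y) : f ≫ un adj y = un adj x ≫ R.map (N.map f) :=
  adj.unit.naturality f

theorem co_nat {z w : T} (f : z ⟶ w) : N.map (R.map f) ≫ co adj w = co adj z ≫ f :=
  adj.counit.naturality f

theorem map_un_co (x : K) : N.map (un adj x) ≫ co adj (N.obj x) = 𝟙 _ :=
  adj.left_triangle_components x

theorem un_map_co (z : T) : un adj (R.obj z) ≫ R.map (co adj z) = 𝟙 _ :=
  adj.right_triangle_components z

variable {adj}

/-- For a regular adjunction each `η_x` is the equalizer of `R N η_x` and `η_{R N x}`. -/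
theorem IsRegularAdj.equalizes [HasEqualizers K] (h : IsRegularAdj adj) (x : K) :
    Equalizes (un adj x) (R.map (N.map (un adj x))) (un adj (R.obj (N.obj x))) := by
  obtain ⟨⟨r⟩⟩ := h.unit_regular
  have e : ∀ x, Equalizes (un adj x) (r.left.app x) (r.right.app x) :=
    equalizes_app ⟨r.w, ⟨r.isLimit⟩⟩
  -- The unit equalizes some pair `r.left`, `r.right` into Z. To see that k equalizes it too,
  -- compose with the monic η_Z: naturality turns this into k ≫ η_{RNx} followed by R N of the pair,
  -- and `hk` replaces η_{RNx} by R N η_x, after which the fork equation of r applies.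
  refine ⟨(un_nat adj _).symm, fun k hk => (e x).lift k ((e (r.Z.obj x)).cancel ?_), (e x).cancel⟩
  rw [Category.assoc, Category.assoc]
  refine (congrArg (k ≫ ·) (un_nat adj (r.left.app x))).trans
    (Eq.trans ?_ (congrArg (k ≫ ·) (un_nat adj (r.right.app x))).symm)
  refine Eq.trans (?_ : _ = k ≫ R.map (N.map (un adj x)) ≫ R.map (N.map (r.left.app x))) ?_
  · rw [reassoc_of% hk]
    rfl
  refine Eq.trans (?_ : _ = k ≫ R.map (N.map (un adj x)) ≫ R.map (N.map (r.right.app x))) ?_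
  · rw [← R.map_comp, ← N.map_comp, (e x).w, N.map_comp, R.map_comp]
  · rw [reassoc_of% hk]
    rfl

theorem IsRegularAdj.preservesEq (h : IsRegularAdj adj) : PreservesEq N :=
  have := h.preserves
  PreservesEq.of_preserves N

end Adjunctions

/-! ### The comparison of left adjoints and the two triangle identities it satisfies -/

section Comparison

variable {K : Type u₁} [Category.{v₁} K] {T : Type u₂} [Category.{v₂} T]
  {T' : Type u₃} [Category.{v₃} T'] {N : K ⥤ T} {R : T ⥤ K} {N' : K ⥤ T'} {R' : T' ⥤ K}
  (adj : N ⊣ R) (adj' : N' ⊣ R') (F : T' ⥤ T) (h : F ⋙ R = R')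

/-- The components of the identity `R F = R'`. -/
def eqc {F : T' ⥤ T} (h : F ⋙ R = R') (z : T') : R.obj (F.obj z) ⟶ R'.obj z := (eqToHom h).app z

/-- The components of the comparison `cmp`. -/
def cmpc (x : K) : N.obj x ⟶ F.obj (N'.obj x) := (cmp adj adj' F h).app x

theorem eqc_nat {y z : T'} (m : y ⟶ z) : R.map (F.map m) ≫ eqc h z = eqc h y ≫ R'.map m :=
  (eqToHom h).naturality m

theorem cmpc_nat {x y : K} (m : x ⟶ y) :
    N.map m ≫ cmpc adj adj' F h y = cmpc adj adj' F h x ≫ F.map (N'.map m) :=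
  (cmp adj adj' F h).naturality m

/-- The comparison is the mate of the identity R F = R', so it carries one unit to the other; once h
is substituted, this is naturality of η and a triangle identity. -/
theorem un_cmpc (x : K) :
    un adj x ≫ R.map (cmpc adj adj' F h x) ≫ eqc h (N'.obj x) = un adj' x := by
  subst h
  have h1 : cmpc adj adj' F rfl x = N.map (un adj' x) ≫ co adj (F.obj (N'.obj x)) := by
    simp [cmpc, cmp_app, un, co]
  have h2 : eqc (rfl : F ⋙ R = F ⋙ R) (N'.obj x) = 𝟙 _ := rfl
  rw [h1, h2, Category.comp_id, R.map_comp]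
  exact ((reassoc_of% un_nat adj (un adj' x)) _).symm.trans
    ((congrArg (un adj' x ≫ ·) (un_map_co adj (F.obj (N'.obj x)))).trans (Category.comp_id _))

/-- The companion of `un_cmpc` for counits, again by naturality and a triangle identity. -/
theorem cmpc_co (z : T') :
    N.map (eqc h z) ≫ cmpc adj adj' F h (R'.obj z) ≫ F.map (co adj' z) = co adj (F.obj z) := by
  subst h
  have h1 : cmpc adj adj' F rfl (R.obj (F.obj z)) =
      N.map (un adj' (R.obj (F.obj z))) ≫ co adj (F.obj (N'.obj (R.obj (F.obj z)))) := by
    simp [cmpc, cmp_app, un, co]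
  have h2 : eqc (rfl : F ⋙ R = F ⋙ R) z = 𝟙 _ := rfl
  have h3 : un adj' (R.obj (F.obj z)) ≫ R.map (F.map (co adj' z)) = 𝟙 _ := un_map_co adj' z
  refine (congrArg₂ (fun p q => N.map p ≫ q ≫ F.map (co adj' z)) h2 h1).trans ?_
  rw [N.map_id, Category.id_comp, Category.assoc]
  refine (congrArg (N.map (un adj' (R.obj (F.obj z))) ≫ ·)
    (co_nat adj (F.map (co adj' z)))).symm.trans ?_
  refine ((N.map_comp_assoc _ _ _).symm.trans (congrArg (fun p => N.map p ≫ co adj (F.obj z))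
    h3)).trans ?_
  rw [N.map_id, Category.id_comp]

end Comparison

/-! ### The pre-torsor axioms on components -/

section Torsor

variable {A : Type u₁} [Category.{v₁} A] {B : Type u₂} [Category.{v₂} B]
  (X : AdjObj.{v₁, v₂, v₃, u₁, u₂, u₃} A B)

/-- A natural family with the laws of a pre-torsor. -/
structure TorsorLaws (t : ∀ y : B, X.RA.obj (X.NB.obj y) ⟶
    X.RA.obj (X.NB.obj (X.RB.obj (X.NA.obj (X.RA.obj (X.NB.obj y)))))) : Prop where
  nat : ∀ {y y' : B} (f : y ⟶ y'), X.RA.map (X.NB.map f) ≫ t y' =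
    t y ≫ X.RA.map (X.NB.map (X.RB.map (X.NA.map (X.RA.map (X.NB.map f)))))
  counitA : ∀ y, t y ≫ X.RA.map (X.NB.map (X.RB.map (co X.adjA (X.NB.obj y)))) =
    X.RA.map (X.NB.map (un X.adjB y))
  counitB : ∀ y, t y ≫ X.RA.map (co X.adjB (X.NA.obj (X.RA.obj (X.NB.obj y)))) =
    un X.adjA (X.RA.obj (X.NB.obj y))
  coassoc : ∀ y, t y ≫ X.RA.map (X.NB.map (X.RB.map (X.NA.map (t y)))) =
    t y ≫ t (X.RB.obj (X.NA.obj (X.RA.obj (X.NB.obj y))))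

theorem PreTor.laws (X : PreTor.{v₁, v₂, v₃, u₁, u₂, u₃} A B) : TorsorLaws X.adj X.τ.app where
  nat f := X.τ.naturality f
  counitA := X.isPreTorsor.counitA
  counitB := X.isPreTorsor.counitB
  coassoc := X.isPreTorsor.coassoc

variable {X} {t : ∀ y : B, X.RA.obj (X.NB.obj y) ⟶
    X.RA.obj (X.NB.obj (X.RB.obj (X.NA.obj (X.RA.obj (X.NB.obj y)))))}

/-! ## The comonad of a pre-torsor on the first category -/

/-- A natural family `i` that is, componentwise, the equalizer of `ω^l` and `ω^r`. -/
structure EqualizesOmega (X : AdjObj.{v₁, v₂, v₃, u₁, u₂, u₃} A B)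
    (t : ∀ y : B, X.RA.obj (X.NB.obj y) ⟶
      X.RA.obj (X.NB.obj (X.RB.obj (X.NA.obj (X.RA.obj (X.NB.obj y)))))) (C : A ⥤ A)
    (i : ∀ x : A, C.obj x ⟶ X.RA.obj (X.NB.obj (X.RB.obj (X.NA.obj x)))) : Prop where
  nat : ∀ {x x' : A} (f : x ⟶ x'),
    C.map f ≫ i x' = i x ≫ X.RA.map (X.NB.map (X.RB.map (X.NA.map f)))
  equalizes : ∀ x, Equalizes (i x)
    (t (X.RB.obj (X.NA.obj x)) ≫
      X.RA.map (X.NB.map (X.RB.map (X.NA.map (X.RA.map (co X.adjB (X.NA.obj x)))))))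
    (X.RA.map (X.NB.map (X.RB.map (X.NA.map (un X.adjA x)))))

/-- A family `δ` with `(i i) ∘ δ = (τ R_B N_A) ∘ i`. -/
def IsComul (X : AdjObj.{v₁, v₂, v₃, u₁, u₂, u₃} A B)
    (t : ∀ y : B, X.RA.obj (X.NB.obj y) ⟶
      X.RA.obj (X.NB.obj (X.RB.obj (X.NA.obj (X.RA.obj (X.NB.obj y)))))) (C : A ⥤ A)
    (i : ∀ x : A, C.obj x ⟶ X.RA.obj (X.NB.obj (X.RB.obj (X.NA.obj x))))
    (d : ∀ x : A, C.obj x ⟶ C.obj (C.obj x)) : Prop :=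
  ∀ x, d x ≫ i (C.obj x) ≫ X.RA.map (X.NB.map (X.RB.map (X.NA.map (i x)))) =
    i x ≫ t (X.RB.obj (X.NA.obj x))

/-- A family `ε` with `η^A ∘ ε = (R_A ϵ^B N_A) ∘ i`. -/
def IsCounit (X : AdjObj.{v₁, v₂, v₃, u₁, u₂, u₃} A B) (C : A ⥤ A)
    (i : ∀ x : A, C.obj x ⟶ X.RA.obj (X.NB.obj (X.RB.obj (X.NA.obj x))))
    (e : ∀ x : A, C.obj x ⟶ x) : Prop :=
  ∀ x, e x ≫ un X.adjA x = i x ≫ X.RA.map (co X.adjB (X.NA.obj x))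

/-- The components of `(R_A N_B R_B ϵ^A) ∘ (i R_A)`. -/
def arrowOf (X : AdjObj.{v₁, v₂, v₃, u₁, u₂, u₃} A B) (C : A ⥤ A)
    (i : ∀ x : A, C.obj x ⟶ X.RA.obj (X.NB.obj (X.RB.obj (X.NA.obj x)))) (z : X.T) :
    C.obj (X.RA.obj z) ⟶ X.RA.obj (X.NB.obj (X.RB.obj z)) :=
  i (X.RA.obj z) ≫ X.RA.map (X.NB.map (X.RB.map (co X.adjA z)))

variable {C : A ⥤ A} {i : ∀ x : A, C.obj x ⟶ X.RA.obj (X.NB.obj (X.RB.obj (X.NA.obj x)))}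
  {d : ∀ x : A, C.obj x ⟶ C.obj (C.obj x)} {e : ∀ x : A, C.obj x ⟶ x}

theorem AdjObj.coB_nat {z w : X.T} (f : z ⟶ w) :
    X.RA.map (X.NB.map (X.RB.map f)) ≫ X.RA.map (co X.adjB w) =
      X.RA.map (co X.adjB z) ≫ X.RA.map f :=
  map_sq X.RA (co_nat X.adjB f)

theorem AdjObj.coA_nat {z w : X.T} (f : z ⟶ w) :
    X.RB.map (X.NA.map (X.RA.map f)) ≫ X.RB.map (co X.adjA w) =
      X.RB.map (co X.adjA z) ≫ X.RB.map f :=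
  map_sq X.RB (co_nat X.adjA f)

namespace EqualizesOmega

theorem w (hi : EqualizesOmega X t C i) (x : A) : i x ≫ t (X.RB.obj (X.NA.obj x)) ≫
      X.RA.map (X.NB.map (X.RB.map (X.NA.map (X.RA.map (co X.adjB (X.NA.obj x)))))) =
    i x ≫ X.RA.map (X.NB.map (X.RB.map (X.NA.map (un X.adjA x)))) := (hi.equalizes x).w

/-- Two successive lifts. Coassociativity and the fork equation of i let i ≫ τ factor through S i,
where S = R_A N_B R_B N_A. The factor then goes through i at C x; this is tested against the monic S
R_A N_A i, where it follows from coassociativity and `counitB`. -/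
theorem exists_comul (hi : EqualizesOmega X t C i) (ht : TorsorLaws X t)
    (hA : PreservesEq X.NA) (hB : PreservesEq X.NB) :
    ∃ d : ∀ x : A, C.obj x ⟶ C.obj (C.obj x), IsComul X t C i d := by
  have pRA : PreservesEq X.RA := PreservesEq.of_adj X.adjA
  have pRB : PreservesEq X.RB := PreservesEq.of_adj X.adjB
  suffices h : ∀ x, ∃ d : C.obj x ⟶ C.obj (C.obj x),
      d ≫ i (C.obj x) ≫ X.RA.map (X.NB.map (X.RB.map (X.NA.map (i x)))) =
        i x ≫ t (X.RB.obj (X.NA.obj x)) by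
    choose d hd using h
    exact ⟨d, hd⟩
  intro x
  obtain ⟨k, hk⟩ := (pRA (hB (pRB (hA (hi.equalizes x))))).lift
      (i x ≫ t (X.RB.obj (X.NA.obj x))) (by
    simp only [Functor.map_comp, Category.assoc]
    rw [reassoc_of% ht.coassoc, ← ht.nat, reassoc_of% hi.w x, ht.nat])
  obtain ⟨l, hl⟩ := (hi.equalizes (C.obj x)).lift k (by
    refine (pRA (hB (pRB (hA (pRA (hA (hi.equalizes x))))))).cancel ?_
    have h1 := map_sq X.RB (map_sq X.NA (AdjObj.coB_nat (X.NA.map (i x))))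
    have h2 := map_tri X.RB (map_tri X.NA (ht.counitB (X.RB.obj (X.NA.obj x))))
    have h3 := map_sq X.RB (map_sq X.NA (un_nat X.adjA (i x)))
    rw [Category.assoc, Category.assoc, Category.assoc, ← map_sq X.RA (map_sq X.NB h1),
      ← map_sq X.RA (map_sq X.NB h3), ← reassoc_of% ht.nat, reassoc_of% hk, reassoc_of% hk,
      ← reassoc_of% ht.coassoc, map_tri X.RA (map_tri X.NB h2)])
  exact ⟨l, by rw [reassoc_of% hl, hk]⟩

/-- (R_A ϵ^B N_A) ∘ i equalizes the pair of which η^A is the equalizer: exchange the pair for ω^l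
and ω^r by naturality of ϵ^B, then use `counitB`. -/
theorem exists_counit (hi : EqualizesOmega X t C i) (ht : TorsorLaws X t)
    (hA : ∀ x, Equalizes (un X.adjA x) (X.RA.map (X.NA.map (un X.adjA x)))
      (un X.adjA (X.RA.obj (X.NA.obj x)))) :
    ∃ e : ∀ x : A, C.obj x ⟶ x, IsCounit X C i e := by
  refine Classical.skolem.1 fun x => (hA x).lift _ ?_
  rw [Category.assoc, Category.assoc, ← AdjObj.coB_nat, ← reassoc_of% hi.w x, AdjObj.coB_nat,
    reassoc_of% ht.counitB, un_nat]

theorem mono_i (hi : EqualizesOmega X t C i) (x : A) : Mono (i x) :=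
  ⟨fun _ _ => (hi.equalizes x).cancel⟩

theorem comul_nat (hi : EqualizesOmega X t C i) (ht : TorsorLaws X t)
    (hA : PreservesEq X.NA) (hB : PreservesEq X.NB) (hd : IsComul X t C i d) {x x' : A}
    (f : x ⟶ x') : C.map f ≫ d x' = d x ≫ C.map (C.map f) := by
  have pRA : PreservesEq X.RA := PreservesEq.of_adj X.adjA
  have pRB : PreservesEq X.RB := PreservesEq.of_adj X.adjB
  refine (hi.equalizes _).cancel ((pRA (hB (pRB (hA (hi.equalizes x'))))).cancel ?_)
  have h1 := map_sq X.RA (map_sq X.NB (map_sq X.RB (map_sq X.NA (hi.nat f))))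
  simp only [Category.assoc]
  rw [hd, reassoc_of% hi.nat, reassoc_of% hi.nat, h1, reassoc_of% hd, ht.nat]

theorem counit_nat (hA : ∀ x, Mono (un X.adjA x)) (hi : EqualizesOmega X t C i)
    (he : IsCounit X C i e) {x x' : A} (f : x ⟶ x') : C.map f ≫ e x' = e x ≫ f := by
  rw [← cancel_mono (un X.adjA x'), Category.assoc, Category.assoc, he, reassoc_of% hi.nat,
    un_nat, reassoc_of% he, AdjObj.coB_nat]

/-- Against the monomorphism i i i, the two sides become the two sides of the coassociativity of τ.
-/
theorem comul_assoc (hi : EqualizesOmega X t C i) (ht : TorsorLaws X t)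
    (hA : PreservesEq X.NA) (hB : PreservesEq X.NB) (hd : IsComul X t C i d) (x : A) :
    d x ≫ C.map (d x) = d x ≫ d (C.obj x) := by
  have pRA : PreservesEq X.RA := PreservesEq.of_adj X.adjA
  have pRB : PreservesEq X.RB := PreservesEq.of_adj X.adjB
  refine (hi.equalizes _).cancel ((pRA (hB (pRB (hA (hi.equalizes _))))).cancel
    ((pRA (hB (pRB (hA (pRA (hB (pRB (hA (hi.equalizes x))))))))).cancel ?_))
  have h1 := congrArg (fun f => X.RA.map (X.NB.map (X.RB.map (X.NA.map f)))) (hd x)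
  simp only [Functor.map_comp] at h1
  simp only [Category.assoc]
  rw [reassoc_of% hi.nat, h1, reassoc_of% hd, reassoc_of% hd, ht.coassoc, ← ht.nat,
    reassoc_of% hd]

/-- After composing with the monics i and η^A this is `counitB`. -/
theorem comul_counit (hA : ∀ x, Mono (un X.adjA x)) (hi : EqualizesOmega X t C i)
    (ht : TorsorLaws X t) (hd : IsComul X t C i d) (he : IsCounit X C i e) (x : A) :
    d x ≫ e (C.obj x) = 𝟙 _ := by
  have := hi.mono_i x
  rw [← cancel_mono (i x), ← cancel_mono (un X.adjA _), Category.assoc, Category.assoc,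
    Category.assoc, un_nat, reassoc_of% he, ← AdjObj.coB_nat, reassoc_of% hd, ht.counitB,
    Category.id_comp, un_nat]

/-- After composing with i and S η^A, which is monic because S preserves equalizers, this is the
fork equation of i. -/
theorem comul_map_counit (hA : PreservesEq X.NA) (hB : PreservesEq X.NB)
    (hA' : ∀ x, Equalizes (un X.adjA x) (X.RA.map (X.NA.map (un X.adjA x)))
      (un X.adjA (X.RA.obj (X.NA.obj x)))) (hi : EqualizesOmega X t C i)
    (hd : IsComul X t C i d) (he : IsCounit X C i e) (x : A) :
    d x ≫ C.map (e x) = 𝟙 _ := by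
  have pRA : PreservesEq X.RA := PreservesEq.of_adj X.adjA
  have pRB : PreservesEq X.RB := PreservesEq.of_adj X.adjB
  refine (hi.equalizes _).cancel ((pRA (hB (pRB (hA (hA' x))))).cancel ?_)
  have h1 := map_sq X.RA (map_sq X.NB (map_sq X.RB (map_sq X.NA (he x))))
  simp only [Category.assoc, Category.id_comp]
  rw [reassoc_of% hi.nat, h1, reassoc_of% hd, hi.w]

/-! ### The comonad arrow -/

theorem arrow_nat (hi : EqualizesOmega X t C i) {z w : X.T} (f : z ⟶ w) :
    C.map (X.RA.map f) ≫ arrowOf X C i w =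
      arrowOf X C i z ≫ X.RA.map (X.NB.map (X.RB.map f)) := by
  have h1 := map_sq X.RA (map_sq X.NB (AdjObj.coA_nat f))
  rw [arrowOf, arrowOf, reassoc_of% hi.nat, Category.assoc, h1]

theorem arrow_counit (he : IsCounit X C i e) (z : X.T) :
    arrowOf X C i z ≫ X.RA.map (co X.adjB z) = e (X.RA.obj z) := by
  rw [arrowOf, Category.assoc, AdjObj.coB_nat, ← reassoc_of% he, un_map_co, Category.comp_id]

/-- The part of the comultiplication axiom that precedes the last counit ϵ^A; `counitA` then turns τ
into R_A N_B η^B in `arrow_comul`. -/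
theorem comul_arrow (hi : EqualizesOmega X t C i) (ht : TorsorLaws X t) (hd : IsComul X t C i d)
    (z : X.T) : d (X.RA.obj z) ≫ C.map (arrowOf X C i z) ≫ i _ =
      arrowOf X C i z ≫ t (X.RB.obj z) := by
  rw [hi.nat, arrowOf]
  simp only [Functor.map_comp, Category.assoc]
  rw [reassoc_of% hd, ht.nat]

theorem arrow_comul (hi : EqualizesOmega X t C i) (ht : TorsorLaws X t) (hd : IsComul X t C i d)
    (z : X.T) : arrowOf X C i z ≫ X.RA.map (X.NB.map (un X.adjB (X.RB.obj z))) =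
      d (X.RA.obj z) ≫ C.map (arrowOf X C i z) ≫
        arrowOf X C i (X.NB.obj (X.RB.obj z)) := by
  rw [arrowOf.eq_def X C i (X.NB.obj (X.RB.obj z)), ← ht.counitA,
    ← reassoc_of% hi.comul_arrow ht hd]

/-- The lift exists by coassociativity and `counitB`. It is a section of ξ by `counitA` and a
triangle identity for B, a retraction by the fork equation and a triangle identity for A. -/
theorem exists_arrow_inv (hi : EqualizesOmega X t C i) (ht : TorsorLaws X t) (z : X.T) :
    ∃ k : X.RA.obj (X.NB.obj (X.RB.obj z)) ⟶ C.obj (X.RA.obj z),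
      k ≫ i (X.RA.obj z) = t (X.RB.obj z) ≫
        X.RA.map (X.NB.map (X.RB.map (X.NA.map (X.RA.map (co X.adjB z))))) ∧
      k ≫ arrowOf X C i z = 𝟙 _ ∧ arrowOf X C i z ≫ k = 𝟙 _ := by
  have h1 := map_sq X.RA (map_sq X.NB (map_sq X.RB (map_sq X.NA (AdjObj.coB_nat
    (X.NA.map (X.RA.map (co X.adjB z)))))))
  have h2 := map_tri X.RA (map_tri X.NB (map_tri X.RB (map_tri X.NA
    (ht.counitB (X.RB.obj z)))))
  have h3 := map_sq X.RA (map_sq X.NB (map_sq X.RB (map_sq X.NA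
    (un_nat X.adjA (X.RA.map (co X.adjB z))))))
  obtain ⟨k, hk⟩ := (hi.equalizes (X.RA.obj z)).lift (t (X.RB.obj z) ≫
      X.RA.map (X.NB.map (X.RB.map (X.NA.map (X.RA.map (co X.adjB z)))))) (by
    rw [Category.assoc, Category.assoc, reassoc_of% ht.nat, h1, h3,
      ← reassoc_of% ht.coassoc, reassoc_of% h2])
  refine ⟨k, hk, ?_, (hi.equalizes _).cancel ?_⟩
  · have h4 := map_sq X.RA (map_sq X.NB (AdjObj.coA_nat (co X.adjB z)))
    have h5 := map_tri X.RA (map_tri X.NB (un_map_co X.adjB z))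
    rw [arrowOf, reassoc_of% hk, h4, reassoc_of% ht.counitA, h5]
    simp only [CategoryTheory.Functor.map_id]
  · have h4 := map_sq X.RA (map_sq X.NB (map_sq X.RB (map_sq X.NA (AdjObj.coB_nat
      (co X.adjA z)))))
    have h5 := map_tri X.RA (map_tri X.NB (map_tri X.RB (map_tri X.NA (un_map_co X.adjA z))))
    rw [Category.assoc, hk, arrowOf, Category.assoc, reassoc_of% ht.nat, h4,
      reassoc_of% hi.w, h5]
    simp only [CategoryTheory.Functor.map_id, Category.comp_id, Category.id_comp]

end EqualizesOmega
end Torsor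

section TorsorBar

variable {A : Type u₁} [Category.{v₁} A] {B : Type u₂} [Category.{v₂} B]
  {X : AdjObj.{v₁, v₂, v₃, u₁, u₂, u₃} A B} {t : ∀ y : B, X.RA.obj (X.NB.obj y) ⟶
    X.RA.obj (X.NB.obj (X.RB.obj (X.NA.obj (X.RA.obj (X.NB.obj y)))))}

/-! ## The comonad of a pre-torsor on the second category -/

/-- A natural family `j` that is, componentwise, the equalizer of `θ^l` and `θ^r`. -/
structure EqualizesTheta (X : AdjObj.{v₁, v₂, v₃, u₁, u₂, u₃} A B)
    (t : ∀ y : B, X.RA.obj (X.NB.obj y) ⟶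
      X.RA.obj (X.NB.obj (X.RB.obj (X.NA.obj (X.RA.obj (X.NB.obj y)))))) (D : B ⥤ B)
    (j : ∀ y : B, D.obj y ⟶ X.RB.obj (X.NA.obj (X.RA.obj (X.NB.obj y)))) : Prop where
  nat : ∀ {y y' : B} (f : y ⟶ y'),
    D.map f ≫ j y' = j y ≫ X.RB.map (X.NA.map (X.RA.map (X.NB.map f)))
  equalizes : ∀ y, Equalizes (j y)
    (X.RB.map (X.NA.map (t y)) ≫
      X.RB.map (co X.adjA (X.NB.obj (X.RB.obj (X.NA.obj (X.RA.obj (X.NB.obj y)))))))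
    (un X.adjB (X.RB.obj (X.NA.obj (X.RA.obj (X.NB.obj y)))))

/-- A family `δ` with `(j j) ∘ δ = (R_B N_A τ) ∘ j`. -/
def IsComulBar (X : AdjObj.{v₁, v₂, v₃, u₁, u₂, u₃} A B)
    (t : ∀ y : B, X.RA.obj (X.NB.obj y) ⟶
      X.RA.obj (X.NB.obj (X.RB.obj (X.NA.obj (X.RA.obj (X.NB.obj y)))))) (D : B ⥤ B)
    (j : ∀ y : B, D.obj y ⟶ X.RB.obj (X.NA.obj (X.RA.obj (X.NB.obj y))))
    (d : ∀ y : B, D.obj y ⟶ D.obj (D.obj y)) : Prop :=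
  ∀ y, d y ≫ j (D.obj y) ≫ X.RB.map (X.NA.map (X.RA.map (X.NB.map (j y)))) =
    j y ≫ X.RB.map (X.NA.map (t y))

/-- A family `ε` with `η^B ∘ ε = (R_B ϵ^A N_B) ∘ j`. -/
def IsCounitBar (X : AdjObj.{v₁, v₂, v₃, u₁, u₂, u₃} A B) (D : B ⥤ B)
    (j : ∀ y : B, D.obj y ⟶ X.RB.obj (X.NA.obj (X.RA.obj (X.NB.obj y))))
    (e : ∀ y : B, D.obj y ⟶ y) : Prop :=
  ∀ y, e y ≫ un X.adjB y = j y ≫ X.RB.map (co X.adjA (X.NB.obj y))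

/-- The components of `(R_B N_A R_A ϵ^B) ∘ (j R_B)`. -/
def arrowBarOf (X : AdjObj.{v₁, v₂, v₃, u₁, u₂, u₃} A B) (D : B ⥤ B)
    (j : ∀ y : B, D.obj y ⟶ X.RB.obj (X.NA.obj (X.RA.obj (X.NB.obj y)))) (z : X.T) :
    D.obj (X.RB.obj z) ⟶ X.RB.obj (X.NA.obj (X.RA.obj z)) :=
  j (X.RB.obj z) ≫ X.RB.map (X.NA.map (X.RA.map (co X.adjB z)))

variable {D : B ⥤ B} {j : ∀ y : B, D.obj y ⟶ X.RB.obj (X.NA.obj (X.RA.obj (X.NB.obj y)))}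
  {d : ∀ y : B, D.obj y ⟶ D.obj (D.obj y)} {e : ∀ y : B, D.obj y ⟶ y}

namespace EqualizesTheta

theorem w (hj : EqualizesTheta X t D j) (y : B) : j y ≫ X.RB.map (X.NA.map (t y)) ≫
      X.RB.map (co X.adjA (X.NB.obj (X.RB.obj (X.NA.obj (X.RA.obj (X.NB.obj y)))))) =
    j y ≫ un X.adjB (X.RB.obj (X.NA.obj (X.RA.obj (X.NB.obj y)))) := (hj.equalizes y).w

theorem mono_j (hj : EqualizesTheta X t D j) (y : B) : Mono (j y) :=
  ⟨fun _ _ => (hj.equalizes y).cancel⟩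

/-- As over A, but with the inputs exchanged: the first lift uses `counitA`, the second the fork
equation, both together with coassociativity. -/
theorem exists_comul (hj : EqualizesTheta X t D j) (ht : TorsorLaws X t)
    (hA : PreservesEq X.NA) (hB : PreservesEq X.NB) :
    ∃ d : ∀ y : B, D.obj y ⟶ D.obj (D.obj y), IsComulBar X t D j d := by
  have pRA : PreservesEq X.RA := PreservesEq.of_adj X.adjA
  have pRB : PreservesEq X.RB := PreservesEq.of_adj X.adjB
  suffices h : ∀ y, ∃ d : D.obj y ⟶ D.obj (D.obj y),
      d ≫ j (D.obj y) ≫ X.RB.map (X.NA.map (X.RA.map (X.NB.map (j y)))) =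
        j y ≫ X.RB.map (X.NA.map (t y)) by
    choose d hd using h
    exact ⟨d, hd⟩
  intro y
  have h1 := map_sq X.RB (map_sq X.NA (ht.coassoc y))
  have h2 := map_tri X.RB (map_tri X.NA (ht.counitA
    (X.RB.obj (X.NA.obj (X.RA.obj (X.NB.obj y))))))
  obtain ⟨k, hk⟩ := (pRB (hA (pRA (hB (hj.equalizes y))))).lift
      (j y ≫ X.RB.map (X.NA.map (t y))) (by
    simp only [Functor.map_comp, Category.assoc]
    rw [reassoc_of% h1, h2])
  obtain ⟨l, hl⟩ := (hj.equalizes (D.obj y)).lift k (by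
    refine (pRB (hB (pRB (hA (pRA (hB (hj.equalizes y))))))).cancel ?_
    have h3 := map_sq X.RB (map_sq X.NA (ht.nat (j y)))
    rw [Category.assoc, Category.assoc, Category.assoc, ← AdjObj.coA_nat, ← un_nat,
      ← reassoc_of% h3, reassoc_of% hk, reassoc_of% hk, ← reassoc_of% h1, AdjObj.coA_nat,
      reassoc_of% hj.w, un_nat])
  exact ⟨l, by rw [reassoc_of% hl, hk]⟩

theorem exists_counit (hj : EqualizesTheta X t D j) (ht : TorsorLaws X t)
    (hB : ∀ y, Equalizes (un X.adjB y) (X.RB.map (X.NB.map (un X.adjB y)))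
      (un X.adjB (X.RB.obj (X.NB.obj y)))) :
    ∃ e : ∀ y : B, D.obj y ⟶ y, IsCounitBar X D j e := by
  refine Classical.skolem.1 fun y => (hB y).lift _ ?_
  have h1 := map_tri X.RB (map_tri X.NA (ht.counitA y))
  rw [Category.assoc, Category.assoc, un_nat, ← reassoc_of% hj.w, ← AdjObj.coA_nat,
    ← AdjObj.coA_nat, reassoc_of% h1]

theorem comul_nat (hj : EqualizesTheta X t D j) (ht : TorsorLaws X t)
    (hA : PreservesEq X.NA) (hB : PreservesEq X.NB) (hd : IsComulBar X t D j d) {y y' : B}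
    (f : y ⟶ y') : D.map f ≫ d y' = d y ≫ D.map (D.map f) := by
  have pRA : PreservesEq X.RA := PreservesEq.of_adj X.adjA
  have pRB : PreservesEq X.RB := PreservesEq.of_adj X.adjB
  refine (hj.equalizes _).cancel ((pRB (hA (pRA (hB (hj.equalizes y'))))).cancel ?_)
  have h1 := map_sq X.RB (map_sq X.NA (map_sq X.RA (map_sq X.NB (hj.nat f))))
  have h2 := map_sq X.RB (map_sq X.NA (ht.nat f))
  simp only [Category.assoc]
  rw [hd, reassoc_of% hj.nat, reassoc_of% hj.nat, h1, reassoc_of% hd, h2]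

theorem counit_nat (hB : ∀ y, Mono (un X.adjB y)) (hj : EqualizesTheta X t D j)
    (he : IsCounitBar X D j e) {y y' : B} (f : y ⟶ y') : D.map f ≫ e y' = e y ≫ f := by
  rw [← cancel_mono (un X.adjB y'), Category.assoc, Category.assoc, he, reassoc_of% hj.nat,
    un_nat, reassoc_of% he, AdjObj.coA_nat]

theorem comul_assoc (hj : EqualizesTheta X t D j) (ht : TorsorLaws X t)
    (hA : PreservesEq X.NA) (hB : PreservesEq X.NB) (hd : IsComulBar X t D j d) (y : B) :
    d y ≫ D.map (d y) = d y ≫ d (D.obj y) := by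
  have pRA : PreservesEq X.RA := PreservesEq.of_adj X.adjA
  have pRB : PreservesEq X.RB := PreservesEq.of_adj X.adjB
  refine (hj.equalizes _).cancel ((pRB (hA (pRA (hB (hj.equalizes _))))).cancel
    ((pRB (hA (pRA (hB (pRB (hA (pRA (hB (hj.equalizes y))))))))).cancel ?_))
  have h1 := congrArg (fun f => X.RB.map (X.NA.map (X.RA.map (X.NB.map f)))) (hd y)
  have h2 := map_sq X.RB (map_sq X.NA (ht.nat (j y)))
  have h3 := map_sq X.RB (map_sq X.NA (ht.coassoc y))
  simp only [Functor.map_comp] at h1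
  simp only [Category.assoc]
  rw [reassoc_of% hj.nat, h1, reassoc_of% hd, reassoc_of% hd, h3, ← h2, reassoc_of% hd]

/-- Here the fork equation of j does the work, whereas the other counit law, `comul_map_counit`,
comes from `counitA`; over A the roles are reversed. -/
theorem comul_counit (hB : ∀ y, Mono (un X.adjB y)) (hj : EqualizesTheta X t D j)
    (hd : IsComulBar X t D j d) (he : IsCounitBar X D j e) (y : B) :
    d y ≫ e (D.obj y) = 𝟙 _ := by
  have := hj.mono_j y
  rw [← cancel_mono (j y), ← cancel_mono (un X.adjB _), Category.assoc, Category.assoc,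
    Category.assoc, un_nat, reassoc_of% he, ← AdjObj.coA_nat, reassoc_of% hd, hj.w,
    Category.id_comp, un_nat]

theorem comul_map_counit (hA : PreservesEq X.NA) (hB : PreservesEq X.NB)
    (hB' : ∀ y, Equalizes (un X.adjB y) (X.RB.map (X.NB.map (un X.adjB y)))
      (un X.adjB (X.RB.obj (X.NB.obj y)))) (hj : EqualizesTheta X t D j) (ht : TorsorLaws X t)
    (hd : IsComulBar X t D j d) (he : IsCounitBar X D j e) (y : B) :
    d y ≫ D.map (e y) = 𝟙 _ := by
  have pRA : PreservesEq X.RA := PreservesEq.of_adj X.adjA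
  have pRB : PreservesEq X.RB := PreservesEq.of_adj X.adjB
  refine (hj.equalizes _).cancel ((pRB (hA (pRA (hB (hB' y))))).cancel ?_)
  have h1 := map_sq X.RB (map_sq X.NA (map_sq X.RA (map_sq X.NB (he y))))
  have h2 := map_tri X.RB (map_tri X.NA (ht.counitA y))
  simp only [Category.assoc, Category.id_comp]
  rw [reassoc_of% hj.nat, h1, reassoc_of% hd, h2]

/-! ### The comonad arrow -/

theorem arrow_nat (hj : EqualizesTheta X t D j) {z w : X.T} (f : z ⟶ w) :
    D.map (X.RB.map f) ≫ arrowBarOf X D j w =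
      arrowBarOf X D j z ≫ X.RB.map (X.NA.map (X.RA.map f)) := by
  have h1 := map_sq X.RB (map_sq X.NA (AdjObj.coB_nat f))
  rw [arrowBarOf, arrowBarOf, reassoc_of% hj.nat, Category.assoc, h1]

theorem arrow_counit (he : IsCounitBar X D j e) (z : X.T) :
    arrowBarOf X D j z ≫ X.RB.map (co X.adjA z) = e (X.RB.obj z) := by
  rw [arrowBarOf, Category.assoc, AdjObj.coA_nat, ← reassoc_of% he, un_map_co, Category.comp_id]

/-- Naturality of ϵ^B brings τ next to ϵ^B, where `counitB` turns it into η^A. -/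
theorem arrow_comul (hj : EqualizesTheta X t D j) (ht : TorsorLaws X t)
    (hd : IsComulBar X t D j d) (z : X.T) :
    arrowBarOf X D j z ≫ X.RB.map (X.NA.map (un X.adjA (X.RA.obj z))) =
      d (X.RB.obj z) ≫ D.map (arrowBarOf X D j z) ≫
        arrowBarOf X D j (X.NA.obj (X.RA.obj z)) := by
  have h1 := map_sq X.RB (map_sq X.NA (AdjObj.coB_nat (X.NA.map (X.RA.map (co X.adjB z)))))
  have h2 := map_tri X.RB (map_tri X.NA (ht.counitB (X.RB.obj z)))
  have h3 := map_sq X.RB (map_sq X.NA (un_nat X.adjA (X.RA.map (co X.adjB z))))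
  rw [arrowBarOf.eq_def X D j (X.NA.obj (X.RA.obj z)), reassoc_of% hj.nat, arrowBarOf]
  simp only [Functor.map_comp, Category.assoc]
  rw [reassoc_of% hd, h1, reassoc_of% h2, h3]

/-- The transpose of `j` is inverse to the factorization of `ϵ^A N_B R_B N_A R_A N_B ∘ N_A τ`. -/
theorem exists_transpose_inv (hj : EqualizesTheta X t D j) (ht : TorsorLaws X t)
    (hB : PreservesEq X.NB) (y : B) :
    ∃ k : X.NA.obj (X.RA.obj (X.NB.obj y)) ⟶ X.NB.obj (D.obj y),
      k ≫ X.NB.map (j y) = X.NA.map (t y) ≫ co X.adjA _ ∧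
      k ≫ X.NB.map (j y) ≫ co X.adjB _ = 𝟙 _ ∧ (X.NB.map (j y) ≫ co X.adjB _) ≫ k = 𝟙 _ := by
  have h1 := map_sq X.NA (ht.coassoc y)
  have h2 := map_tri X.NA (ht.counitA (X.RB.obj (X.NA.obj (X.RA.obj (X.NB.obj y)))))
  have h4 := map_tri X.NA (ht.counitB y)
  -- N_B preserves the fork of j; the map lifts by coassociativity and `counitA`. Of the two inverse
  -- laws below, the first is `counitB` and the second the fork equation of j.
  obtain ⟨k, hk⟩ := (hB (hj.equalizes y)).lift (X.NA.map (t y) ≫ co X.adjA _) (by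
    simp only [Functor.map_comp, Category.assoc]
    rw [← reassoc_of% co_nat X.adjA, ← co_nat X.adjA, reassoc_of% h1, reassoc_of% h2, co_nat])
  refine ⟨k, hk, ?_, (hB (hj.equalizes y)).cancel ?_⟩
  · rw [reassoc_of% hk, ← co_nat X.adjA, reassoc_of% h4, map_un_co]
  · have h3 := congrArg X.NB.map (hj.w y)
    simp only [Functor.map_comp] at h3
    rw [Category.assoc, hk, Category.assoc, ← reassoc_of% co_nat X.adjB, ← co_nat X.adjB,
      reassoc_of% h3, map_un_co, Category.comp_id, Category.id_comp]

end EqualizesTheta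
end TorsorBar
/-! ## Morphisms of pairs of adjunctions, componentwise -/

namespace AdjHom

variable {A : Type u₁} [Category.{v₁} A] {B : Type u₂} [Category.{v₂} B]
  {X Y : AdjObj.{v₁, v₂, v₃, u₁, u₂, u₃} A B} (f : X ⟶ Y)

/-- Exchanging the two adjunctions. -/
def swap : X.swap ⟶ Y.swap := (swapFunctor A B).map f

/-- The components of `R_A F = R'_A`. -/
def ea (z : Y.T) : X.RA.obj (f.F.obj z) ⟶ Y.RA.obj z := eqc f.hA z

/-- The components of `R_B F = R'_B`. -/
def eb (z : Y.T) : X.RB.obj (f.F.obj z) ⟶ Y.RB.obj z := eqc f.hB z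

/-- The components of `a : N_A ⟶ F N'_A`. -/
def ca (x : A) : X.NA.obj x ⟶ f.F.obj (Y.NA.obj x) := cmpc X.adjA Y.adjA f.F f.hA x

/-- The components of `b : N_B ⟶ F N'_B`. -/
def cb (y : B) : X.NB.obj y ⟶ f.F.obj (Y.NB.obj y) := cmpc X.adjB Y.adjB f.F f.hB y

/-- The components of `R_B a`. -/
def ra (x : A) : X.RB.obj (X.NA.obj x) ⟶ Y.RB.obj (Y.NA.obj x) :=
  X.RB.map (ca f x) ≫ eb f (Y.NA.obj x)

/-- The components of `R_A b`. -/
def rb (y : B) : X.RA.obj (X.NB.obj y) ⟶ Y.RA.obj (Y.NB.obj y) :=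
  X.RA.map (cb f y) ≫ ea f (Y.NB.obj y)

theorem ea_nat {z w : Y.T} (m : z ⟶ w) :
    X.RA.map (f.F.map m) ≫ ea f w = ea f z ≫ Y.RA.map m := eqc_nat f.F f.hA m

theorem cb_nat {y y' : B} (m : y ⟶ y') :
    X.NB.map m ≫ cb f y' = cb f y ≫ f.F.map (Y.NB.map m) := cmpc_nat _ _ _ _ m

theorem rb_nat {y y' : B} (m : y ⟶ y') :
    X.RA.map (X.NB.map m) ≫ rb f y' = rb f y ≫ Y.RA.map (Y.NB.map m) :=
  (Rb f).naturality m

theorem ra_nat {x x' : A} (m : x ⟶ x') :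
    X.RB.map (X.NA.map m) ≫ ra f x' = ra f x ≫ Y.RB.map (Y.NA.map m) :=
  (Ra f).naturality m

theorem un_ca (x : A) : un X.adjA x ≫ X.RA.map (ca f x) ≫ ea f (Y.NA.obj x) = un Y.adjA x :=
  un_cmpc _ _ _ _ x

theorem un_cb (y : B) : un X.adjB y ≫ X.RB.map (cb f y) ≫ eb f (Y.NB.obj y) = un Y.adjB y :=
  un_cmpc _ _ _ _ y

/-- Compatibility of b with the counits ϵ^B, seen through R_A; `ra_co` is the same for the exchanged
adjunctions. -/
theorem rb_co (z : Y.T) : X.RA.map (X.NB.map (eb f z)) ≫ rb f (Y.RB.obj z) ≫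
    Y.RA.map (co Y.adjB z) = X.RA.map (co X.adjB (f.F.obj z)) ≫ ea f z := by
  have h : X.NB.map (eb f z) ≫ cb f (Y.RB.obj z) ≫ f.F.map (co Y.adjB z) =
    co X.adjB (f.F.obj z) := cmpc_co X.adjB Y.adjB f.F f.hB z
  rw [rb, Category.assoc, ← ea_nat, ← h]
  simp only [Functor.map_comp, Category.assoc]

theorem ra_co (z : Y.T) : X.RB.map (X.NA.map (ea f z)) ≫ ra f (Y.RA.obj z) ≫
    Y.RB.map (co Y.adjA z) = X.RB.map (co X.adjA (f.F.obj z)) ≫ eb f z :=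
  rb_co (swap f) z

/-- The components of `R_A b R_B a`. -/
def sig (x : A) : X.RA.obj (X.NB.obj (X.RB.obj (X.NA.obj x))) ⟶
    Y.RA.obj (Y.NB.obj (Y.RB.obj (Y.NA.obj x))) :=
  rb f (X.RB.obj (X.NA.obj x)) ≫ Y.RA.map (Y.NB.map (ra f x))

/-- The components of `R_B a R_A b`. -/
def sigBar (y : B) : X.RB.obj (X.NA.obj (X.RA.obj (X.NB.obj y))) ⟶
    Y.RB.obj (Y.NA.obj (Y.RA.obj (Y.NB.obj y))) :=
  ra f (X.RA.obj (X.NB.obj y)) ≫ Y.RB.map (Y.NA.map (rb f y))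

theorem sig_nat {x x' : A} (m : x ⟶ x') :
    X.RA.map (X.NB.map (X.RB.map (X.NA.map m))) ≫ sig f x' =
      sig f x ≫ Y.RA.map (Y.NB.map (Y.RB.map (Y.NA.map m))) := by
  rw [sig, sig, reassoc_of% rb_nat f, Category.assoc, map_sq Y.RA (map_sq Y.NB (ra_nat f m))]

theorem sigBar_nat {y y' : B} (m : y ⟶ y') :
    X.RB.map (X.NA.map (X.RA.map (X.NB.map m))) ≫ sigBar f y' =
      sigBar f y ≫ Y.RB.map (Y.NA.map (Y.RA.map (Y.NB.map m))) :=
  sig_nat (swap f) m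

theorem sig_co (x : A) : sig f x ≫ Y.RA.map (co Y.adjB (Y.NA.obj x)) =
    X.RA.map (co X.adjB (X.NA.obj x)) ≫ X.RA.map (ca f x) ≫ ea f (Y.NA.obj x) := by
  rw [sig, ← rb_nat, ra]
  simp only [Functor.map_comp, Category.assoc]
  rw [rb_co, reassoc_of% X.coB_nat]

theorem sigBar_co (y : B) : sigBar f y ≫ Y.RB.map (co Y.adjA (Y.NB.obj y)) =
    X.RB.map (co X.adjA (X.NB.obj y)) ≫ X.RB.map (cb f y) ≫ eb f (Y.NB.obj y) :=
  sig_co (swap f) y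

theorem sig_ea_co (z : Y.T) : sig f (X.RA.obj (f.F.obj z)) ≫
    Y.RA.map (Y.NB.map (Y.RB.map (Y.NA.map (ea f z)))) ≫
      Y.RA.map (Y.NB.map (Y.RB.map (co Y.adjA z))) =
    X.RA.map (X.NB.map (X.RB.map (co X.adjA (f.F.obj z)))) ≫ X.RA.map (X.NB.map (eb f z)) ≫
      rb f (Y.RB.obj z) := by
  have h := congrArg (fun m => Y.RA.map (Y.NB.map m)) (ra_co f z)
  simp only [Functor.map_comp] at h
  rw [sig, Category.assoc, ← reassoc_of% map_sq Y.RA (map_sq Y.NB (ra_nat f (ea f z))), h,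
    rb_nat, reassoc_of% rb_nat f]

end AdjHom

open AdjHom

/-! ### Comonad maps induced by a morphism of pre-torsors -/

section TorsorHom

variable {A : Type u₁} [Category.{v₁} A] {B : Type u₂} [Category.{v₂} B]
  {X Y : AdjObj.{v₁, v₂, v₃, u₁, u₂, u₃} A B} {f : X ⟶ Y}
  {t : ∀ y : B, X.RA.obj (X.NB.obj y) ⟶
    X.RA.obj (X.NB.obj (X.RB.obj (X.NA.obj (X.RA.obj (X.NB.obj y)))))}
  {t' : ∀ y : B, Y.RA.obj (Y.NB.obj y) ⟶
    Y.RA.obj (Y.NB.obj (Y.RB.obj (Y.NA.obj (Y.RA.obj (Y.NB.obj y)))))}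

/-- Compatibility of `F` with pre-torsor maps, componentwise. -/
def TorsorCompat (f : X ⟶ Y) (t : ∀ y : B, X.RA.obj (X.NB.obj y) ⟶
      X.RA.obj (X.NB.obj (X.RB.obj (X.NA.obj (X.RA.obj (X.NB.obj y))))))
    (t' : ∀ y : B, Y.RA.obj (Y.NB.obj y) ⟶
      Y.RA.obj (Y.NB.obj (Y.RB.obj (Y.NA.obj (Y.RA.obj (Y.NB.obj y)))))) : Prop :=
  ∀ y, t y ≫ sig f (X.RA.obj (X.NB.obj y)) ≫
    Y.RA.map (Y.NB.map (Y.RB.map (Y.NA.map (rb f y)))) = rb f y ≫ t' y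

/-- Whiskering the morphism axiom with R_B N_A: this is the form in which it meets ω^l and Δ. -/
theorem TorsorCompat.sig_comp (h : TorsorCompat f t t') (ht' : TorsorLaws Y t') (x : A) :
    sig f x ≫ t' (Y.RB.obj (Y.NA.obj x)) = t (X.RB.obj (X.NA.obj x)) ≫
      sig f (X.RA.obj (X.NB.obj (X.RB.obj (X.NA.obj x)))) ≫
        Y.RA.map (Y.NB.map (Y.RB.map (Y.NA.map (sig f x)))) := by
  rw [sig.eq_def f x, Category.assoc, ht'.nat, ← reassoc_of% h]
  simp only [Functor.map_comp]

theorem TorsorCompat.sigBar_comp (h : TorsorCompat f t t') (y : B) :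
    sigBar f y ≫ Y.RB.map (Y.NA.map (t' y)) = X.RB.map (X.NA.map (t y)) ≫
      sigBar f (X.RB.obj (X.NA.obj (X.RA.obj (X.NB.obj y)))) ≫
        Y.RB.map (Y.NA.map (Y.RA.map (Y.NB.map (sigBar f y)))) := by
  have h1 := congrArg (fun m => Y.RB.map (Y.NA.map m)) (h y)
  simp only [Functor.map_comp, sig] at h1
  simp only [sigBar, Functor.map_comp, Category.assoc] at h1 ⊢
  rw [← h1, reassoc_of% ra_nat f]

variable {C C' : A ⥤ A} {i : ∀ x : A, C.obj x ⟶ X.RA.obj (X.NB.obj (X.RB.obj (X.NA.obj x)))}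
  {i' : ∀ x : A, C'.obj x ⟶ Y.RA.obj (Y.NB.obj (Y.RB.obj (Y.NA.obj x)))}
  {d : ∀ x : A, C.obj x ⟶ C.obj (C.obj x)} {e : ∀ x : A, C.obj x ⟶ x}
  {d' : ∀ x : A, C'.obj x ⟶ C'.obj (C'.obj x)} {e' : ∀ x : A, C'.obj x ⟶ x}
  {s : ∀ x : A, C.obj x ⟶ C'.obj x}

namespace EqualizesOmega

/-- R_A b R_B a carries the fork of i to a fork over the pair of Y: compatibility with τ handles
ω^l, and `un_ca` handles ω^r. -/
theorem exists_hom (hi : EqualizesOmega X t C i) (hi' : EqualizesOmega Y t' C' i')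
    (ht' : TorsorLaws Y t') (h : TorsorCompat f t t') :
    ∃ s : ∀ x : A, C.obj x ⟶ C'.obj x, ∀ x, s x ≫ i' x = i x ≫ sig f x := by
  refine Classical.skolem.1 fun x => (hi'.equalizes x).lift _ ?_
  have h1 := congrArg (fun m => Y.RA.map (Y.NB.map (Y.RB.map (Y.NA.map m)))) (sig_co f x)
  have h2 := congrArg (fun m => Y.RA.map (Y.NB.map (Y.RB.map (Y.NA.map m)))) (un_ca f x)
  simp only [Functor.map_comp] at h1 h2
  rw [Category.assoc, Category.assoc, reassoc_of% h.sig_comp ht' x, h1,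
    ← reassoc_of% sig_nat f, reassoc_of% hi.w, reassoc_of% sig_nat f, h2]

theorem hom_nat (hi : EqualizesOmega X t C i) (hi' : EqualizesOmega Y t' C' i')
    (hs : ∀ x, s x ≫ i' x = i x ≫ sig f x) {x x' : A} (m : x ⟶ x') :
    C.map m ≫ s x' = s x ≫ C'.map m := by
  refine (hi'.equalizes _).cancel ?_
  rw [Category.assoc, Category.assoc, hs, hi'.nat, reassoc_of% hs, reassoc_of% hi.nat, sig_nat]

theorem hom_comul (hi' : EqualizesOmega Y t' C' i')
    (ht' : TorsorLaws Y t') (hA : PreservesEq Y.NA) (hB : PreservesEq Y.NB)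
    (h : TorsorCompat f t t') (hd : IsComul X t C i d) (hd' : IsComul Y t' C' i' d')
    (hs : ∀ x, s x ≫ i' x = i x ≫ sig f x) (x : A) :
    s x ≫ d' x = d x ≫ s (C.obj x) ≫ C'.map (s x) := by
  have pRA : PreservesEq Y.RA := PreservesEq.of_adj Y.adjA
  have pRB : PreservesEq Y.RB := PreservesEq.of_adj Y.adjB
  refine (hi'.equalizes _).cancel ((pRA (hB (pRB (hA (hi'.equalizes x))))).cancel ?_)
  have h1 := map_sq Y.RA (map_sq Y.NB (map_sq Y.RB (map_sq Y.NA (hs x))))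
  simp only [Category.assoc]
  rw [hd', reassoc_of% hs, h.sig_comp ht', reassoc_of% hi'.nat, h1, reassoc_of% hs,
    ← reassoc_of% sig_nat f, reassoc_of% hd]

theorem hom_counit (hA : ∀ x, Mono (un Y.adjA x)) (he : IsCounit X C i e)
    (he' : IsCounit Y C' i' e') (hs : ∀ x, s x ≫ i' x = i x ≫ sig f x) (x : A) :
    s x ≫ e' x = e x := by
  rw [← cancel_mono (un Y.adjA x), Category.assoc, he', reassoc_of% hs, sig_co,
    ← reassoc_of% he, un_ca]

end EqualizesOmega

/-- Only naturality of i and the relation between s, i and i' enter, with no equalizer property; so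
the statement over B follows by exchanging the adjunctions. -/
theorem hom_arrow (hi : ∀ {x x' : A} (f : x ⟶ x'),
      C.map f ≫ i x' = i x ≫ X.RA.map (X.NB.map (X.RB.map (X.NA.map f))))
    (hs : ∀ x, s x ≫ i' x = i x ≫ sig f x) (z : Y.T) :
    arrowOf X C i (f.F.obj z) ≫ X.RA.map (X.NB.map (eb f z)) ≫ rb f (Y.RB.obj z) =
      C.map (ea f z) ≫ s (Y.RA.obj z) ≫ arrowOf Y C' i' z := by
  rw [arrowOf, arrowOf, reassoc_of% hs, reassoc_of% hi, reassoc_of% sig_nat f, sig_ea_co,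
    Category.assoc]

variable {D D' : B ⥤ B} {j : ∀ y : B, D.obj y ⟶ X.RB.obj (X.NA.obj (X.RA.obj (X.NB.obj y)))}
  {j' : ∀ y : B, D'.obj y ⟶ Y.RB.obj (Y.NA.obj (Y.RA.obj (Y.NB.obj y)))}
  {δ : ∀ y : B, D.obj y ⟶ D.obj (D.obj y)} {ε : ∀ y : B, D.obj y ⟶ y}
  {δ' : ∀ y : B, D'.obj y ⟶ D'.obj (D'.obj y)} {ε' : ∀ y : B, D'.obj y ⟶ y}
  {r : ∀ y : B, D.obj y ⟶ D'.obj y}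

namespace EqualizesTheta

theorem exists_hom (hj : EqualizesTheta X t D j) (hj' : EqualizesTheta Y t' D' j')
    (h : TorsorCompat f t t') :
    ∃ r : ∀ y : B, D.obj y ⟶ D'.obj y, ∀ y, r y ≫ j' y = j y ≫ sigBar f y := by
  refine Classical.skolem.1 fun y => (hj'.equalizes y).lift _ ?_
  rw [Category.assoc, Category.assoc, reassoc_of% h.sigBar_comp, Y.coA_nat,
    reassoc_of% sigBar_co f, reassoc_of% hj.w, reassoc_of% un_cb f, un_nat]

theorem hom_nat (hj : EqualizesTheta X t D j) (hj' : EqualizesTheta Y t' D' j')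
    (hr : ∀ y, r y ≫ j' y = j y ≫ sigBar f y) {y y' : B} (m : y ⟶ y') :
    D.map m ≫ r y' = r y ≫ D'.map m := by
  refine (hj'.equalizes _).cancel ?_
  rw [Category.assoc, Category.assoc, hr, hj'.nat, reassoc_of% hr, reassoc_of% hj.nat,
    sigBar_nat]

theorem hom_comul (hj' : EqualizesTheta Y t' D' j')
    (hA : PreservesEq Y.NA) (hB : PreservesEq Y.NB)
    (h : TorsorCompat f t t') (hd : IsComulBar X t D j δ) (hd' : IsComulBar Y t' D' j' δ')
    (hr : ∀ y, r y ≫ j' y = j y ≫ sigBar f y) (y : B) :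
    r y ≫ δ' y = δ y ≫ r (D.obj y) ≫ D'.map (r y) := by
  have pRA : PreservesEq Y.RA := PreservesEq.of_adj Y.adjA
  have pRB : PreservesEq Y.RB := PreservesEq.of_adj Y.adjB
  refine (hj'.equalizes _).cancel ((pRB (hA (pRA (hB (hj'.equalizes y))))).cancel ?_)
  have h1 := map_sq Y.RB (map_sq Y.NA (map_sq Y.RA (map_sq Y.NB (hr y))))
  simp only [Category.assoc]
  rw [hd', reassoc_of% hr, h.sigBar_comp, reassoc_of% hj'.nat, h1, reassoc_of% hr,
    ← reassoc_of% sigBar_nat f, reassoc_of% hd]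

theorem hom_counit (hB : ∀ y, Mono (un Y.adjB y)) (he : IsCounitBar X D j ε)
    (he' : IsCounitBar Y D' j' ε') (hr : ∀ y, r y ≫ j' y = j y ≫ sigBar f y) (y : B) :
    r y ≫ ε' y = ε y := by
  rw [← cancel_mono (un Y.adjB y), Category.assoc, he', reassoc_of% hr, sigBar_co,
    ← reassoc_of% he, un_cb]

end EqualizesTheta

theorem hom_arrowBar (hj : ∀ {y y' : B} (f : y ⟶ y'),
      D.map f ≫ j y' = j y ≫ X.RB.map (X.NA.map (X.RA.map (X.NB.map f))))
    (hr : ∀ y, r y ≫ j' y = j y ≫ sigBar f y) (z : Y.T) :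
    arrowBarOf X D j (f.F.obj z) ≫ X.RB.map (X.NA.map (ea f z)) ≫ ra f (Y.RA.obj z) =
      D.map (eb f z) ≫ r (Y.RB.obj z) ≫ arrowBarOf Y D' j' z :=
  hom_arrow (f := swap f) hj hr z

end TorsorHom

section RegularArrow

variable {A : Type u₁} [Category.{v₁} A] {B : Type u₂} [Category.{v₂} B]

/-! ## Invertible comonad arrows, componentwise -/

/-- A comonad arrow `ξ` with inverse `ξi`. -/
structure ArrowLaws (X : AdjObj.{v₁, v₂, v₃, u₁, u₂, u₃} A B) (C : A ⥤ A)
    (d : ∀ x : A, C.obj x ⟶ C.obj (C.obj x)) (e : ∀ x : A, C.obj x ⟶ x)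
    (ξ : ∀ z : X.T, C.obj (X.RA.obj z) ⟶ X.RA.obj (X.NB.obj (X.RB.obj z)))
    (ξi : ∀ z : X.T, X.RA.obj (X.NB.obj (X.RB.obj z)) ⟶ C.obj (X.RA.obj z)) : Prop where
  d_nat : ∀ {x x' : A} (m : x ⟶ x'), C.map m ≫ d x' = d x ≫ C.map (C.map m)
  e_nat : ∀ {x x' : A} (m : x ⟶ x'), C.map m ≫ e x' = e x ≫ m
  nat : ∀ {z w : X.T} (m : z ⟶ w), C.map (X.RA.map m) ≫ ξ w =
    ξ z ≫ X.RA.map (X.NB.map (X.RB.map m))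
  hom_inv : ∀ z, ξ z ≫ ξi z = 𝟙 _
  inv_hom : ∀ z, ξi z ≫ ξ z = 𝟙 _
  counit : ∀ z, ξ z ≫ X.RA.map (co X.adjB z) = e (X.RA.obj z)
  comul : ∀ z, ξ z ≫ X.RA.map (X.NB.map (un X.adjB (X.RB.obj z))) =
    d (X.RA.obj z) ≫ C.map (ξ z) ≫ ξ (X.NB.obj (X.RB.obj z))

/-- The components of `(ξ N_A) ∘ (C η^A)`. -/
def inclOf (X : AdjObj.{v₁, v₂, v₃, u₁, u₂, u₃} A B) (C : A ⥤ A)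
    (ξ : ∀ z : X.T, C.obj (X.RA.obj z) ⟶ X.RA.obj (X.NB.obj (X.RB.obj z))) (x : A) :
    C.obj x ⟶ X.RA.obj (X.NB.obj (X.RB.obj (X.NA.obj x))) :=
  C.map (un X.adjA x) ≫ ξ (X.NA.obj x)

/-- The components of the coaction `(ξ⁻¹ N_B) ∘ (R_A N_B η^B)`. -/
def coactOf (X : AdjObj.{v₁, v₂, v₃, u₁, u₂, u₃} A B) (C : A ⥤ A)
    (ξi : ∀ z : X.T, X.RA.obj (X.NB.obj (X.RB.obj z)) ⟶ C.obj (X.RA.obj z)) (y : B) :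
    X.RA.obj (X.NB.obj y) ⟶ C.obj (X.RA.obj (X.NB.obj y)) :=
  X.RA.map (X.NB.map (un X.adjB y)) ≫ ξi (X.NB.obj y)

/-- The components of `tauOfArr`. -/
def tauOf (X : AdjObj.{v₁, v₂, v₃, u₁, u₂, u₃} A B) (C : A ⥤ A)
    (ξ : ∀ z : X.T, C.obj (X.RA.obj z) ⟶ X.RA.obj (X.NB.obj (X.RB.obj z)))
    (ξi : ∀ z : X.T, X.RA.obj (X.NB.obj (X.RB.obj z)) ⟶ C.obj (X.RA.obj z)) (y : B) :
    X.RA.obj (X.NB.obj y) ⟶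
      X.RA.obj (X.NB.obj (X.RB.obj (X.NA.obj (X.RA.obj (X.NB.obj y))))) :=
  coactOf X C ξi y ≫ inclOf X C ξ (X.RA.obj (X.NB.obj y))

variable {X : AdjObj.{v₁, v₂, v₃, u₁, u₂, u₃} A B} {C : A ⥤ A}
  {d : ∀ x : A, C.obj x ⟶ C.obj (C.obj x)} {e : ∀ x : A, C.obj x ⟶ x}
  {ξ : ∀ z : X.T, C.obj (X.RA.obj z) ⟶ X.RA.obj (X.NB.obj (X.RB.obj z))}
  {ξi : ∀ z : X.T, X.RA.obj (X.NB.obj (X.RB.obj z)) ⟶ C.obj (X.RA.obj z)}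

theorem inclOf_nat (nat : ∀ {z w : X.T} (m : z ⟶ w), C.map (X.RA.map m) ≫ ξ w =
      ξ z ≫ X.RA.map (X.NB.map (X.RB.map m))) {x x' : A} (m : x ⟶ x') :
    C.map m ≫ inclOf X C ξ x' =
      inclOf X C ξ x ≫ X.RA.map (X.NB.map (X.RB.map (X.NA.map m))) := by
  rw [inclOf, inclOf, reassoc_of% map_sq C (un_nat X.adjA m), nat, Category.assoc]

/-- With `inclOf_arrowOf`, the bijection given by N_A ⊣ R_A between natural families ξ : C R_A ⟶ R_A
N_B R_B and i : C ⟶ R_A N_B R_B N_A. -/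
theorem arrowOf_inclOf (nat : ∀ {z w : X.T} (m : z ⟶ w), C.map (X.RA.map m) ≫ ξ w =
      ξ z ≫ X.RA.map (X.NB.map (X.RB.map m))) (z : X.T) : arrowOf X C (inclOf X C ξ) z = ξ z := by
  rw [arrowOf, inclOf, Category.assoc, ← nat, reassoc_of% map_tri C (un_map_co X.adjA z),
    CategoryTheory.Functor.map_id, Category.id_comp]

theorem inclOf_arrowOf {i : ∀ x : A, C.obj x ⟶ X.RA.obj (X.NB.obj (X.RB.obj (X.NA.obj x)))}
    (nat : ∀ {x x' : A} (f : x ⟶ x'),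
      C.map f ≫ i x' = i x ≫ X.RA.map (X.NB.map (X.RB.map (X.NA.map f)))) (x : A) :
    inclOf X C (arrowOf X C i) x = i x := by
  have h := map_tri X.RA (map_tri X.NB (map_tri X.RB (map_un_co X.adjA x)))
  rw [inclOf, arrowOf, reassoc_of% nat, h]
  simp only [CategoryTheory.Functor.map_id, Category.comp_id]

namespace ArrowLaws

theorem inv_nat (h : ArrowLaws X C d e ξ ξi) {z w : X.T} (m : z ⟶ w) :
    X.RA.map (X.NB.map (X.RB.map m)) ≫ ξi w = ξi z ≫ C.map (X.RA.map m) := by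
  rw [← Category.id_comp (X.RA.map (X.NB.map (X.RB.map m)) ≫ ξi w), ← h.inv_hom z,
    Category.assoc, ← reassoc_of% h.nat, h.hom_inv, Category.comp_id]

theorem coact_nat (h : ArrowLaws X C d e ξ ξi) {y y' : B} (m : y ⟶ y') :
    X.RA.map (X.NB.map m) ≫ coactOf X C ξi y' =
      coactOf X C ξi y ≫ C.map (X.RA.map (X.NB.map m)) := by
  rw [coactOf, coactOf, reassoc_of% map_sq X.RA (map_sq X.NB (un_nat X.adjB m)), h.inv_nat,
    Category.assoc]

theorem inv_comul (h : ArrowLaws X C d e ξ ξi) (z : X.T) :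
    ξi z ≫ d (X.RA.obj z) = coactOf X C ξi (X.RB.obj z) ≫ C.map (ξi z) := by
  have h1 := map_tri C (h.hom_inv z)
  rw [coactOf, Category.assoc, ← Category.id_comp (X.RA.map _ ≫ _), ← h.inv_hom z,
    Category.assoc, reassoc_of% h.comul, reassoc_of% h.hom_inv, h1,
    CategoryTheory.Functor.map_id, Category.comp_id]

/-- Coassociativity of the C-coaction on R_A N_B: the comultiplication axiom of ξ, rewritten for
ξ⁻¹. -/
theorem coact_comul (h : ArrowLaws X C d e ξ ξi) (y : B) :
    coactOf X C ξi y ≫ d (X.RA.obj (X.NB.obj y)) =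
      coactOf X C ξi y ≫ C.map (coactOf X C ξi y) := by
  rw [coactOf.eq_def X C ξi y, Category.assoc, h.inv_comul, reassoc_of% h.coact_nat, coactOf]
  simp only [Functor.map_comp, Category.assoc]

/-- The map C ⟶ R_A N_B R_B N_A is C-colinear. With coassociativity of the coaction this yields that
of τ. -/
theorem incl_coact (h : ArrowLaws X C d e ξ ξi) (x : A) :
    inclOf X C ξ x ≫ coactOf X C ξi (X.RB.obj (X.NA.obj x)) =
      d x ≫ C.map (inclOf X C ξ x) := by
  rw [inclOf, coactOf, Category.assoc, reassoc_of% h.comul, h.hom_inv, Category.comp_id,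
    reassoc_of% h.d_nat]
  simp only [Functor.map_comp]

theorem incl_counit (h : ArrowLaws X C d e ξ ξi) : IsCounit X C (inclOf X C ξ) e := by
  intro x
  rw [inclOf, Category.assoc, h.counit, h.e_nat]

theorem tau_laws (h : ArrowLaws X C d e ξ ξi) : TorsorLaws X (tauOf X C ξ ξi) where
  nat f := by
    rw [tauOf, tauOf, reassoc_of% h.coact_nat, inclOf_nat h.nat, Category.assoc]
  counitA y := by
    have h1 := arrowOf_inclOf h.nat (X.NB.obj y)
    rw [arrowOf] at h1
    rw [tauOf, Category.assoc, h1, coactOf, Category.assoc, h.inv_hom, Category.comp_id]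
  counitB y := by
    have h1 := map_tri X.RA (map_un_co X.adjB y)
    rw [tauOf, Category.assoc, ← h.incl_counit, coactOf, Category.assoc, ← h.counit,
      Category.assoc, reassoc_of% h.inv_hom, reassoc_of% h1, CategoryTheory.Functor.map_id,
      Category.id_comp]
  coassoc y := by
    rw [tauOf, tauOf, Category.assoc, Category.assoc, reassoc_of% h.incl_coact,
      reassoc_of% h.coact_comul, ← inclOf_nat h.nat]
    simp only [Functor.map_comp, Category.assoc]

theorem tau_isComul (h : ArrowLaws X C d e ξ ξi) :
    IsComul X (tauOf X C ξ ξi) C (inclOf X C ξ) d := by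
  intro x
  rw [← inclOf_nat h.nat, tauOf, reassoc_of% h.incl_coact]

theorem coact_map_co (h : ArrowLaws X C d e ξ ξi) (z : X.T) :
    coactOf X C ξi (X.RB.obj z) ≫ C.map (X.RA.map (co X.adjB z)) = ξi z := by
  rw [coactOf, Category.assoc, ← h.inv_nat,
    reassoc_of% map_tri X.RA (map_tri X.NB (un_map_co X.adjB z))]
  simp only [CategoryTheory.Functor.map_id, Category.id_comp]

/-- C preserves the fork of η^A, and ξ is an isomorphism from its image to the pair ω^l, ω^r. -/
theorem equalizesOmega (h : ArrowLaws X C d e ξ ξi) (hC : PreservesEq C)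
    (hA : ∀ x, Equalizes (un X.adjA x) (X.RA.map (X.NA.map (un X.adjA x)))
      (un X.adjA (X.RA.obj (X.NA.obj x)))) :
    EqualizesOmega X (tauOf X C ξ ξi) C (inclOf X C ξ) := by
  refine ⟨inclOf_nat h.nat, fun x => ?_⟩
  have i1 : ∀ z, IsIso (ξ z) := fun z => ⟨ξi z, h.hom_inv z, h.inv_hom z⟩
  have key := hC (hA x)
  -- The pair is interchanged: C η^A at R_A N_A x corresponds to ω^l, and C R_A N_A η^A to ω^r.
  have sym : Equalizes (C.map (un X.adjA x)) (C.map (un X.adjA (X.RA.obj (X.NA.obj x))))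
      (C.map (X.RA.map (X.NA.map (un X.adjA x)))) :=
    ⟨key.w.symm, fun k hk => key.lift k hk.symm, key.cancel⟩
  refine sym.comp_iso (ξ (X.NA.obj x)) (ξ (X.NA.obj (X.RA.obj (X.NA.obj x)))) rfl ?_
    (h.nat _).symm
  rw [tauOf, Category.assoc, ← inclOf_nat h.nat, reassoc_of% h.coact_map_co,
    reassoc_of% h.hom_inv, inclOf]

end ArrowLaws

/-- A pre-torsor map is recovered from its comonad arrow. -/
theorem EqualizesOmega.tauOf_arrowOf {t : ∀ y : B, X.RA.obj (X.NB.obj y) ⟶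
      X.RA.obj (X.NB.obj (X.RB.obj (X.NA.obj (X.RA.obj (X.NB.obj y)))))}
    {i : ∀ x : A, C.obj x ⟶ X.RA.obj (X.NB.obj (X.RB.obj (X.NA.obj x)))}
    (hi : EqualizesOmega X t C i) (ht : TorsorLaws X t)
    (hom_inv : ∀ z, arrowOf X C i z ≫ ξi z = 𝟙 _)
    (y : B) : tauOf X C (arrowOf X C i) ξi y = t y := by
  -- The given inverse of ξ must be the explicit one of `exists_arrow_inv`, whose composite with i
  -- is known.
  have h1 : ∀ z, ξi z ≫ i (X.RA.obj z) = t (X.RB.obj z) ≫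
      X.RA.map (X.NB.map (X.RB.map (X.NA.map (X.RA.map (co X.adjB z))))) := by
    intro z
    obtain ⟨k, hk, h2, h3⟩ := hi.exists_arrow_inv ht z
    rw [← hk, ← Category.comp_id k, ← hom_inv z, reassoc_of% h2]
  have h4 := map_tri X.RA (map_tri X.NB (map_tri X.RB (map_tri X.NA (map_tri X.RA
    (map_un_co X.adjB y)))))
  rw [tauOf, inclOf_arrowOf hi.nat, coactOf, Category.assoc, h1, reassoc_of% ht.nat, h4]
  simp only [CategoryTheory.Functor.map_id, Category.comp_id]

/-! ### Morphisms -/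

section Hom

variable {Y : AdjObj.{v₁, v₂, v₃, u₁, u₂, u₃} A B} {f : X ⟶ Y} {C' : A ⥤ A}
  {d' : ∀ x : A, C'.obj x ⟶ C'.obj (C'.obj x)} {e' : ∀ x : A, C'.obj x ⟶ x}
  {ξ' : ∀ z : Y.T, C'.obj (Y.RA.obj z) ⟶ Y.RA.obj (Y.NB.obj (Y.RB.obj z))}
  {ξi' : ∀ z : Y.T, Y.RA.obj (Y.NB.obj (Y.RB.obj z)) ⟶ C'.obj (Y.RA.obj z)}
  {s : ∀ x : A, C.obj x ⟶ C'.obj x}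

/-- The transpose of the square for (F, t). When the second map is monic it determines t from F. -/
theorem incl_hom
    (nat : ∀ {z w : X.T} (m : z ⟶ w), C.map (X.RA.map m) ≫ ξ w =
      ξ z ≫ X.RA.map (X.NB.map (X.RB.map m)))
    (s_nat : ∀ {x x' : A} (m : x ⟶ x'), C.map m ≫ s x' = s x ≫ C'.map m)
    (comm : ∀ z, ξ (f.F.obj z) ≫ X.RA.map (X.NB.map (eb f z)) ≫ rb f (Y.RB.obj z) =
      C.map (ea f z) ≫ s (Y.RA.obj z) ≫ ξ' z) (x : A) :
    s x ≫ inclOf Y C' ξ' x = inclOf X C ξ x ≫ sig f x := by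
  rw [inclOf, ← reassoc_of% s_nat, ← un_ca f x]
  simp only [Functor.map_comp, Category.assoc]
  rw [← comm, reassoc_of% nat, sig, ← rb_nat, inclOf, ra]
  simp only [Functor.map_comp, Category.assoc]

/-- R_A b respects the coactions; after cancelling the invertible ξ' this is the square for (F, t)
and the compatibility of b with the units. -/
theorem ArrowLaws.coact_hom (h : ArrowLaws X C d e ξ ξi) (h' : ArrowLaws Y C' d' e' ξ' ξi')
    (comm : ∀ z, ξ (f.F.obj z) ≫ X.RA.map (X.NB.map (eb f z)) ≫ rb f (Y.RB.obj z) =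
      C.map (ea f z) ≫ s (Y.RA.obj z) ≫ ξ' z) (y : B) :
    coactOf X C ξi y ≫ C.map (rb f y) ≫ s (Y.RA.obj (Y.NB.obj y)) =
      rb f y ≫ coactOf Y C' ξi' y := by
  have i1 : ∀ z, IsIso (ξ' z) := fun z => ⟨ξi' z, h'.hom_inv z, h'.inv_hom z⟩
  have h1 := congrArg (fun m => X.RA.map (X.NB.map m)) (un_cb f y)
  simp only [Functor.map_comp] at h1
  rw [← cancel_mono (ξ' (Y.NB.obj y)), coactOf, coactOf, rb.eq_def f y]
  simp only [Functor.map_comp, Category.assoc]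
  rw [h'.inv_hom, Category.comp_id, ← comm, reassoc_of% h.nat, reassoc_of% h.inv_hom,
    reassoc_of% h1, rb_nat, rb, Category.assoc]

theorem ArrowLaws.tau_compat (h : ArrowLaws X C d e ξ ξi) (h' : ArrowLaws Y C' d' e' ξ' ξi')
    (s_nat : ∀ {x x' : A} (m : x ⟶ x'), C.map m ≫ s x' = s x ≫ C'.map m)
    (comm : ∀ z, ξ (f.F.obj z) ≫ X.RA.map (X.NB.map (eb f z)) ≫ rb f (Y.RB.obj z) =
      C.map (ea f z) ≫ s (Y.RA.obj z) ≫ ξ' z) :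
    TorsorCompat f (tauOf X C ξ ξi) (tauOf Y C' ξ' ξi') := by
  intro y
  rw [tauOf, tauOf, ← reassoc_of% h.coact_hom h' comm, incl_hom h.nat s_nat comm, Category.assoc,
    reassoc_of% inclOf_nat h.nat, sig_nat]

end Hom
end RegularArrow

section CoregularArrow

variable {A : Type u₁} [Category.{v₁} A] {B : Type u₂} [Category.{v₂} B]

/-! ## Co-regular comonad arrows, componentwise -/

/-- The components of `(ζ N_B) ∘ (D η^B)`. -/
def inclBarOf (X : AdjObj.{v₁, v₂, v₃, u₁, u₂, u₃} A B) (D : B ⥤ B)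
    (ζ : ∀ z : X.T, D.obj (X.RB.obj z) ⟶ X.RB.obj (X.NA.obj (X.RA.obj z))) (y : B) :
    D.obj y ⟶ X.RB.obj (X.NA.obj (X.RA.obj (X.NB.obj y))) :=
  D.map (un X.adjB y) ≫ ζ (X.NB.obj y)

/-- The transpose `(ϵ^B N_A R_A N_B) ∘ (N_B j)` of `j`. -/
def transposeOf (X : AdjObj.{v₁, v₂, v₃, u₁, u₂, u₃} A B) (D : B ⥤ B)
    (j : ∀ y : B, D.obj y ⟶ X.RB.obj (X.NA.obj (X.RA.obj (X.NB.obj y)))) (y : B) :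
    X.NB.obj (D.obj y) ⟶ X.NA.obj (X.RA.obj (X.NB.obj y)) :=
  X.NB.map (j y) ≫ co X.adjB (X.NA.obj (X.RA.obj (X.NB.obj y)))

/-- A comonad arrow `ζ` such that the transpose of `(ζ N_B) ∘ (D η^B)` has the inverse `ζi`. -/
structure ArrowBarLaws (X : AdjObj.{v₁, v₂, v₃, u₁, u₂, u₃} A B) (D : B ⥤ B)
    (d : ∀ y : B, D.obj y ⟶ D.obj (D.obj y)) (e : ∀ y : B, D.obj y ⟶ y)
    (ζ : ∀ z : X.T, D.obj (X.RB.obj z) ⟶ X.RB.obj (X.NA.obj (X.RA.obj z)))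
    (ζi : ∀ y : B, X.NA.obj (X.RA.obj (X.NB.obj y)) ⟶ X.NB.obj (D.obj y)) : Prop where
  d_nat : ∀ {y y' : B} (m : y ⟶ y'), D.map m ≫ d y' = d y ≫ D.map (D.map m)
  e_nat : ∀ {y y' : B} (m : y ⟶ y'), D.map m ≫ e y' = e y ≫ m
  nat : ∀ {z w : X.T} (m : z ⟶ w), D.map (X.RB.map m) ≫ ζ w =
    ζ z ≫ X.RB.map (X.NA.map (X.RA.map m))
  hom_inv : ∀ y, transposeOf X D (inclBarOf X D ζ) y ≫ ζi y = 𝟙 _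
  inv_hom : ∀ y, ζi y ≫ transposeOf X D (inclBarOf X D ζ) y = 𝟙 _
  counit : ∀ z, ζ z ≫ X.RB.map (co X.adjA z) = e (X.RB.obj z)
  comul : ∀ z, ζ z ≫ X.RB.map (X.NA.map (un X.adjA (X.RA.obj z))) =
    d (X.RB.obj z) ≫ D.map (ζ z) ≫ ζ (X.NA.obj (X.RA.obj z))

/-- The components of the coaction `(R_A ζ'⁻¹) ∘ (η^A R_A N_B)`. -/
def coactBarOf (X : AdjObj.{v₁, v₂, v₃, u₁, u₂, u₃} A B) (D : B ⥤ B)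
    (ζi : ∀ y : B, X.NA.obj (X.RA.obj (X.NB.obj y)) ⟶ X.NB.obj (D.obj y)) (y : B) :
    X.RA.obj (X.NB.obj y) ⟶ X.RA.obj (X.NB.obj (D.obj y)) :=
  un X.adjA (X.RA.obj (X.NB.obj y)) ≫ X.RA.map (ζi y)

/-- The components of `tauOfArrBar`. -/
def tauBarOf (X : AdjObj.{v₁, v₂, v₃, u₁, u₂, u₃} A B) (D : B ⥤ B)
    (j : ∀ y : B, D.obj y ⟶ X.RB.obj (X.NA.obj (X.RA.obj (X.NB.obj y))))
    (ζi : ∀ y : B, X.NA.obj (X.RA.obj (X.NB.obj y)) ⟶ X.NB.obj (D.obj y)) (y : B) :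
    X.RA.obj (X.NB.obj y) ⟶
      X.RA.obj (X.NB.obj (X.RB.obj (X.NA.obj (X.RA.obj (X.NB.obj y))))) :=
  coactBarOf X D ζi y ≫ X.RA.map (X.NB.map (j y))

variable {X : AdjObj.{v₁, v₂, v₃, u₁, u₂, u₃} A B} {D : B ⥤ B}
  {d : ∀ y : B, D.obj y ⟶ D.obj (D.obj y)} {e : ∀ y : B, D.obj y ⟶ y}
  {ζ : ∀ z : X.T, D.obj (X.RB.obj z) ⟶ X.RB.obj (X.NA.obj (X.RA.obj z))}
  {ζi : ∀ y : B, X.NA.obj (X.RA.obj (X.NB.obj y)) ⟶ X.NB.obj (D.obj y)}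

theorem inclBarOf_nat (nat : ∀ {z w : X.T} (m : z ⟶ w), D.map (X.RB.map m) ≫ ζ w =
      ζ z ≫ X.RB.map (X.NA.map (X.RA.map m))) {y y' : B} (m : y ⟶ y') :
    D.map m ≫ inclBarOf X D ζ y' =
      inclBarOf X D ζ y ≫ X.RB.map (X.NA.map (X.RA.map (X.NB.map m))) :=
  inclOf_nat (X := X.swap) nat m

theorem arrowBarOf_inclBarOf (nat : ∀ {z w : X.T} (m : z ⟶ w), D.map (X.RB.map m) ≫ ζ w =
      ζ z ≫ X.RB.map (X.NA.map (X.RA.map m))) (z : X.T) :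
    arrowBarOf X D (inclBarOf X D ζ) z = ζ z :=
  arrowOf_inclOf (X := X.swap) nat z

theorem inclBarOf_arrowBarOf
    {j : ∀ y : B, D.obj y ⟶ X.RB.obj (X.NA.obj (X.RA.obj (X.NB.obj y)))}
    (nat : ∀ {y y' : B} (f : y ⟶ y'),
      D.map f ≫ j y' = j y ≫ X.RB.map (X.NA.map (X.RA.map (X.NB.map f)))) (y : B) :
    inclBarOf X D (arrowBarOf X D j) y = j y :=
  inclOf_arrowOf (X := X.swap) nat y

theorem un_map_transposeOf (j : ∀ y : B, D.obj y ⟶ X.RB.obj (X.NA.obj (X.RA.obj (X.NB.obj y))))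
    (y : B) : un X.adjB (D.obj y) ≫ X.RB.map (transposeOf X D j y) = j y := by
  rw [transposeOf, Functor.map_comp, ← reassoc_of% un_nat X.adjB, un_map_co, Category.comp_id]

namespace ArrowBarLaws

theorem transpose_nat (h : ArrowBarLaws X D d e ζ ζi) {y y' : B} (m : y ⟶ y') :
    X.NB.map (D.map m) ≫ transposeOf X D (inclBarOf X D ζ) y' =
      transposeOf X D (inclBarOf X D ζ) y ≫ X.NA.map (X.RA.map (X.NB.map m)) := by
  rw [transposeOf, transposeOf, reassoc_of% map_sq X.NB (inclBarOf_nat h.nat m), co_nat,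
    Category.assoc]

theorem inv_nat (h : ArrowBarLaws X D d e ζ ζi) {y y' : B} (m : y ⟶ y') :
    X.NA.map (X.RA.map (X.NB.map m)) ≫ ζi y' = ζi y ≫ X.NB.map (D.map m) := by
  rw [← Category.id_comp (X.NA.map (X.RA.map (X.NB.map m)) ≫ ζi y'), ← h.inv_hom y,
    Category.assoc, ← reassoc_of% h.transpose_nat, h.hom_inv, Category.comp_id]

theorem coact_nat (h : ArrowBarLaws X D d e ζ ζi) {y y' : B} (m : y ⟶ y') :
    X.RA.map (X.NB.map m) ≫ coactBarOf X D ζi y' =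
      coactBarOf X D ζi y ≫ X.RA.map (X.NB.map (D.map m)) := by
  rw [coactBarOf, coactBarOf, reassoc_of% un_nat X.adjA, map_sq X.RA (h.inv_nat m),
    Category.assoc]

theorem incl_counit (h : ArrowBarLaws X D d e ζ ζi) : IsCounitBar X D (inclBarOf X D ζ) e := by
  intro y
  rw [inclBarOf, Category.assoc, h.counit, h.e_nat]

theorem transpose_counit (h : ArrowBarLaws X D d e ζ ζi) (y : B) :
    transposeOf X D (inclBarOf X D ζ) y ≫ co X.adjA (X.NB.obj y) = X.NB.map (e y) := by
  have h1 := map_sq X.NB (h.incl_counit y)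
  rw [transposeOf, Category.assoc, ← co_nat X.adjB, ← reassoc_of% h1, map_un_co,
    Category.comp_id]

theorem incl_comul (h : ArrowBarLaws X D d e ζ ζi) (y : B) :
    inclBarOf X D ζ y ≫ X.RB.map (X.NA.map (un X.adjA (X.RA.obj (X.NB.obj y)))) =
      d y ≫ D.map (inclBarOf X D ζ y) ≫ ζ (X.NA.obj (X.RA.obj (X.NB.obj y))) := by
  rw [inclBarOf, Category.assoc, h.comul, reassoc_of% h.d_nat]
  simp only [Functor.map_comp, Category.assoc]

/-- Expresses ζ at an arbitrary object through the invertible transpose, so that the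
comultiplication axiom can be read in terms of the latter. -/
theorem map_arrow_co (h : ArrowBarLaws X D d e ζ ζi) (z : X.T) :
    X.NB.map (ζ z) ≫ co X.adjB (X.NA.obj (X.RA.obj z)) =
      transposeOf X D (inclBarOf X D ζ) (X.RB.obj z) ≫ X.NA.map (X.RA.map (co X.adjB z)) := by
  have h1 := congrArg X.NB.map (arrowBarOf_inclBarOf h.nat z)
  rw [arrowBarOf, Functor.map_comp] at h1
  rw [transposeOf, Category.assoc, ← co_nat, reassoc_of% h1]

/-- The comultiplication axiom of ζ, transposed along N_B ⊣ R_B, with the inner transpose cancelled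
against its inverse. Coassociativity of the coaction and `incl_coact` are both consequences. -/
theorem transpose_coact (h : ArrowBarLaws X D d e ζ ζi) (y : B) :
    transposeOf X D (inclBarOf X D ζ) y ≫ X.NA.map (coactBarOf X D ζi y) =
      X.NB.map (d y) ≫ transposeOf X D (inclBarOf X D ζ) (D.obj y) := by
  have h1 := congrArg X.NB.map (h.incl_comul y)
  simp only [Functor.map_comp] at h1
  have h2 := map_tri X.NA (map_tri X.RA (h.hom_inv y))
  have h3 : X.NA.map (X.RA.map (X.NB.map (inclBarOf X D ζ y))) ≫
      X.NA.map (X.RA.map (co X.adjB (X.NA.obj (X.RA.obj (X.NB.obj y))))) =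
      X.NA.map (X.RA.map (transposeOf X D (inclBarOf X D ζ) y)) :=
    map_tri X.NA (map_tri X.RA rfl)
  have h4 : transposeOf X D (inclBarOf X D ζ) y ≫
      X.NA.map (un X.adjA (X.RA.obj (X.NB.obj y))) =
      X.NB.map (d y) ≫ transposeOf X D (inclBarOf X D ζ) (D.obj y) ≫
        X.NA.map (X.RA.map (transposeOf X D (inclBarOf X D ζ) y)) := by
    rw [transposeOf, Category.assoc, ← co_nat X.adjB, reassoc_of% h1, h.map_arrow_co,
      reassoc_of% h.transpose_nat, h3, ← transposeOf]
  rw [coactBarOf, Functor.map_comp, reassoc_of% h4, h2]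
  simp only [CategoryTheory.Functor.map_id, Category.comp_id]

theorem coact_comul (h : ArrowBarLaws X D d e ζ ζi) (y : B) :
    coactBarOf X D ζi y ≫ coactBarOf X D ζi (D.obj y) =
      coactBarOf X D ζi y ≫ X.RA.map (X.NB.map (d y)) := by
  have h1 : ζi y ≫ X.NB.map (d y) = X.NA.map (coactBarOf X D ζi y) ≫ ζi (D.obj y) := by
    rw [← Category.comp_id (X.NB.map (d y)), ← h.hom_inv, ← reassoc_of% h.transpose_coact,
      reassoc_of% h.inv_hom]
  rw [coactBarOf.eq_def X D ζi (D.obj y), reassoc_of% un_nat X.adjA, ← map_sq X.RA h1,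
    coactBarOf, Category.assoc]

theorem coact_counit (h : ArrowBarLaws X D d e ζ ζi) (y : B) :
    coactBarOf X D ζi y ≫ X.RA.map (X.NB.map (e y)) = 𝟙 _ := by
  have h1 : ζi y ≫ X.NB.map (e y) = co X.adjA (X.NB.obj y) := by
    rw [← h.transpose_counit, reassoc_of% h.inv_hom]
  rw [coactBarOf, Category.assoc, map_tri X.RA h1, un_map_co]

theorem coact_transpose (h : ArrowBarLaws X D d e ζ ζi) (y : B) :
    coactBarOf X D ζi y ≫ X.RA.map (transposeOf X D (inclBarOf X D ζ) y) = un X.adjA _ := by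
  rw [coactBarOf, Category.assoc, map_tri X.RA (h.inv_hom y)]
  simp only [CategoryTheory.Functor.map_id, Category.comp_id]

theorem incl_coact (h : ArrowBarLaws X D d e ζ ζi) (y : B) :
    inclBarOf X D ζ y ≫ X.RB.map (X.NA.map (coactBarOf X D ζi y)) =
      d y ≫ inclBarOf X D ζ (D.obj y) := by
  rw [← un_map_transposeOf (inclBarOf X D ζ) y, Category.assoc, map_sq X.RB (h.transpose_coact y),
    ← reassoc_of% un_nat X.adjB, un_map_transposeOf]

theorem tau_laws (h : ArrowBarLaws X D d e ζ ζi) :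
    TorsorLaws X (tauBarOf X D (inclBarOf X D ζ) ζi) where
  nat f := by
    rw [tauBarOf, tauBarOf, reassoc_of% h.coact_nat,
      map_sq X.RA (map_sq X.NB (inclBarOf_nat h.nat f)), Category.assoc]
  counitA y := by
    have h1 := map_sq X.RA (map_sq X.NB (h.incl_counit y))
    rw [tauBarOf, Category.assoc, ← h1, reassoc_of% h.coact_counit]
  counitB y := by
    rw [tauBarOf, Category.assoc, ← h.coact_transpose, transposeOf, Functor.map_comp]
  coassoc y := by
    have h1 := map_sq X.RA (map_sq X.NB (h.incl_coact y))
    have h2 := map_sq X.RA (map_sq X.NB (inclBarOf_nat h.nat (inclBarOf X D ζ y)))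
    rw [tauBarOf, tauBarOf, Category.assoc, Category.assoc, reassoc_of% h.coact_nat,
      reassoc_of% h.coact_comul, h2]
    simp only [Functor.map_comp]
    rw [reassoc_of% h1]

theorem tau_isComul (h : ArrowBarLaws X D d e ζ ζi) :
    IsComulBar X (tauBarOf X D (inclBarOf X D ζ) ζi) D (inclBarOf X D ζ) d := by
  intro y
  rw [tauBarOf, Functor.map_comp, Functor.map_comp, reassoc_of% h.incl_coact]

/-- The fork of η^B at D y, moved along R_B of the transpose, is the fork of θ^l and θ^r: η^B
followed by R_B of the transpose is j itself. -/
theorem equalizesTheta (h : ArrowBarLaws X D d e ζ ζi)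
    (hB : ∀ y, Equalizes (un X.adjB y) (X.RB.map (X.NB.map (un X.adjB y)))
      (un X.adjB (X.RB.obj (X.NB.obj y)))) :
    EqualizesTheta X (tauBarOf X D (inclBarOf X D ζ) ζi) D (inclBarOf X D ζ) := by
  refine ⟨inclBarOf_nat h.nat, fun y => ?_⟩
  have i1 : IsIso (transposeOf X D (inclBarOf X D ζ) y) := ⟨ζi y, h.hom_inv y, h.inv_hom y⟩
  have h1 : X.NA.map (tauBarOf X D (inclBarOf X D ζ) ζi y) ≫ co X.adjA _ =
      ζi y ≫ X.NB.map (inclBarOf X D ζ y) := by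
    rw [tauBarOf, Functor.map_comp, Category.assoc, co_nat, coactBarOf, Functor.map_comp,
      Category.assoc, reassoc_of% co_nat X.adjA, reassoc_of% map_un_co X.adjA]
  refine (hB (D.obj y)).comp_iso (X.RB.map (transposeOf X D (inclBarOf X D ζ) y))
    (X.RB.map (X.NB.map (X.RB.map (transposeOf X D (inclBarOf X D ζ) y))))
    (un_map_transposeOf _ _) ?_ (un_nat X.adjB _)
  rw [← X.RB.map_comp (X.NA.map _), h1, ← Functor.map_comp, reassoc_of% h.hom_inv,
    ← Functor.map_comp, ← Functor.map_comp, un_map_transposeOf]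

end ArrowBarLaws

/-- A pre-torsor map is recovered from its co-regular comonad arrow. -/
theorem EqualizesTheta.tauBarOf_eq {t : ∀ y : B, X.RA.obj (X.NB.obj y) ⟶
      X.RA.obj (X.NB.obj (X.RB.obj (X.NA.obj (X.RA.obj (X.NB.obj y)))))}
    {j : ∀ y : B, D.obj y ⟶ X.RB.obj (X.NA.obj (X.RA.obj (X.NB.obj y)))}
    (hj : EqualizesTheta X t D j) (ht : TorsorLaws X t) (hB : PreservesEq X.NB)
    (hom_inv : ∀ y, transposeOf X D j y ≫ ζi y = 𝟙 _) (y : B) : tauBarOf X D j ζi y = t y := by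
  have h1 : ζi y ≫ X.NB.map (j y) = X.NA.map (t y) ≫ co X.adjA _ := by
    obtain ⟨k, hk, h2, h3⟩ := hj.exists_transpose_inv ht hB y
    have h4 := hom_inv y
    rw [transposeOf, Category.assoc] at h4
    rw [← hk, ← Category.comp_id k, ← h4, reassoc_of% h2]
  rw [tauBarOf, coactBarOf, Category.assoc, map_sq X.RA h1, ← reassoc_of% un_nat X.adjA,
    un_map_co, Category.comp_id]

/-! ### Morphisms -/

section Hom

variable {Y : AdjObj.{v₁, v₂, v₃, u₁, u₂, u₃} A B} {f : X ⟶ Y} {D' : B ⥤ B}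
  {d' : ∀ y : B, D'.obj y ⟶ D'.obj (D'.obj y)} {e' : ∀ y : B, D'.obj y ⟶ y}
  {ζ' : ∀ z : Y.T, D'.obj (Y.RB.obj z) ⟶ Y.RB.obj (Y.NA.obj (Y.RA.obj z))}
  {ζi' : ∀ y : B, Y.NA.obj (Y.RA.obj (Y.NB.obj y)) ⟶ Y.NB.obj (D'.obj y)}
  {r : ∀ y : B, D.obj y ⟶ D'.obj y}

theorem inclBar_hom
    (nat : ∀ {z w : X.T} (m : z ⟶ w), D.map (X.RB.map m) ≫ ζ w =
      ζ z ≫ X.RB.map (X.NA.map (X.RA.map m)))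
    (r_nat : ∀ {y y' : B} (m : y ⟶ y'), D.map m ≫ r y' = r y ≫ D'.map m)
    (comm : ∀ z, ζ (f.F.obj z) ≫ X.RB.map (X.NA.map (ea f z)) ≫ ra f (Y.RA.obj z) =
      D.map (eb f z) ≫ r (Y.RB.obj z) ≫ ζ' z) (y : B) :
    r y ≫ inclBarOf Y D' ζ' y = inclBarOf X D ζ y ≫ sigBar f y :=
  incl_hom (f := swap f) nat r_nat comm y

/-- Transposing the relation between r, j and j': the counit identity `cmpc_co` removes b on the
right, leaving only a. -/
theorem transpose_hom {j : ∀ y : B, D.obj y ⟶ X.RB.obj (X.NA.obj (X.RA.obj (X.NB.obj y)))}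
    {j' : ∀ y : B, D'.obj y ⟶ Y.RB.obj (Y.NA.obj (Y.RA.obj (Y.NB.obj y)))}
    (hr : ∀ y, r y ≫ j' y = j y ≫ sigBar f y) (y : B) :
    X.NB.map (r y) ≫ cb f (D'.obj y) ≫ f.F.map (transposeOf Y D' j' y) =
      transposeOf X D j y ≫ X.NA.map (rb f y) ≫ ca f (Y.RA.obj (Y.NB.obj y)) := by
  have h1 := map_sq X.NB (hr y)
  have h2 : X.NB.map (eb f _) ≫ cb f _ ≫ f.F.map (co Y.adjB _) = co X.adjB _ :=
    cmpc_co X.adjB Y.adjB f.F f.hB (Y.NA.obj (Y.RA.obj (Y.NB.obj y)))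
  rw [transposeOf, Functor.map_comp, ← reassoc_of% cb_nat f, reassoc_of% h1, sigBar, ← ra_nat f,
    ra]
  simp only [Functor.map_comp, Category.assoc]
  rw [h2, co_nat, reassoc_of% co_nat X.adjB, transposeOf, Category.assoc]

theorem ArrowBarLaws.coact_hom (h : ArrowBarLaws X D d e ζ ζi)
    (h' : ArrowBarLaws Y D' d' e' ζ' ζi')
    (hr : ∀ y, r y ≫ inclBarOf Y D' ζ' y = inclBarOf X D ζ y ≫ sigBar f y) (y : B) :
    rb f y ≫ coactBarOf Y D' ζi' y =
      coactBarOf X D ζi y ≫ X.RA.map (X.NB.map (r y)) ≫ rb f (D'.obj y) := by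
  have h1 := map_tri f.F (h'.hom_inv y)
  have h2 : X.NA.map (rb f y) ≫ ca f (Y.RA.obj (Y.NB.obj y)) ≫ f.F.map (ζi' y) =
      ζi y ≫ X.NB.map (r y) ≫ cb f (D'.obj y) := by
    rw [← Category.comp_id (cb f (D'.obj y)), ← f.F.map_id, ← h1,
      reassoc_of% transpose_hom hr y, reassoc_of% h.inv_hom]
  have h3 := congrArg X.RA.map h2
  simp only [Functor.map_comp] at h3
  rw [coactBarOf, coactBarOf, ← un_ca f, Category.assoc, Category.assoc, ← ea_nat,
    reassoc_of% un_nat X.adjA, reassoc_of% h3, Category.assoc, rb]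

theorem ArrowBarLaws.tau_compat (h : ArrowBarLaws X D d e ζ ζi)
    (h' : ArrowBarLaws Y D' d' e' ζ' ζi')
    (r_nat : ∀ {y y' : B} (m : y ⟶ y'), D.map m ≫ r y' = r y ≫ D'.map m)
    (comm : ∀ z, ζ (f.F.obj z) ≫ X.RB.map (X.NA.map (ea f z)) ≫ ra f (Y.RA.obj z) =
      D.map (eb f z) ≫ r (Y.RB.obj z) ≫ ζ' z) :
    TorsorCompat f (tauBarOf X D (inclBarOf X D ζ) ζi)
      (tauBarOf Y D' (inclBarOf Y D' ζ') ζi') := by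
  intro y
  have hr := inclBar_hom h.nat r_nat comm
  have h1 := congrArg (fun m => X.RA.map (X.NB.map m)) (hr y)
  simp only [Functor.map_comp] at h1
  rw [tauBarOf, tauBarOf, reassoc_of% h.coact_hom h' hr, ← rb_nat, reassoc_of% h1, sigBar, sig]
  simp only [Functor.map_comp, Category.assoc]
  rw [rb_nat, reassoc_of% rb_nat f (ra f (X.RA.obj (X.NB.obj y)))]

end Hom
end CoregularArrow

/-! ### From components back to natural transformations -/

section Bridges

variable {A : Type u₁} [Category.{v₁} A] {B : Type u₂} [Category.{v₂} B]

theorem TorsorLaws.isPreTorsor {X : AdjObj.{v₁, v₂, v₃, u₁, u₂, u₃} A B}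
    {τ : X.Q ⟶ X.Q ⋙ X.P ⋙ X.Q} (h : TorsorLaws X τ.app) : IsPreTorsor X τ :=
  ⟨h.counitA, h.counitB, h.coassoc⟩

theorem PreTor.mk_congr {X : AdjObj.{v₁, v₂, v₃, u₁, u₂, u₃} A B} {τ τ' : X.Q ⟶ X.Q ⋙ X.P ⋙ X.Q}
    (h : IsPreTorsor X τ) (h' : IsPreTorsor X τ') (e : τ = τ') : PreTor.mk X τ h = ⟨X, τ', h'⟩ := by
  subst e
  rfl

theorem PreTorHom.compat {X Y : PreTor.{v₁, v₂, v₃, u₁, u₂, u₃} A B} (f : PreTorHom X Y) :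
    TorsorCompat f.f X.τ.app Y.τ.app := by
  intro y
  rw [sig, Category.assoc]
  exact (congrArg (X.τ.app y ≫ ·) (Category.assoc _ _ _)).symm.trans (NatTrans.congr_app f.comm y)

theorem TorsorCompat.comm {X Y : AdjObj.{v₁, v₂, v₃, u₁, u₂, u₃} A B} {f : X ⟶ Y}
    {τ : X.Q ⟶ X.Q ⋙ X.P ⋙ X.Q} {τ' : Y.Q ⟶ Y.Q ⋙ Y.P ⋙ Y.Q}
    (h : TorsorCompat f τ.app τ'.app) : τ ≫ (Rb f ◫ (Ra f ◫ Rb f)) = Rb f ≫ τ' := by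
  ext y
  exact h y

/-- The comonad morphism with the given components. -/
def comonadHom {C C' : Comonad A} (s : ∀ x, C.obj x ⟶ C'.obj x)
    (nat : ∀ {x x' : A} (m : x ⟶ x'), C.map m ≫ s x' = s x ≫ C'.map m)
    (counit : ∀ x, s x ≫ C'.ε.app x = C.ε.app x)
    (comul : ∀ x, s x ≫ C'.δ.app x = C.δ.app x ≫ s (C.obj x) ≫ C'.map (s x)) : C ⟶ C' :=
  ({ app := s, naturality := fun _ _ m => nat m, app_ε := counit, app_δ := comul } :
    ComonadHom C C')

theorem comonadHom_ext {C C' : Comonad A} {s t : C ⟶ C'} (h : ∀ x, s.app x = t.app x) : s = t :=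
  ComonadHom.ext (funext h)

/-- A functor over a common faithful base is the identity once it is so on objects and over the
base. -/
theorem eq_id_of_faithful {K : Type u₁} [Category.{v₁} K] {L : Type u₂} [Category.{v₂} L]
    {F : K ⥤ K} {U : K ⥤ L} [U.Faithful] (hF : F ⋙ U = U) (h : ∀ X, F.obj X = X) : F = 𝟭 K := by
  refine CategoryTheory.Functor.ext h fun X Y f => U.map_injective ?_
  have := Functor.congr_hom hF f
  simp only [Functor.comp_map] at this
  rw [this, U.map_comp, U.map_comp, eqToHom_map, eqToHom_map]
  rfl

instance : (PreTorReg.toAdj A B : PreTorReg.{v₁, v₂, v₃, u₁, u₂, u₃} A B ⥤ _).Faithful where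
  map_injective h := ObjectProperty.hom_ext _ (PreTorHom.ext h)

end Bridges

section First

variable {A : Type u₁} [Category.{v₁} A] {B : Type u₂} [Category.{v₂} B]

/-! ## From pre-torsors to regular comonad arrows -/

namespace PreTor

theorem IsComonadOf.equalizesOmega [HasEqualizers A] {X : PreTor.{v₁, v₂, v₃, u₁, u₂, u₃} A B}
    {C : Comonad A} {i : C.toFunctor ⟶ X.adj.P ⋙ X.adj.Q}
    {ξ : X.adj.RA ⋙ C.toFunctor ⟶ (X.adj.RB ⋙ X.adj.NB) ⋙ X.adj.RA} (h : X.IsComonadOf C i ξ) :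
    EqualizesOmega X.adj X.τ.app C.toFunctor i.app :=
  ⟨fun f => i.naturality f, fun x => equalizes_app h.isEqualizer x⟩

theorem exists_isComonadOf [HasEqualizers A] (X : PreTor.{v₁, v₂, v₃, u₁, u₂, u₃} A B)
    (hA : IsRegularAdj X.adj.adjA) (hB : IsRegularAdj X.adj.adjB) :
    ∃ (C : Comonad A) (i : C.toFunctor ⟶ X.adj.P ⋙ X.adj.Q)
      (ξ : X.adj.RA ⋙ C.toFunctor ⟶ (X.adj.RB ⋙ X.adj.NB) ⋙ X.adj.RA), X.IsComonadOf C i ξ := by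
  have hE : IsEqualizer (equalizer.ι X.omegaL X.omegaR) X.omegaL X.omegaR :=
    ⟨equalizer.condition _ _, ⟨equalizerIsEqualizer _ _⟩⟩
  -- Only the universal property is used from here on.
  generalize equalizer X.omegaL X.omegaR = C, equalizer.ι X.omegaL X.omegaR = i at hE
  have hi : EqualizesOmega X.adj X.τ.app C i.app :=
    ⟨fun f => i.naturality f, fun x => equalizes_app hE x⟩
  have ht := X.laws
  have pA : PreservesEq X.adj.NA := hA.preservesEq
  have pB : PreservesEq X.adj.NB := hB.preservesEq
  have mA : ∀ x, Mono (un X.adj.adjA x) := fun x => ⟨fun _ _ => (hA.equalizes x).cancel⟩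
  obtain ⟨d, hd⟩ := hi.exists_comul ht pA pB
  obtain ⟨e, he⟩ := hi.exists_counit ht hA.equalizes
  exact ⟨{ toFunctor := C
           ε := ⟨e, fun _ _ f => EqualizesOmega.counit_nat mA hi he f⟩
           δ := ⟨d, fun _ _ f => hi.comul_nat ht pA pB hd f⟩
           coassoc := hi.comul_assoc ht pA pB hd
           left_counit := EqualizesOmega.comul_counit mA hi ht hd he
           right_counit := EqualizesOmega.comul_map_counit pA pB hA.equalizes hi hd he }, i,
    ⟨arrowOf X.adj C i.app, fun _ _ f => hi.arrow_nat f⟩, hE, hd, he, fun _ => rfl⟩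

namespace IsComonadOf

variable {X : PreTor.{v₁, v₂, v₃, u₁, u₂, u₃} A B} {C : Comonad A}
  {i : C.toFunctor ⟶ X.adj.P ⋙ X.adj.Q}
  {ξ : X.adj.RA ⋙ C.toFunctor ⟶ (X.adj.RB ⋙ X.adj.NB) ⋙ X.adj.RA}

theorem app_eq (h : X.IsComonadOf C i ξ) : ξ.app = arrowOf X.adj C.toFunctor i.app :=
  funext h.arrow

variable [HasEqualizers A]

theorem isComonadArrow (h : X.IsComonadOf C i ξ) :
    IsComonadArrow C X.adj.adjB.toComonad X.adj.RA ξ := by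
  refine ⟨fun z => ?_, fun z => ?_⟩
  · rw [h.app_eq]
    exact EqualizesOmega.arrow_counit h.counit z
  · rw [h.app_eq]
    exact h.equalizesOmega.arrow_comul X.laws h.comul z

theorem isIso (h : X.IsComonadOf C i ξ) : IsIso ξ := by
  have : ∀ z, IsIso (ξ.app z) := fun z => by
    obtain ⟨k, -, h1, h2⟩ := h.equalizesOmega.exists_arrow_inv X.laws z
    rw [h.app_eq]
    exact ⟨k, h2, h1⟩
  exact NatIso.isIso_of_isIso_app ξ

theorem preserves (h : X.IsComonadOf C i ξ) (hA : IsRegularAdj X.adj.adjA)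
    (hB : IsRegularAdj X.adj.adjB) : PreservesLimitsOfShape WalkingParallelPair C.toFunctor := by
  have pNA : PreservesEq X.adj.NA := hA.preservesEq
  have pNB : PreservesEq X.adj.NB := hB.preservesEq
  have pRA : PreservesEq X.adj.RA := PreservesEq.of_adj X.adj.adjA
  have pRB : PreservesEq X.adj.RB := PreservesEq.of_adj X.adj.adjB
  have pS : PreservesEq (X.adj.P ⋙ X.adj.Q) := fun h => pRA (pNB (pRB (pNA h)))
  have pMS : PreservesEq ((X.adj.NA ⋙ X.adj.RA) ⋙ X.adj.P ⋙ X.adj.Q) :=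
    fun h => pS (pRA (pNA h))
  exact PreservesEq.preserves (PreservesEq.of_equalizes pS pMS
    fun x => equalizes_app h.isEqualizer x)

/-- A morphism of pre-torsors induces a morphism of the associated comonad arrows. -/
theorem exists_hom (h : X.IsComonadOf C i ξ) {Y : PreTor.{v₁, v₂, v₃, u₁, u₂, u₃} A B}
    {C' : Comonad A} {i' : C'.toFunctor ⟶ Y.adj.P ⋙ Y.adj.Q}
    {ξ' : Y.adj.RA ⋙ C'.toFunctor ⟶ (Y.adj.RB ⋙ Y.adj.NB) ⋙ Y.adj.RA}
    (h' : Y.IsComonadOf C' i' ξ') (hA : IsRegularAdj Y.adj.adjA) (hB : IsRegularAdj Y.adj.adjB)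
    (f : PreTorHom X Y) : ∃ t : C ⟶ C', ∀ z : Y.adj.T,
      ξ.app (f.f.F.obj z) ≫ X.adj.Q.map ((eqB f.f).app z) ≫ (Rb f.f).app (Y.adj.RB.obj z) =
        C.map ((eqA f.f).app z) ≫ t.app (Y.adj.RA.obj z) ≫ ξ'.app z := by
  have mA : ∀ x, Mono (un Y.adj.adjA x) := fun x => ⟨fun _ _ => (hA.equalizes x).cancel⟩
  have hi := h.equalizesOmega
  have hi' := h'.equalizesOmega
  obtain ⟨s, hs⟩ := hi.exists_hom hi' Y.laws f.compat
  refine ⟨comonadHom s (hi.hom_nat hi' hs) (EqualizesOmega.hom_counit mA h.counit h'.counit hs)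
    (hi'.hom_comul Y.laws hA.preservesEq hB.preservesEq f.compat h.comul h'.comul hs), ?_⟩
  rw [h.app_eq, h'.app_eq]
  exact hom_arrow hi.nat hs

end IsComonadOf

end PreTor

/-! ## From regular comonad arrows to pre-torsors -/

namespace RArrReg

theorem laws (X : RArrReg.{v₁, v₂, v₃, u₁, u₂, u₃} A B) :
    have := X.property.isIso
    ArrowLaws X.obj.adj X.obj.C.toFunctor X.obj.C.δ.app X.obj.C.ε.app X.obj.ξ.app
      (inv X.obj.ξ).app :=
  have := X.property.isIso
  { d_nat := fun m => X.obj.C.δ.naturality m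
    e_nat := fun m => X.obj.C.ε.naturality m
    nat := fun m => X.obj.ξ.naturality m
    hom_inv := fun z => by
      exact (NatTrans.comp_app X.obj.ξ (inv X.obj.ξ) z).symm.trans
        (by rw [IsIso.hom_inv_id]; rfl)
    inv_hom := fun z => by
      exact (NatTrans.comp_app (inv X.obj.ξ) X.obj.ξ z).symm.trans
        (by rw [IsIso.inv_hom_id]; rfl)
    counit := X.obj.isComonadArrow.counit
    comul := X.obj.isComonadArrow.comul }

theorem tau_app (X : RArrReg.{v₁, v₂, v₃, u₁, u₂, u₃} A B) :
    have := X.property.isIso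
    (tauOfArr X.obj.adj X.obj.ξ X.property.isIso).app =
      tauOf X.obj.adj X.obj.C.toFunctor X.obj.ξ.app (inv X.obj.ξ).app := by
  funext y
  exact (Category.assoc _ _ _).symm

theorem isPreTorsor (X : RArrReg.{v₁, v₂, v₃, u₁, u₂, u₃} A B) :
    IsPreTorsor X.obj.adj (tauOfArr X.obj.adj X.obj.ξ X.property.isIso) := by
  refine TorsorLaws.isPreTorsor ?_
  rw [X.tau_app]
  exact X.laws.tau_laws

/-- The pre-torsor of a regular comonad arrow. -/
noncomputable def toPreTor (X : RArrReg.{v₁, v₂, v₃, u₁, u₂, u₃} A B) :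
    PreTor.{v₁, v₂, v₃, u₁, u₂, u₃} A B :=
  ⟨X.obj.adj, tauOfArr X.obj.adj X.obj.ξ X.property.isIso, X.isPreTorsor⟩

/-- The natural transformation `(ξ N_A) ∘ (C η^A) : C ⟶ R_A N_B R_B N_A`. -/
def incl (X : RArrReg.{v₁, v₂, v₃, u₁, u₂, u₃} A B) :
    X.obj.C.toFunctor ⟶ X.obj.adj.P ⋙ X.obj.adj.Q where
  app := inclOf X.obj.adj X.obj.C.toFunctor X.obj.ξ.app
  naturality _ _ m := inclOf_nat X.laws.nat m

theorem equalizesOmega [HasEqualizers A] (X : RArrReg.{v₁, v₂, v₃, u₁, u₂, u₃} A B) :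
    EqualizesOmega X.obj.adj X.toPreTor.τ.app X.obj.C.toFunctor X.incl.app := by
  have hC := X.property.preserves
  have := X.laws.equalizesOmega (PreservesEq.of_preserves X.obj.C.toFunctor)
    X.property.regA.equalizes
  rwa [← X.tau_app] at this

/-- The core of ΓΩ ≅ Id: a regular comonad arrow already satisfies the description by which Γ picks
one for its pre-torsor. -/
theorem isComonadOf [HasEqualizers A] (X : RArrReg.{v₁, v₂, v₃, u₁, u₂, u₃} A B) :
    X.toPreTor.IsComonadOf X.obj.C X.incl X.obj.ξ where
  isEqualizer := isEqualizer_of_app X.equalizesOmega.equalizes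
  comul := by
    have := X.laws.tau_isComul
    rw [← X.tau_app] at this
    exact this
  counit := X.laws.incl_counit
  arrow z := (arrowOf_inclOf X.laws.nat z).symm

instance [HasEqualizers A] :
    (RArrReg.toAdj A B : RArrReg.{v₁, v₂, v₃, u₁, u₂, u₃} A B ⥤ _).Faithful where
  map_injective {X Y} := by
    rintro ⟨⟨f, s, hs⟩⟩ ⟨⟨g, t, ht⟩⟩ h
    obtain rfl : f = g := h
    refine ObjectProperty.hom_ext _ (ArrHom.ext rfl (comonadHom_ext fun x => ?_))
    refine (Y.equalizesOmega.equalizes x).cancel ?_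
    -- Both comonad maps have the same composite with the monic inclusion, one that depends on F
    -- alone.
    exact (incl_hom X.laws.nat (fun m => s.naturality m) hs x).trans
      (incl_hom X.laws.nat (fun m => t.naturality m) ht x).symm

end RArrReg

variable (A B)

/-- `Ω`, from regular comonad arrows to pre-torsors. -/
noncomputable def omega : RArrReg.{v₁, v₂, v₃, u₁, u₂, u₃} A B ⥤
    PreTorReg.{v₁, v₂, v₃, u₁, u₂, u₃} A B where
  obj X := ⟨X.toPreTor, X.property.regA, X.property.regB⟩
  map {X Y} f := ObjectProperty.homMk ⟨f.hom.f, TorsorCompat.comm (by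
    have := X.laws.tau_compat Y.laws (fun m => f.hom.t.naturality m) f.hom.comm
    rw [← X.tau_app, ← Y.tau_app] at this
    exact this)⟩

/-- `Γ`, from pre-torsors to regular comonad arrows. -/
noncomputable def gamma [HasEqualizers A] : PreTorReg.{v₁, v₂, v₃, u₁, u₂, u₃} A B ⥤
    RArrReg.{v₁, v₂, v₃, u₁, u₂, u₃} A B :=
  have h (X : PreTorReg.{v₁, v₂, v₃, u₁, u₂, u₃} A B) :=
    (X.obj.exists_isComonadOf X.property.regA X.property.regB).choose_spec.choose_spec.choose_spec
  { obj X := ⟨⟨X.obj.adj, _, _, (h X).isComonadArrow⟩,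
      (h X).isIso, X.property.regA, X.property.regB, (h X).preserves X.property.regA
        X.property.regB⟩
    map {X Y} f := ObjectProperty.homMk ⟨f.hom.f, _,
      ((h X).exists_hom (h Y) Y.property.regA Y.property.regB f.hom).choose_spec⟩
    -- The comonad maps are obtained by choice; faithfulness over Adj(A, B) makes the functor laws
    -- independent of it.
    map_id _ := (RArrReg.toAdj A B).map_injective rfl
    map_comp _ _ := (RArrReg.toAdj A B).map_injective rfl }

variable {A B}

theorem isOmega_omega : IsOmega (omega.{v₁, v₂, v₃, u₁, u₂, u₃} A B) :=
  ⟨rfl, fun X => ⟨X.isPreTorsor, rfl⟩⟩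

theorem isGamma_gamma [HasEqualizers A] : IsGamma (gamma.{v₁, v₂, v₃, u₁, u₂, u₃} A B) :=
  ⟨rfl, fun X => ⟨_, _, _, _, (X.obj.exists_isComonadOf X.property.regA
    X.property.regB).choose_spec.choose_spec.choose_spec, rfl⟩⟩

/-- Over Adj(A, B) the composite is the identity and the forgetful functor is faithful, so only the
recovery of τ on objects remains. -/
theorem gamma_omega [HasEqualizers A] :
    gamma.{v₁, v₂, v₃, u₁, u₂, u₃} A B ⋙ omega A B = 𝟭 _ := by
  refine eq_id_of_faithful (U := PreTorReg.toAdj A B) rfl fun X => ?_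
  obtain ⟨C, i, ξ, h, hi, hX⟩ := isGamma_gamma.2 X
  -- Stated for a variable Y so that the equation `hX` can be substituted although τ depends on the
  -- proof that ξ is invertible.
  have key : ∀ (Y : Arr A B) (hY : IsRegularArr A B Y), Y = ⟨X.obj.adj, C, ξ, h⟩ →
      RArrReg.toPreTor ⟨Y, hY⟩ = X.obj := by
    rintro Y hY rfl
    have hτ : tauOfArr X.obj.adj ξ hY.isIso = X.obj.τ := by
      ext y
      have := hY.isIso
      refine (congrFun (RArrReg.tau_app ⟨_, hY⟩) y).trans ?_
      have h1 := (RArrReg.laws ⟨_, hY⟩).hom_inv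
      dsimp only at h1 ⊢
      rw [hi.app_eq] at h1 ⊢
      exact hi.equalizesOmega.tauOf_arrowOf X.obj.laws h1 y
    exact PreTor.mk_congr _ _ hτ
  exact ObjectProperty.FullSubcategory.ext (key _ _ hX)

/-- The counit `Γ Ω ≅ Id`. -/
noncomputable def omegaGamma [HasEqualizers A] :
    omega.{v₁, v₂, v₃, u₁, u₂, u₃} A B ⋙ gamma A B ≅ 𝟭 _ := by
  have h (X : PreTorReg.{v₁, v₂, v₃, u₁, u₂, u₃} A B) :=
    (X.obj.exists_isComonadOf X.property.regA X.property.regB).choose_spec.choose_spec.choose_spec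
  -- Both the chosen and the given comonad belong to the pre-torsor of X, so its identity induces
  -- comonad maps in both directions; faithfulness shows them inverse and natural.
  refine NatIso.ofComponents (fun X => ⟨ObjectProperty.homMk ⟨𝟙 X.obj.adj, _,
    ((h ((omega A B).obj X)).exists_hom X.isComonadOf X.property.regA X.property.regB
      (𝟙 X.toPreTor)).choose_spec⟩, ObjectProperty.homMk ⟨𝟙 X.obj.adj, _,
    (X.isComonadOf.exists_hom (h ((omega A B).obj X)) X.property.regA X.property.regB
      (𝟙 X.toPreTor)).choose_spec⟩, ?_, ?_⟩) fun {X Y} f => ?_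
  · exact (RArrReg.toAdj A B).map_injective (Category.comp_id (𝟙 X.obj.adj))
  · exact (RArrReg.toAdj A B).map_injective (Category.comp_id (𝟙 X.obj.adj))
  · exact (RArrReg.toAdj A B).map_injective
      ((Category.comp_id f.hom.f).trans (Category.id_comp f.hom.f).symm)

end First

section Second

variable {A : Type u₁} [Category.{v₁} A] {B : Type u₂} [Category.{v₂} B]

/-! ## From pre-torsors to co-regular comonad arrows -/

namespace PreTor

theorem IsComonadBarOf.equalizesTheta [HasEqualizers B]
    {X : PreTor.{v₁, v₂, v₃, u₁, u₂, u₃} A B} {D : Comonad B}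
    {j : D.toFunctor ⟶ X.adj.Q ⋙ X.adj.P}
    {ζ : X.adj.RB ⋙ D.toFunctor ⟶ (X.adj.RA ⋙ X.adj.NA) ⋙ X.adj.RB}
    (h : X.IsComonadBarOf D j ζ) : EqualizesTheta X.adj X.τ.app D.toFunctor j.app :=
  ⟨fun f => j.naturality f, fun y => equalizes_app h.isEqualizer y⟩

theorem exists_isComonadBarOf [HasEqualizers B] (X : PreTor.{v₁, v₂, v₃, u₁, u₂, u₃} A B)
    (hA : IsRegularAdj X.adj.adjA) (hB : IsRegularAdj X.adj.adjB) :
    ∃ (D : Comonad B) (j : D.toFunctor ⟶ X.adj.Q ⋙ X.adj.P)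
      (ζ : X.adj.RB ⋙ D.toFunctor ⟶ (X.adj.RA ⋙ X.adj.NA) ⋙ X.adj.RB),
      X.IsComonadBarOf D j ζ := by
  have hE : IsEqualizer (equalizer.ι X.thetaL X.thetaR) X.thetaL X.thetaR :=
    ⟨equalizer.condition _ _, ⟨equalizerIsEqualizer _ _⟩⟩
  generalize equalizer X.thetaL X.thetaR = D, equalizer.ι X.thetaL X.thetaR = j at hE
  have hj : EqualizesTheta X.adj X.τ.app D j.app :=
    ⟨fun f => j.naturality f, fun x => equalizes_app hE x⟩
  have ht := X.laws
  have pA : PreservesEq X.adj.NA := hA.preservesEq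
  have pB : PreservesEq X.adj.NB := hB.preservesEq
  have mB : ∀ y, Mono (un X.adj.adjB y) := fun y => ⟨fun _ _ => (hB.equalizes y).cancel⟩
  obtain ⟨d, hd⟩ := hj.exists_comul ht pA pB
  obtain ⟨e, he⟩ := hj.exists_counit ht hB.equalizes
  exact ⟨{ toFunctor := D
           ε := ⟨e, fun _ _ f => EqualizesTheta.counit_nat mB hj he f⟩
           δ := ⟨d, fun _ _ f => hj.comul_nat ht pA pB hd f⟩
           coassoc := hj.comul_assoc ht pA pB hd
           left_counit := EqualizesTheta.comul_counit mB hj hd he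
           right_counit := EqualizesTheta.comul_map_counit pA pB hB.equalizes hj ht hd he }, j,
    ⟨arrowBarOf X.adj D j.app, fun _ _ f => hj.arrow_nat f⟩, hE, hd, he, fun _ => rfl⟩

end PreTor

theorem coMate_app {X : AdjObj.{v₁, v₂, v₃, u₁, u₂, u₃} A B} {D : B ⥤ B}
    (ζ : X.RB ⋙ D ⟶ (X.RA ⋙ X.NA) ⋙ X.RB) (y : B) :
    (coMate X.adjB ζ).app y = transposeOf X D (inclBarOf X D ζ.app) y := by
  rw [transposeOf, inclBarOf, Functor.map_comp, Category.assoc]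
  rfl

theorem coMate_hom_inv {X : AdjObj.{v₁, v₂, v₃, u₁, u₂, u₃} A B} {D : B ⥤ B}
    (ζ : X.RB ⋙ D ⟶ (X.RA ⋙ X.NA) ⋙ X.RB) (_ : IsIso (coMate X.adjB ζ)) (y : B) :
    transposeOf X D (inclBarOf X D ζ.app) y ≫ (inv (coMate X.adjB ζ)).app y = 𝟙 _ := by
  rw [← coMate_app]
  exact (NatTrans.comp_app (coMate X.adjB ζ) (inv _) y).symm.trans
    (by rw [IsIso.hom_inv_id]; rfl)

theorem coMate_inv_hom {X : AdjObj.{v₁, v₂, v₃, u₁, u₂, u₃} A B} {D : B ⥤ B}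
    (ζ : X.RB ⋙ D ⟶ (X.RA ⋙ X.NA) ⋙ X.RB) (_ : IsIso (coMate X.adjB ζ)) (y : B) :
    (inv (coMate X.adjB ζ)).app y ≫ transposeOf X D (inclBarOf X D ζ.app) y = 𝟙 _ := by
  rw [← coMate_app]
  exact (NatTrans.comp_app (inv _) (coMate X.adjB ζ) y).symm.trans
    (by rw [IsIso.inv_hom_id]; rfl)

/-- The last two factors of τ combine by a triangle identity: η^B D followed by R_B of the transpose
is (ζ N_B) ∘ (D η^B). -/
theorem tauOfArrBar_app {X : AdjObj.{v₁, v₂, v₃, u₁, u₂, u₃} A B} {D : B ⥤ B}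
    (ζ : X.RB ⋙ D ⟶ (X.RA ⋙ X.NA) ⋙ X.RB) (h : IsIso (coMate X.adjB ζ)) :
    (tauOfArrBar X ζ h).app =
      tauBarOf X D (inclBarOf X D ζ.app) (inv (coMate X.adjB ζ)).app := by
  funext y
  have h1 : un X.adjB (D.obj y) ≫ X.RB.map ((coMate X.adjB ζ).app y) =
      inclBarOf X D ζ.app y := by
    rw [coMate_app]
    exact un_map_transposeOf _ y
  refine Eq.trans ?_ (congrArg (coactBarOf X D _ y ≫ ·) (map_tri X.RA (map_tri X.NB h1)))
  exact (Category.assoc _ _ _).symm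

namespace PreTor.IsComonadBarOf

variable {X : PreTor.{v₁, v₂, v₃, u₁, u₂, u₃} A B} {D : Comonad B}
  {j : D.toFunctor ⟶ X.adj.Q ⋙ X.adj.P}
  {ζ : X.adj.RB ⋙ D.toFunctor ⟶ (X.adj.RA ⋙ X.adj.NA) ⋙ X.adj.RB}

theorem app_eq (h : X.IsComonadBarOf D j ζ) : ζ.app = arrowBarOf X.adj D.toFunctor j.app :=
  funext h.arrow

theorem inclBarOf_eq (h : X.IsComonadBarOf D j ζ) :
    inclBarOf X.adj D.toFunctor ζ.app = j.app := by
  rw [h.app_eq]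
  exact funext fun y => inclBarOf_arrowBarOf (fun f => j.naturality f) y

variable [HasEqualizers B]

theorem isComonadArrow (h : X.IsComonadBarOf D j ζ) :
    IsComonadArrow D X.adj.adjA.toComonad X.adj.RB ζ := by
  refine ⟨fun z => ?_, fun z => ?_⟩
  · rw [h.app_eq]
    exact EqualizesTheta.arrow_counit h.counit z
  · rw [h.app_eq]
    exact h.equalizesTheta.arrow_comul X.laws h.comul z

theorem isIso (h : X.IsComonadBarOf D j ζ) (hB : IsRegularAdj X.adj.adjB) :
    IsIso (coMate X.adj.adjB ζ) := by
  have : ∀ y, IsIso ((coMate X.adj.adjB ζ).app y) := fun y => by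
    obtain ⟨k, -, h1, h2⟩ := h.equalizesTheta.exists_transpose_inv X.laws hB.preservesEq y
    rw [coMate_app, h.inclBarOf_eq]
    exact ⟨k, h2, h1⟩
  exact NatIso.isIso_of_isIso_app _

theorem preserves (h : X.IsComonadBarOf D j ζ) (hA : IsRegularAdj X.adj.adjA)
    (hB : IsRegularAdj X.adj.adjB) : PreservesLimitsOfShape WalkingParallelPair D.toFunctor := by
  have pNA : PreservesEq X.adj.NA := hA.preservesEq
  have pNB : PreservesEq X.adj.NB := hB.preservesEq
  have pRA : PreservesEq X.adj.RA := PreservesEq.of_adj X.adj.adjA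
  have pRB : PreservesEq X.adj.RB := PreservesEq.of_adj X.adj.adjB
  have pS : PreservesEq (X.adj.Q ⋙ X.adj.P) := fun h => pRB (pNA (pRA (pNB h)))
  have pSM : PreservesEq ((X.adj.Q ⋙ X.adj.P) ⋙ X.adj.NB ⋙ X.adj.RB) :=
    fun h => pRB (pNB (pS h))
  exact PreservesEq.preserves (PreservesEq.of_equalizes pS pSM
    fun x => equalizes_app h.isEqualizer x)

/-- A morphism of pre-torsors induces a morphism of the associated comonad arrows. -/
theorem exists_hom (h : X.IsComonadBarOf D j ζ) {Y : PreTor.{v₁, v₂, v₃, u₁, u₂, u₃} A B}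
    {D' : Comonad B} {j' : D'.toFunctor ⟶ Y.adj.Q ⋙ Y.adj.P}
    {ζ' : Y.adj.RB ⋙ D'.toFunctor ⟶ (Y.adj.RA ⋙ Y.adj.NA) ⋙ Y.adj.RB}
    (h' : Y.IsComonadBarOf D' j' ζ') (hA : IsRegularAdj Y.adj.adjA)
    (hB : IsRegularAdj Y.adj.adjB) (f : PreTorHom X Y) : ∃ t : D ⟶ D', ∀ z : Y.adj.T,
      ζ.app (f.f.F.obj z) ≫ X.adj.P.map ((eqA f.f).app z) ≫ (Ra f.f).app (Y.adj.RA.obj z) =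
        D.map ((eqB f.f).app z) ≫ t.app (Y.adj.RB.obj z) ≫ ζ'.app z := by
  have mB : ∀ y, Mono (un Y.adj.adjB y) := fun y => ⟨fun _ _ => (hB.equalizes y).cancel⟩
  have hj := h.equalizesTheta
  have hj' := h'.equalizesTheta
  obtain ⟨s, hs⟩ := hj.exists_hom hj' f.compat
  refine ⟨comonadHom s (hj.hom_nat hj' hs) (EqualizesTheta.hom_counit mB h.counit h'.counit hs)
    (hj'.hom_comul hA.preservesEq hB.preservesEq f.compat h.comul h'.comul hs), ?_⟩
  rw [h.app_eq, h'.app_eq]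
  exact hom_arrowBar hj.nat hs

end PreTor.IsComonadBarOf

/-! ## From co-regular comonad arrows to pre-torsors -/

namespace RArrBarReg

theorem laws (X : RArrBarReg.{v₂, v₁, v₃, u₂, u₁, u₃} B A) :
    have := X.property.isIso
    ArrowBarLaws X.obj.adj.swap X.obj.C.toFunctor X.obj.C.δ.app X.obj.C.ε.app X.obj.ξ.app
      (inv (coMate X.obj.adj.adjA X.obj.ξ)).app :=
  have := X.property.isIso
  { d_nat := fun m => X.obj.C.δ.naturality m
    e_nat := fun m => X.obj.C.ε.naturality m
    nat := fun m => X.obj.ξ.naturality m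
    hom_inv := coMate_hom_inv (X := X.obj.adj.swap) X.obj.ξ this
    inv_hom := coMate_inv_hom (X := X.obj.adj.swap) X.obj.ξ this
    counit := X.obj.isComonadArrow.counit
    comul := X.obj.isComonadArrow.comul }

theorem tau_app (X : RArrBarReg.{v₂, v₁, v₃, u₂, u₁, u₃} B A) :
    have := X.property.isIso
    (tauOfArrBar X.obj.adj.swap X.obj.ξ X.property.isIso).app =
      tauBarOf X.obj.adj.swap X.obj.C.toFunctor
        (inclBarOf X.obj.adj.swap X.obj.C.toFunctor X.obj.ξ.app)
        (inv (coMate X.obj.adj.adjA X.obj.ξ)).app :=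
  tauOfArrBar_app (X := X.obj.adj.swap) X.obj.ξ X.property.isIso

theorem isPreTorsor (X : RArrBarReg.{v₂, v₁, v₃, u₂, u₁, u₃} B A) :
    IsPreTorsor X.obj.adj.swap (tauOfArrBar X.obj.adj.swap X.obj.ξ X.property.isIso) := by
  refine TorsorLaws.isPreTorsor ?_
  rw [X.tau_app]
  exact X.laws.tau_laws

/-- The pre-torsor of a co-regular comonad arrow. -/
noncomputable def toPreTor (X : RArrBarReg.{v₂, v₁, v₃, u₂, u₁, u₃} B A) :
    PreTor.{v₁, v₂, v₃, u₁, u₂, u₃} A B :=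
  ⟨X.obj.adj.swap, tauOfArrBar X.obj.adj.swap X.obj.ξ X.property.isIso, X.isPreTorsor⟩

/-- The natural transformation `(ζ N_B) ∘ (D η^B) : D ⟶ R_B N_A R_A N_B`. -/
def incl (X : RArrBarReg.{v₂, v₁, v₃, u₂, u₁, u₃} B A) :
    X.obj.C.toFunctor ⟶ X.obj.adj.swap.Q ⋙ X.obj.adj.swap.P where
  app := inclBarOf X.obj.adj.swap X.obj.C.toFunctor X.obj.ξ.app
  naturality _ _ m := inclBarOf_nat X.laws.nat m

theorem equalizesTheta [HasEqualizers B] (X : RArrBarReg.{v₂, v₁, v₃, u₂, u₁, u₃} B A) :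
    EqualizesTheta X.obj.adj.swap X.toPreTor.τ.app X.obj.C.toFunctor X.incl.app := by
  have := X.laws.equalizesTheta X.property.regA.equalizes
  rwa [← X.tau_app] at this

/-- As for regular arrows, this gives the isomorphism from ΓΩ to the identity. Objects over (B, A)
list the adjunction of B first; `swap` restores the order of (A, B). -/
theorem isComonadBarOf [HasEqualizers B] (X : RArrBarReg.{v₂, v₁, v₃, u₂, u₁, u₃} B A) :
    X.toPreTor.IsComonadBarOf X.obj.C X.incl X.obj.ξ where
  isEqualizer := isEqualizer_of_app X.equalizesTheta.equalizes
  comul := by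
    have := X.laws.tau_isComul
    rw [← X.tau_app] at this
    exact this
  counit := X.laws.incl_counit
  arrow z := (arrowBarOf_inclBarOf X.laws.nat z).symm

instance [HasEqualizers B] :
    (RArrBarReg.toAdj B A : RArrBarReg.{v₂, v₁, v₃, u₂, u₁, u₃} B A ⥤ _).Faithful where
  map_injective {X Y} := by
    rintro ⟨⟨f, s, hs⟩⟩ ⟨⟨g, t, ht⟩⟩ h
    obtain rfl : f = g := h
    refine ObjectProperty.hom_ext _ (ArrHom.ext rfl (comonadHom_ext fun x => ?_))
    refine (Y.equalizesTheta.equalizes x).cancel ?_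
    exact (inclBar_hom (f := swap f) X.laws.nat (fun m => s.naturality m) hs x).trans
      (inclBar_hom (f := swap f) X.laws.nat (fun m => t.naturality m) ht x).symm

end RArrBarReg

variable (A B)

/-- `Ω` for co-regular comonad arrows. -/
noncomputable def omegaBar : RArrBarReg.{v₂, v₁, v₃, u₂, u₁, u₃} B A ⥤
    PreTorReg.{v₁, v₂, v₃, u₁, u₂, u₃} A B where
  obj X := ⟨X.toPreTor, X.property.regB, X.property.regA⟩
  map {X Y} f := ObjectProperty.homMk ⟨swap f.hom.f, TorsorCompat.comm (by
    have := X.laws.tau_compat (f := swap f.hom.f) Y.laws (fun m => f.hom.t.naturality m)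
      f.hom.comm
    rw [← X.tau_app, ← Y.tau_app] at this
    exact this)⟩

/-- `Γ` for co-regular comonad arrows. -/
noncomputable def gammaBar [HasEqualizers B] : PreTorReg.{v₁, v₂, v₃, u₁, u₂, u₃} A B ⥤
    RArrBarReg.{v₂, v₁, v₃, u₂, u₁, u₃} B A :=
  have h (X : PreTorReg.{v₁, v₂, v₃, u₁, u₂, u₃} A B) :=
    (X.obj.exists_isComonadBarOf X.property.regA
      X.property.regB).choose_spec.choose_spec.choose_spec
  { obj X := ⟨⟨X.obj.adj.swap, _, _, (h X).isComonadArrow⟩,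
      (h X).isIso X.property.regB, X.property.regB, X.property.regA,
      (h X).preserves X.property.regA X.property.regB⟩
    map {X Y} f := ObjectProperty.homMk ⟨swap f.hom.f, _,
      ((h X).exists_hom (h Y) Y.property.regA Y.property.regB f.hom).choose_spec⟩
    map_id _ := (RArrBarReg.toAdj B A).map_injective rfl
    map_comp _ _ := (RArrBarReg.toAdj B A).map_injective rfl }

variable {A B}

theorem isOmegaBar_omegaBar : IsOmegaBar (omegaBar.{v₁, v₂, v₃, u₁, u₂, u₃} A B) :=
  ⟨rfl, fun X => ⟨X.isPreTorsor, rfl⟩⟩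

theorem isGammaBar_gammaBar [HasEqualizers B] :
    IsGammaBar (gammaBar.{v₁, v₂, v₃, u₁, u₂, u₃} A B) :=
  ⟨rfl, fun X => ⟨_, _, _, _, (X.obj.exists_isComonadBarOf X.property.regA
    X.property.regB).choose_spec.choose_spec.choose_spec, rfl⟩⟩

theorem gammaBar_omegaBar [HasEqualizers B] :
    gammaBar.{v₁, v₂, v₃, u₁, u₂, u₃} A B ⋙ omegaBar A B = 𝟭 _ := by
  refine eq_id_of_faithful (U := PreTorReg.toAdj A B) rfl fun X => ?_
  obtain ⟨D, j, ζ, h, hj, hX⟩ := isGammaBar_gammaBar.2 X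
  have key : ∀ (Y : Arr B A) (hY : IsCoregularArr B A Y), Y = ⟨X.obj.adj.swap, D, ζ, h⟩ →
      RArrBarReg.toPreTor ⟨Y, hY⟩ = X.obj := by
    rintro Y hY rfl
    have hτ : tauOfArrBar X.obj.adj ζ hY.isIso = X.obj.τ := by
      ext y
      have := hY.isIso
      refine (congrFun (RArrBarReg.tau_app ⟨_, hY⟩) y).trans ?_
      have h1 := (RArrBarReg.laws ⟨_, hY⟩).hom_inv
      have h2 : inclBarOf X.obj.adj.swap.swap D.toFunctor ζ.app = j.app := hj.inclBarOf_eq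
      dsimp only at h1 ⊢
      rw [h2] at h1 ⊢
      exact hj.equalizesTheta.tauBarOf_eq X.obj.laws X.property.regB.preservesEq h1 y
    exact PreTor.mk_congr _ _ hτ
  exact ObjectProperty.FullSubcategory.ext (key _ _ hX)

/-- The counit `Γ Ω ≅ Id` for co-regular comonad arrows. -/
noncomputable def omegaBarGammaBar [HasEqualizers B] :
    omegaBar.{v₁, v₂, v₃, u₁, u₂, u₃} A B ⋙ gammaBar A B ≅ 𝟭 _ := by
  have h (X : PreTorReg.{v₁, v₂, v₃, u₁, u₂, u₃} A B) :=
    (X.obj.exists_isComonadBarOf X.property.regA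
      X.property.regB).choose_spec.choose_spec.choose_spec
  refine NatIso.ofComponents (fun X => ⟨ObjectProperty.homMk ⟨𝟙 X.obj.adj, _,
    ((h ((omegaBar A B).obj X)).exists_hom X.isComonadBarOf X.property.regB X.property.regA
      (𝟙 X.toPreTor)).choose_spec⟩, ObjectProperty.homMk ⟨𝟙 X.obj.adj, _,
    (X.isComonadBarOf.exists_hom (h ((omegaBar A B).obj X)) X.property.regB X.property.regA
      (𝟙 X.toPreTor)).choose_spec⟩, ?_, ?_⟩) fun {X Y} f => ?_
  · exact (RArrBarReg.toAdj B A).map_injective (Category.comp_id (𝟙 X.obj.adj))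
  · exact (RArrBarReg.toAdj B A).map_injective (Category.comp_id (𝟙 X.obj.adj))
  · exact (RArrBarReg.toAdj B A).map_injective
      ((Category.comp_id f.hom.f).trans (Category.id_comp f.hom.f).symm)

end Second

end RegTorsor

/-! ### The two equivalences -/

theorem theorem4p11
    (A : Type u₁) [Category.{v₁} A] [HasEqualizers A]
    (B : Type u₂) [Category.{v₂} B] [HasEqualizers B] :
    (∃ e : RegTorsor.PreTorReg.{v₁, v₂, v₃, u₁, u₂, u₃} A B ≌
        RegTorsor.RArrReg.{v₁, v₂, v₃, u₁, u₂, u₃} A B,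
      RegTorsor.IsGamma e.functor ∧ RegTorsor.IsOmega e.inverse ∧
        e.functor ⋙ e.inverse = 𝟭 _) ∧
    (∃ e : RegTorsor.PreTorReg.{v₁, v₂, v₃, u₁, u₂, u₃} A B ≌
        RegTorsor.RArrBarReg.{v₂, v₁, v₃, u₂, u₁, u₃} B A,
      RegTorsor.IsGammaBar e.functor ∧ RegTorsor.IsOmegaBar e.inverse ∧
        e.functor ⋙ e.inverse = 𝟭 _) :=
  ⟨⟨CategoryTheory.Equivalence.mk (RegTorsor.gamma A B) (RegTorsor.omega A B)
      (eqToIso RegTorsor.gamma_omega.symm) RegTorsor.omegaGamma,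
    RegTorsor.isGamma_gamma, RegTorsor.isOmega_omega, RegTorsor.gamma_omega⟩,
   ⟨CategoryTheory.Equivalence.mk (RegTorsor.gammaBar A B) (RegTorsor.omegaBar A B)
      (eqToIso RegTorsor.gammaBar_omegaBar.symm) RegTorsor.omegaBarGammaBar,
    RegTorsor.isGammaBar_gammaBar, RegTorsor.isOmegaBar_omegaBar, RegTorsor.gammaBar_omegaBar⟩⟩
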